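/- \textbf{Setting.} Let $\mathcal X$ be a measurable space, $P$ a probability measure on $\mathcal X\times\mathbb R$, and $(X,Y)\sim P$. Let $(X_i,Y_i)_{1\le i\le n}$, $n\ge 1$, be i.i.d. with law $P$, and let $(I_\lambda)_{\lambda\in\Lambda_m}$ be a finite measurable partition of $\mathcal X$ with $D_m=\operatorname{card}(\Lambda_m)$. Write $\beta_\lambda=\mathbb E[Y\mid X\in I_\lambda]$, $s_m=\sum_\lambda \beta_\lambda\mathbf 1_{I_\lambda}$, $\sigma_\lambda^2=\mathbb E[(Y-s_m(X))^2\mid X\in I_\lambda]$, $m_{q,\lambda}=(\mathbb E[|Y-s_m(X)|^q\mid X\in I_\lambda])^{1/q}$, $n\widehat p_\lambda=\operatorname{card}\{i: X_i\in I_\lambda\}$, $\widehat\beta_\lambda=\frac1{n\widehat p_\lambda}\sum_{X_i\in I_\lambda}Y_i$, $\widehat s_m=\sum_\lambda\widehat\beta_\lambda\mathbf 1_{I_\lambda}$. Let $$p_2(m)=\frac1n\sum_{i=1}^n\big[(s_m(X_i)-Y_i)^2-(\widehat s_m(X_i)-Y_i)^2\big]+\frac1n\sum_{\lambda}\sigma_\lambda^2\mathbf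 1_{n\widehat p_\lambda=0}$$ (the last term is the convention used when some cell is empty). Let $\mathbb E^{\Lambda_m}$ denote expectation conditionally on $(\mathbf 1_{X_i\in I_\lambda})_{i,\lambda}$. Let $W=(W_1,\dots,W_n)$ be an exchangeable random vector independent of the data, with $W_i\ge0$ a.s., $\mathbb E[W_i]=1$ and $\mathbb E[W_i^2]<\infty$, and let $\mathbb E_W$ denote expectation with respect to $W$ only. With $\widehat W_\lambda=\frac1{n\widehat p_\lambda}\sum_{X_i\in I_\lambda}W_i$, $\widehat p^W_\lambda=\widehat p_\lambda\widehat W_\lambda$ and $\widehat\beta^W_\lambda=\frac1{n\widehat p^W_\lambda}\sum_{X_i\in I_\lambda}W_iY_i$, the resampling penalty with constant $C\ge0$ is $$\mathrm{pen}(m)=C\sum_{\lambda}\Big(\mathbb E_W\big[\widehat p_\lambda(\widehat\beta^W_\lambda-\widehat\beta_\lambda)^2\mid\widehat W_\lambda>0\big]+\mathbb E_W\big[\widehat p^W_\lambda(\widehat\beta^W_\lambda-\widehat\beta_\lambda)^2\big]\Big),$$ where the second integrand is $0$ when $\widehat p^W_\lambda=0$. For $k\in\{1,\dots,n\}$ let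 $\overline W_k=\frac1k\sum_{i\le k}W_i$ and $$R_{1,W}(n,k/n)=\mathbb E\Big[\frac{(W_1-\overline W_k)^2}{\overline W_k^2}\,\Big|\,\overline W_k>0\Big],\qquad R_{2,W}(n,k/n)=\mathbb E\Big[\frac{(W_1-\overline W_k)^2}{\overline W_k}\Big]\quad(0/0=0).$$ \textbf{Proposition 3.} Let $\gamma>0$ and $A_n\ge2$ be real numbers, and assume that for some positive constants $a_\ell,\xi_\ell$ and every real $q\ge2$ all the $m_{q,\lambda}$ are finite and $$\frac{\sqrt{D_m\sum_{\lambda}m_{q,\lambda}^4}}{\sum_{\lambda}m_{2,\lambda}^2}\le a_\ell\,q^{\xi_\ell}.$$ Let $\Omega_m(A_n)=\{\min_{\lambda}n\widehat p_\lambda\ge A_n\}$. Then there exist constants $K_4,K_5>0$ and an event of probability at least $1-K_4n^{-\gamma}$ on which $$\big|\mathrm{pen}(m)-\mathbb E^{\Lambda_m}[\mathrm{pen}(m)]\big|\mathbf 1_{\Omega_m(A_n)}\le C K_5\sup_{np\ge A_n}\{R_{1,W}(n,p)+R_{2,W}(n,p)\}\frac{(\ln n)^{\xi_\ell+1}}{\sqrt{A_nD_m}}\,\mathbb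 E[p_2(m)],$$ the supremum being over $p=k/n$ with $k\in\mathbb{N}$, $A_n\le k\le n$ (and equal to $0$ if $A_n>n$, in which case $\Omega_m(A_n)$ is empty). The constant $K_4$ is absolute and $K_5$ depends only on $a_\ell,\xi_\ell,\gamma$. If moreover $W$ is one of the following weight vectors: Efr($M$), $M\ge1$ ($(M/n)W$ is multinomial $(M;1/n,\dots,1/n)$; $C_W=M/n$); Rad($p$), $0<p<1$ ($pW_i$ i.i.d. Bernoulli($p$); $C_W=p/(1-p)$); Poi($\mu$), $\mu>0$ ($\mu W_i$ i.i.d. Poisson($\mu$); $C_W=\mu$); Rho($\lfloor n/2\rfloor$) or Loo $=$ Rho($n-1$), $n\ge2$, where Rho($q$) is $W_i=(n/q)\mathbf 1_{i\in J}$ with $J$ uniform among the subsets of $\{1,\dots,n\}$ of cardinality $q$ and $C_W=q/(n-q)$; then, on the same event, $$\big|\mathrm{pen}(m)-\mathbb E^{\Lambda_m}[\mathrm{pen}(m)]\big|\mathbf 1_{\Omega_m(A_n)}\le\frac{C K_5K_W(\ln n)^{\xi_\ell+1}}{C_W\sqrt{A_nD_m}}\,\mathbb E[p_2(m)],$$ where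 the constant $K_W>0$ depends only on the resampling scheme, is at most an absolute constant times $(1-p)^{-1}$ for Rad($p$), and is at most an absolute constant for the other weights. -/

import Mathlib

open MeasureTheory ProbabilityTheory
open scoped ENNReal BigOperators

noncomputable section

namespace HistRP

/-- `(cell l)` for `l : Λ` is a (measurable) partition of `𝒳`. -/
structure IsPartition {𝒳 Λ : Type*} [MeasurableSpace 𝒳] (cell : Λ → Set 𝒳) : Prop where
  measurableSet_cell : ∀ l, MeasurableSet (cell l)
  disjoint : Pairwise (fun l l' => Disjoint (cell l) (cell l'))
  cover : ⋃ l, cell l = Set.univ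

/-- Law of a resampling weight vector: exchangeable, a.s. nonnegative coordinates with finite
second moment and expectation one. -/
structure IsWeightLaw {n : ℕ} (ν : Measure (Fin n → ℝ)) : Prop where
  isProbabilityMeasure : IsProbabilityMeasure ν
  exchangeable : ∀ σ : Equiv.Perm (Fin n), ν.map (fun w i => w (σ i)) = ν
  nonneg : ∀ i, ∀ᵐ w ∂ν, 0 ≤ w i
  memLp_two : ∀ i, MemLp (fun w => w i) 2 ν
  integral_eq_one : ∀ i, ∫ w, w i ∂ν = 1

section Population

variable {𝒳 Λ : Type*} [MeasurableSpace 𝒳] [Fintype Λ]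

/-- The law of `(X, Y) ∼ P` conditionally on `X ∈ I`. -/
def condCell (P : Measure (𝒳 × ℝ)) (I : Set 𝒳) : Measure (𝒳 × ℝ) :=
  P[|Prod.fst ⁻¹' I]

/-- `β_l = E[Y | X ∈ I_l]`. -/
def beta (P : Measure (𝒳 × ℝ)) (I : Set 𝒳) : ℝ :=
  ∫ z, z.2 ∂(condCell P I)

/-- The best predictor `s_m = ∑ β_l 1_{I_l}` over the histogram model. -/
def sM (P : Measure (𝒳 × ℝ)) (cell : Λ → Set 𝒳) (x : 𝒳) : ℝ :=
  ∑ l, (cell l).indicator (fun _ => beta P (cell l)) x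

/-- `m_{q,l} = (E[|Y - s_m(X)|^q | X ∈ I_l])^{1/q}`. -/
def mq (P : Measure (𝒳 × ℝ)) (cell : Λ → Set 𝒳) (q : ℝ) (l : Λ) : ℝ :=
  (∫ z, |z.2 - sM P cell z.1| ^ q ∂(condCell P (cell l))) ^ (1 / q)

/-- `σ_l² = E[(Y - s_m(X))² | X ∈ I_l]`. -/
def sigmaSq (P : Measure (𝒳 × ℝ)) (cell : Λ → Set 𝒳) (l : Λ) : ℝ :=
  ∫ z, (z.2 - sM P cell z.1) ^ 2 ∂(condCell P (cell l))

/-- The local moment condition: all the moments `m_{q,l}`, `q ≥ 2`, are finite and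
`√(D_m ∑ m_{q,l}⁴) / ∑ m_{2,l}² ≤ a q^ξ`. -/
def LocalMoment (P : Measure (𝒳 × ℝ)) (cell : Λ → Set 𝒳) (a ξ : ℝ) : Prop :=
  ∀ q : ℝ, 2 ≤ q →
    (∀ l, MemLp (fun z : 𝒳 × ℝ => z.2 - sM P cell z.1) (ENNReal.ofReal q)
      (condCell P (cell l))) ∧
    Real.sqrt ((Fintype.card Λ : ℝ) * ∑ l, mq P cell q l ^ 4) / ∑ l, mq P cell 2 l ^ 2
      ≤ a * q ^ ξ

end Population

section Sample

variable {𝒳 Λ : Type*} {n : ℕ}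

/-- The number `n p̂_I` of sample points with `X_i ∈ I`. -/
def count (z : Fin n → 𝒳 × ℝ) (I : Set 𝒳) : ℝ :=
  ∑ i, I.indicator (fun _ => (1 : ℝ)) (z i).1

/-- `p̂_I = P_n(X ∈ I)`. -/
def pHat (z : Fin n → 𝒳 × ℝ) (I : Set 𝒳) : ℝ :=
  count z I / n

/-- `β̂_I = (n p̂_I)⁻¹ ∑_{X_i ∈ I} Y_i`. -/
def betaHat (z : Fin n → 𝒳 × ℝ) (I : Set 𝒳) : ℝ :=
  (∑ i, I.indicator (fun _ => (z i).2) (z i).1) / (n * pHat z I)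

/-- `Ŵ_I = (n p̂_I)⁻¹ ∑_{X_i ∈ I} W_i`. -/
def wHat (z : Fin n → 𝒳 × ℝ) (I : Set 𝒳) (w : Fin n → ℝ) : ℝ :=
  (∑ i, I.indicator (fun _ => w i) (z i).1) / (n * pHat z I)

/-- `p̂^W_I = p̂_I Ŵ_I`. -/
def pHatW (z : Fin n → 𝒳 × ℝ) (I : Set 𝒳) (w : Fin n → ℝ) : ℝ :=
  pHat z I * wHat z I w

/-- `β̂^W_I = (n p̂^W_I)⁻¹ ∑_{X_i ∈ I} W_i Y_i`. -/
def betaHatW (z : Fin n → 𝒳 × ℝ) (I : Set 𝒳) (w : Fin n → ℝ) : ℝ :=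
  (∑ i, I.indicator (fun _ => w i * (z i).2) (z i).1) / (n * pHatW z I w)

/-- The resampling penalty
`C ∑_l (E_W[p̂_l (β̂^W_l - β̂_l)² | Ŵ_l > 0] + E_W[p̂^W_l (β̂^W_l - β̂_l)²])`
of the sample `z`, where `ν` is the law of `W`. -/
def pen [Fintype Λ] (C : ℝ) (ν : Measure (Fin n → ℝ)) (cell : Λ → Set 𝒳)
    (z : Fin n → 𝒳 × ℝ) : ℝ :=
  C * ∑ l,
    ((∫ w, pHat z (cell l) * (betaHatW z (cell l) w - betaHat z (cell l)) ^ 2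
        ∂(ν[|{w | 0 < wHat z (cell l) w}])) +
      ∫ w, pHatW z (cell l) w * (betaHatW z (cell l) w - betaHat z (cell l)) ^ 2 ∂ν)

/-- The empirical risk minimizer `ŝ_m = ∑ β̂_l 1_{I_l}` (regressogram). -/
def sHat [Fintype Λ] (cell : Λ → Set 𝒳) (z : Fin n → 𝒳 × ℝ) (x : 𝒳) : ℝ :=
  ∑ l, (cell l).indicator (fun _ => betaHat z (cell l)) x

/-- Least-squares contrast `γ(t; (x, y)) = (t(x) - y)²`. -/
def contrast (t : 𝒳 → ℝ) (z : 𝒳 × ℝ) : ℝ :=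
  (t z.1 - z.2) ^ 2

open Classical in
/-- `p₂(m) = P_n(γ(s_m) - γ(ŝ_m)) + n⁻¹ ∑_l σ_l² 1_{n p̂_l = 0}`. The second term is the convention
used when some cell contains no data point; it vanishes as soon as `ŝ_m` is uniquely defined. -/
def p2 [MeasurableSpace 𝒳] [Fintype Λ] (P : Measure (𝒳 × ℝ)) (cell : Λ → Set 𝒳)
    (z : Fin n → 𝒳 × ℝ) : ℝ :=
  (1 / (n : ℝ)) * ∑ i, (contrast (sM P cell) (z i) - contrast (sHat cell z) (z i)) +
    (1 / (n : ℝ)) * ∑ l, if count z (cell l) = 0 then sigmaSq P cell l else 0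

/-- The σ-algebra on `Ω` generated by `(1_{X_i ∈ I_l})_{i, l}`. -/
abbrev cellSigma {Ω : Type*} (cell : Λ → Set 𝒳) (D : Fin n → Ω → 𝒳 × ℝ) : MeasurableSpace Ω :=
  MeasurableSpace.comap
    (fun ω (i : Fin n) (l : Λ) => (cell l).indicator (fun _ => (1 : ℝ)) (D i ω).1)
    inferInstance

/-- `Ω_m(A)`: every cell contains at least `A` data points. -/
def occEvent {Ω : Type*} (cell : Λ → Set 𝒳) (D : Fin n → Ω → 𝒳 × ℝ) (A : ℝ) : Set Ω :=
  {ω | ∀ l, A ≤ count (fun i => D i ω) (cell l)}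

end Sample

section Weights

variable {n : ℕ}

/-- `Ŵ` for a cell containing exactly `k` data points. As `W` is exchangeable and independent of the
data, these points may be taken to be the first `k` ones. -/
def avg (k : ℕ) (w : Fin n → ℝ) : ℝ :=
  (∑ i with i.val < k, w i) / k

/-- `R_{1,W}(n, k/n) = E[(W_1 - Ŵ)² / Ŵ² | X_1 ∈ I, Ŵ > 0]` when the cell `I` contains exactly
`k` data points. -/
def R1 [NeZero n] (ν : Measure (Fin n → ℝ)) (k : ℕ) : ℝ :=
  ∫ w, (w 0 - avg k w) ^ 2 / avg k w ^ 2 ∂(ν[|{w | 0 < avg k w}])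

/-- `R_{2,W}(n, k/n) = E[(W_1 - Ŵ)² / Ŵ | X_1 ∈ I]` (with `0/0 = 0`) when the cell `I` contains
exactly `k` data points. -/
def R2 [NeZero n] (ν : Measure (Fin n → ℝ)) (k : ℕ) : ℝ :=
  ∫ w, (w 0 - avg k w) ^ 2 / avg k w ∂ν

/-- `sup_{np ≥ A} (R_{1,W}(n,p) + R_{2,W}(n,p))`, a supremum over the possible values `k = np ≤ n`
of a cell count. It is a supremum of finitely many reals (and `0` if `A > n`, in which case no cell
can contain `A` points). -/
def supR [NeZero n] (ν : Measure (Fin n → ℝ)) (A : ℝ) : ℝ :=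
  ⨆ k : {k : ℕ // A ≤ (k : ℝ) ∧ k ≤ n}, (R1 ν k.1 + R2 ν k.1)

/-- The classical resampling schemes: Efron(`m`), Rademacher(`p`), Poisson(`μ`), random hold-out
with `q = ⌊n/2⌋`, and leave-one-out. -/
inductive Scheme where
  | efr (m : ℕ)
  | rad (p : ℝ)
  | poi (μ : ℝ)
  | rhoHalf
  | loo

/-- Law of the random hold-out (`q`) weights `W_i = (n/q) 1_{i ∈ I}`, with `I` uniform among the
subsets of `{1, …, n}` of cardinality `q`. -/
def rhoLaw (n q : ℕ) : Measure (Fin n → ℝ) :=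
  ∑ I ∈ Finset.powersetCard q (Finset.univ : Finset (Fin n)),
    ((n.choose q : ℝ≥0∞)⁻¹) • Measure.dirac (fun i => if i ∈ I then (n : ℝ) / q else 0)

/-- Law of the Efron (`m`) weights `W_i = (n/m) card {j ≤ m : U_j = i}`, with `U_1, …, U_m`
i.i.d. uniform on `{1, …, n}` (so that `(m/n) W` is multinomial `(m; 1/n, …, 1/n)`). -/
def efrLaw (n m : ℕ) : Measure (Fin n → ℝ) :=
  ∑ u : Fin m → Fin n,
    (((n : ℝ≥0∞) ^ m)⁻¹) • Measure.dirac
      (fun i => ((n : ℝ) / m) * ((Finset.univ.filter (fun j => u j = i)).card : ℝ))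

/-- Law of the Rademacher (`p`) weights: the `p W_i` are i.i.d. Bernoulli (`p`). -/
def radLaw (n : ℕ) (p : ℝ) : Measure (Fin n → ℝ) :=
  Measure.pi (fun _ => ENNReal.ofReal p • Measure.dirac (1 / p) +
    ENNReal.ofReal (1 - p) • Measure.dirac (0 : ℝ))

/-- Law of the Poisson (`μ`) weights: the `μ W_i` are i.i.d. Poisson (`μ`). -/
def poiLaw (n : ℕ) (μ : ℝ) : Measure (Fin n → ℝ) :=
  Measure.pi (fun _ => (poissonMeasure μ.toNNReal).map (fun k : ℕ => (k : ℝ) / μ))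

/-- The law of the weight vector of size `n` in each scheme. -/
def Scheme.law (n : ℕ) : Scheme → Measure (Fin n → ℝ)
  | .efr m => efrLaw n m
  | .rad p => radLaw n p
  | .poi μ => poiLaw n μ
  | .rhoHalf => rhoLaw n (n / 2)
  | .loo => rhoLaw n (n - 1)

/-- Admissible values of the parameters. -/
def Scheme.Valid (n : ℕ) : Scheme → Prop
  | .efr m => 1 ≤ m
  | .rad p => 0 < p ∧ p < 1
  | .poi μ => 0 < μ
  | .rhoHalf => 2 ≤ n
  | .loo => 2 ≤ n

/-- The constant `C_W`. -/
def Scheme.CW (n : ℕ) : Scheme → ℝ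
  | .efr m => (m : ℝ) / n
  | .rad p => p / (1 - p)
  | .poi μ => μ
  | .rhoHalf => ((n / 2 : ℕ) : ℝ) / ((n : ℝ) - ((n / 2 : ℕ) : ℝ))
  | .loo => (n : ℝ) - 1

end Weights

end HistRP

end

noncomputable section

namespace HistRP

/-! Exchangeability makes the penalty explicit. On a cell with k points the centred weights `W_i -
Ŵ` sum to zero, so the matrix of the `E_W[(W_i - Ŵ)(W_j - Ŵ) f(Ŵ)]` is a multiple of the projection
that removes the mean. Hence the cell contributes `(R₁ + R₂)(k) / n` times the unbiased sample
variance of its responses (`IsWeightLaw.integral_quadratic`, `pen_cell_eq`).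

Fix an allocation `c` of the design points to the cells, that is, work on the event `box cell D c`.
There the responses stay independent, with the conditional laws of their cells
(`iIndepFun_cond_iInter`), and sample variances of different cells are independent with means
`σ_λ²`. The boxes are atoms of the conditioning σ-algebra, so the conditional expectation of the
penalty is a constant on each of them (`condExp_pen`), and the deviation is a weighted sum over
cells of independent centred variables. The reference quantity `E[p₂]` equals `n⁻¹ ∑ σ_λ²`
(`integral_p2`).

Concentration goes through moments. A Marcinkiewicz–Zygmund inequality whose constant is linear in
`p` (`integral_sum_pow_le`) is used twice: inside a cell, where the squared `L^{2p}` norm of the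
variance error is of order `p m_{4p}⁴ / k`, and then across cells, which costs another factor `p`.
The total is of order `p² (sup R)² A⁻¹ ∑ m_{4p,λ}⁴`, and the local moment condition at `q = 4p`
bounds the last sum by a multiple of `p^{2ξ} (∑ σ_λ²)² / D_m`. Markov's inequality at order `2p`,
with `p` about `γ ln n`, gives failure probability `n^{-γ}` and the factor `(ln n)^{ξ+1}`. The bound
is uniform in `c`, so averaging over the disjoint boxes costs nothing.

For the concrete schemes let `c` now denote the smallest positive value of a weight and `S` the sum
of the first k weights. For two-valued weights, and for Efron and Poisson weights through `(W_1 -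
W_2)²`, one has `E[(W_1 - Ŵ)² f(Ŵ)] ≤ c E[Ŵ f(Ŵ)]`. With `f(a) = 1/a²` an inverse moment remains. It
is controlled by `E[1/(S + c)] ≤ E[W_1/S] = P(S > 0)/k`, proved scheme by scheme: by exchanging
coordinates, by independence, by moving one ball, or by the Chen–Stein identity. Leave-one-out needs
a sharper argument, because there the target `1/C_W` is `c - 1` rather than `c`. -/

/-! ### Elementary inequalities for even powers -/

theorem add_pow_two_mul_sub_le (p : ℕ) (hp : 1 ≤ p) {a b : ℝ} (ha : 0 ≤ a) (hb : 0 ≤ b) :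
    (a + b) ^ (2 * p) - 2 * p * a ^ (2 * p - 1) * b ≤ (a ^ 2 + 5 * p * b ^ 2) ^ p := by
  have hp1 : (1 : ℝ) ≤ p := by exact_mod_cast hp
  rcases ha.eq_or_lt with rfl | ha
  · have : (0 : ℝ) ^ (2 * p - 1) = 0 := zero_pow (by omega)
    rw [this, pow_mul]
    simp only [zero_add, mul_zero, zero_mul, sub_zero]
    gcongr
    nlinarith [sq_nonneg b]
  · have key : ∀ t : ℝ, 0 ≤ t → (1 + t) ^ (2 * p) - 2 * p * t ≤ (1 + 5 * p * t ^ 2) ^ p := by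
      intro t ht
      -- For small t the second-order remainder of the exponential is at most (2pt)², which
      -- Bernoulli's inequality absorbs. For large t, 2t ≤ 4pt² gives (1 + t)² ≤ 1 + 5pt², and the
      -- linear term is not needed. The constant 5 is 4 + 1.
      rcases le_total (2 * p * t) 1 with h | h
      · have h1 : (1 + t) ^ (2 * p) ≤ Real.exp (2 * p * t) := by
          calc (1 + t) ^ (2 * p) ≤ (Real.exp t) ^ (2 * p) := by
                gcongr; linarith [Real.add_one_le_exp t]
            _ = Real.exp (2 * p * t) := by rw [← Real.exp_nat_mul]; push_cast; rfl
        have h2 := Real.abs_exp_sub_one_sub_id_le (x := 2 * p * t)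
          (by rw [abs_of_nonneg (by positivity)]; exact h)
        have h3 := (abs_le.1 h2).2
        have h4 := one_add_mul_le_pow (a := 5 * p * t ^ 2) (by nlinarith [sq_nonneg t]) p
        nlinarith [sq_nonneg (p * t)]
      · have h1 : (1 + t) ^ 2 ≤ 1 + 5 * p * t ^ 2 := by nlinarith [sq_nonneg t]
        calc (1 + t) ^ (2 * p) - 2 * p * t ≤ ((1 + t) ^ 2) ^ p := by rw [pow_mul]; nlinarith
          _ ≤ _ := by gcongr
    have h := mul_le_mul_of_nonneg_left (key (b / a) (by positivity)) (by positivity : 0 ≤ a ^ (2 * p))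
    have e1 : a ^ (2 * p) * ((1 + b / a) ^ (2 * p) - 2 * p * (b / a)) =
        (a + b) ^ (2 * p) - 2 * p * a ^ (2 * p - 1) * b := by
      rw [mul_sub, ← mul_pow]
      congr 1
      · congr 1; field_simp
      · have : a ^ (2 * p) = a ^ (2 * p - 1) * a := by rw [← pow_succ]; congr 1; omega
        rw [this]; field_simp
    have e2 : a ^ (2 * p) * (1 + 5 * p * (b / a) ^ 2) ^ p = (a ^ 2 + 5 * p * b ^ 2) ^ p := by
      rw [pow_mul, ← mul_pow]; congr 1; field_simp
    rwa [e1, e2] at h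

theorem integrable_add_even_pow {Ω : Type*} [MeasurableSpace Ω] {μ : Measure Ω}
    {X Y : Ω → ℝ} (hX : Measurable X) (hY : Measurable Y) {p : ℕ}
    (hXi : Integrable (fun ω => X ω ^ (2 * p)) μ) (hYi : Integrable (fun ω => Y ω ^ (2 * p)) μ) :
    Integrable (fun ω => (X ω + Y ω) ^ (2 * p)) μ := by
  refine ((hXi.add hYi).const_mul (2 ^ (2 * p - 1))).mono'
    ((hX.add hY).pow_const _).aestronglyMeasurable ?_
  filter_upwards with ω
  rw [Real.norm_of_nonneg ((even_two_mul p).pow_nonneg _)]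
  exact (even_two_mul p).add_pow_le

/-- Supplies the only form of independence that `integral_sum_pow_le` asks for: a partial sum
against one further variable. -/
theorem _root_.ProbabilityTheory.iIndepFun.indepFun_fun_sum {Ω : Type*} [MeasurableSpace Ω]
    {μ : Measure Ω} {ι : Type*} {X : ι → Ω → ℝ}
    (h : iIndepFun X μ) (hX : ∀ i, Measurable (X i)) (s : Finset ι) (i : ι) (hi : i ∉ s) :
    IndepFun (fun ω => ∑ j ∈ s, X j ω) (X i) μ := by
  have := h.indepFun_finsetSum_of_notMem hX hi
  convert this using 1
  ext ω; simp

/-! ### Even moments of sums and of the sample variance -/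

section Moments

variable {Ω : Type*} [MeasurableSpace Ω] {μ : Measure Ω} [IsProbabilityMeasure μ]

theorem abs_pow_le_one_add_abs_pow (x : ℝ) {j N : ℕ} (hj : j ≤ N) : |x| ^ j ≤ 1 + |x| ^ N := by
  rcases le_total |x| 1 with h | h
  · have := pow_le_one₀ (n := j) (abs_nonneg x) h
    have := pow_nonneg (abs_nonneg x) N
    linarith
  · have := pow_le_pow_right₀ h hj
    linarith

theorem integrable_pow_of_le {X : Ω → ℝ} (hX : Measurable X) {N : ℕ}
    (hN : Integrable (fun ω => |X ω| ^ N) μ) {j : ℕ} (hj : j ≤ N) :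
    Integrable (fun ω => X ω ^ j) μ := by
  refine ((integrable_const (1 : ℝ)).add hN).mono' (hX.pow_const j).aestronglyMeasurable ?_
  filter_upwards with ω
  simpa using abs_pow_le_one_add_abs_pow (X ω) hj

/-- Lyapunov's inequality for integer exponents. -/
theorem integral_abs_pow_le_of_le {X : Ω → ℝ} (hX : Measurable X) {N : ℕ}
    (hN : Integrable (fun ω => |X ω| ^ N) μ) {a : ℝ} (ha : 0 ≤ a) (hle : ∫ ω, |X ω| ^ N ∂μ ≤ a ^ N)
    {j : ℕ} (hj : j ≤ N) : ∫ ω, |X ω| ^ j ∂μ ≤ a ^ j := by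
  rcases Nat.eq_zero_or_pos j with rfl | hj0
  · simp
  have hNpos : 0 < N := by omega
  have hI : Integrable (fun ω => |X ω| ^ j) μ := by
    simpa using (integrable_pow_of_le hX hN hj).abs
  rcases ha.eq_or_lt with rfl | ha
  · have h0 : ∫ ω, |X ω| ^ N ∂μ = 0 :=
      le_antisymm (by simpa [hNpos.ne'] using hle) (integral_nonneg fun ω => by positivity)
    rw [integral_eq_zero_iff_of_nonneg (fun ω => by positivity) hN] at h0
    have : ∫ ω, |X ω| ^ j ∂μ = 0 := by
      rw [integral_eq_zero_iff_of_nonneg (fun ω => by positivity) hI]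
      filter_upwards [h0] with ω hω
      have : X ω = 0 := by simpa [hNpos.ne'] using hω
      simp [this, hj0.ne']
    simp [this, hj0.ne']
  -- Bernoulli's inequality with exponent j/N ≤ 1, integrated below at t = |X| / a.
  · have key : ∀ t : ℝ, 0 ≤ t → t ^ j ≤ (1 - (j / N : ℝ)) + (j / N : ℝ) * t ^ N := by
      intro t ht
      have hb := rpow_one_add_le_one_add_mul_self (s := t ^ N - 1) (p := (j / N : ℝ))
        (by linarith [pow_nonneg ht N]) (by positivity)
        ((div_le_one (by exact_mod_cast hNpos)).2 (by exact_mod_cast hj))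
      have e : (1 + (t ^ N - 1)) ^ (j / N : ℝ) = t ^ j := by
        rw [add_sub_cancel, ← Real.rpow_natCast t N, ← Real.rpow_mul ht,
          mul_div_cancel₀ _ (by exact_mod_cast hNpos.ne'), Real.rpow_natCast]
      rw [e] at hb
      linarith
    have h1 : ∫ ω, |X ω| ^ j ∂μ ≤
        ∫ ω, a ^ j * (1 - (j / N : ℝ)) + a ^ j * (j / N : ℝ) / a ^ N * |X ω| ^ N ∂μ := by
      refine integral_mono hI ((integrable_const _).add (hN.const_mul _)) fun ω => ?_
      have h := mul_le_mul_of_nonneg_left (key (|X ω| / a) (by positivity))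
        (by positivity : 0 ≤ a ^ j)
      rw [← mul_pow, mul_div_cancel₀ _ ha.ne', div_pow] at h
      refine h.trans (le_of_eq ?_)
      ring
    rw [integral_add (integrable_const _) (hN.const_mul _), integral_const_mul] at h1
    simp only [integral_const, probReal_univ, one_smul] at h1
    refine h1.trans ?_
    have h2 : a ^ j * (j / N : ℝ) / a ^ N * ∫ ω, |X ω| ^ N ∂μ ≤
        a ^ j * (j / N : ℝ) / a ^ N * a ^ N := by gcongr
    rw [div_mul_cancel₀ _ (by positivity), ← integral_const_mul] at h2
    linarith

/-- In the binomial expansion the term linear in `Y` vanishes by independence and centring, and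
Lyapunov's inequality bounds every other term by the matching term of (a + b)^{2p}. Removing the
linear term makes squares of norms add up, instead of norms, at the price of the factor 5p. -/
theorem integral_add_pow_le {X Y : Ω → ℝ} (hX : Measurable X) (hY : Measurable Y)
    (hXY : IndepFun X Y μ) (hY0 : ∫ ω, Y ω ∂μ = 0) {p : ℕ} (hp : 1 ≤ p)
    (hXi : Integrable (fun ω => X ω ^ (2 * p)) μ) (hYi : Integrable (fun ω => Y ω ^ (2 * p)) μ)
    {a b : ℝ} (ha : 0 ≤ a) (hb : 0 ≤ b) (hXa : ∫ ω, X ω ^ (2 * p) ∂μ ≤ a ^ (2 * p))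
    (hYb : ∫ ω, Y ω ^ (2 * p) ∂μ ≤ b ^ (2 * p)) :
    ∫ ω, (X ω + Y ω) ^ (2 * p) ∂μ ≤ (a ^ 2 + 5 * p * b ^ 2) ^ p := by
  have hev : Even (2 * p) := even_two_mul p
  have hXi' : Integrable (fun ω => |X ω| ^ (2 * p)) μ := by simpa only [hev.pow_abs] using hXi
  have hYi' : Integrable (fun ω => |Y ω| ^ (2 * p)) μ := by simpa only [hev.pow_abs] using hYi
  have hXa' : ∫ ω, |X ω| ^ (2 * p) ∂μ ≤ a ^ (2 * p) := by simpa only [hev.pow_abs] using hXa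
  have hYb' : ∫ ω, |Y ω| ^ (2 * p) ∂μ ≤ b ^ (2 * p) := by simpa only [hev.pow_abs] using hYb
  have hind : ∀ i j : ℕ, IndepFun (fun ω => X ω ^ i) (fun ω => Y ω ^ j) μ := fun i j =>
    hXY.comp (measurable_id.pow_const i) (measurable_id.pow_const j)
  have hterm : ∀ j ∈ Finset.range (2 * p + 1),
      Integrable (fun ω => X ω ^ j * Y ω ^ (2 * p - j) * ((2 * p).choose j : ℝ)) μ := by
    intro j hj
    rw [Finset.mem_range] at hj
    exact ((hind j (2 * p - j)).integrable_mul (integrable_pow_of_le hX hXi' (by omega))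
      (integrable_pow_of_le hY hYi' (by omega))).mul_const _
  have hbound : ∀ j ∈ Finset.range (2 * p + 1),
      ∫ ω, X ω ^ j * Y ω ^ (2 * p - j) * ((2 * p).choose j : ℝ) ∂μ ≤
        a ^ j * b ^ (2 * p - j) * ((2 * p).choose j : ℝ) -
          if j = 2 * p - 1 then 2 * p * a ^ (2 * p - 1) * b else 0 := by
    intro j hj
    rw [Finset.mem_range] at hj
    rw [integral_mul_const, (hind j (2 * p - j)).integral_fun_mul_eq_mul_integral
      (hX.pow_const _).aestronglyMeasurable (hY.pow_const _).aestronglyMeasurable]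
    split_ifs with h
    · subst h
      have e : 2 * p - (2 * p - 1) = 1 := by omega
      have e2 : (2 * p).choose (2 * p - 1) = 2 * p := by
        rw [← Nat.choose_symm (by omega), e, Nat.choose_one_right]
      simp [e, hY0, e2]
      linarith
    · rw [sub_zero]
      refine mul_le_mul_of_nonneg_right ?_ (by positivity)
      have h1 : |∫ ω, X ω ^ j ∂μ| ≤ a ^ j := by
        refine abs_integral_le_integral_abs.trans ?_
        simp only [abs_pow]
        exact integral_abs_pow_le_of_le hX hXi' ha hXa' (by omega)
      have h2 : |∫ ω, Y ω ^ (2 * p - j) ∂μ| ≤ b ^ (2 * p - j) := by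
        refine abs_integral_le_integral_abs.trans ?_
        simp only [abs_pow]
        exact integral_abs_pow_le_of_le hY hYi' hb hYb' (by omega)
      calc _ ≤ |(∫ ω, X ω ^ j ∂μ) * ∫ ω, Y ω ^ (2 * p - j) ∂μ| := le_abs_self _
        _ ≤ _ := by rw [abs_mul]; gcongr
  calc ∫ ω, (X ω + Y ω) ^ (2 * p) ∂μ
      = ∑ j ∈ Finset.range (2 * p + 1),
          ∫ ω, X ω ^ j * Y ω ^ (2 * p - j) * ((2 * p).choose j : ℝ) ∂μ := by
        simp_rw [add_pow]
        exact integral_finsetSum _ hterm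
    _ ≤ ∑ j ∈ Finset.range (2 * p + 1), (a ^ j * b ^ (2 * p - j) * ((2 * p).choose j : ℝ) -
          if j = 2 * p - 1 then 2 * p * a ^ (2 * p - 1) * b else 0) := Finset.sum_le_sum hbound
    _ = (a + b) ^ (2 * p) - 2 * p * a ^ (2 * p - 1) * b := by
        rw [Finset.sum_sub_distrib, ← add_pow, Finset.sum_ite_eq', if_pos]
        rw [Finset.mem_range]; omega
    _ ≤ _ := add_pow_two_mul_sub_le p hp ha hb

/-- Marcinkiewicz–Zygmund inequality for even moments, with explicit constants. -/
theorem integral_sum_pow_le {ι : Type*} {X : ι → Ω → ℝ} (hX : ∀ i, Measurable (X i))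
    (hind : ∀ (s : Finset ι) (i : ι), i ∉ s → IndepFun (fun ω => ∑ j ∈ s, X j ω) (X i) μ)
    {p : ℕ} (hp : 1 ≤ p) (s : Finset ι)
    (hX0 : ∀ i ∈ s, ∫ ω, X i ω ∂μ = 0)
    (hXi : ∀ i ∈ s, Integrable (fun ω => X i ω ^ (2 * p)) μ) {b : ι → ℝ} (hb : ∀ i ∈ s, 0 ≤ b i)
    (hXb : ∀ i ∈ s, ∫ ω, X i ω ^ (2 * p) ∂μ ≤ b i ^ (2 * p)) :
    Integrable (fun ω => (∑ i ∈ s, X i ω) ^ (2 * p)) μ ∧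
      ∫ ω, (∑ i ∈ s, X i ω) ^ (2 * p) ∂μ ≤ (5 * p * ∑ i ∈ s, b i ^ 2) ^ p := by
  classical
  induction s using Finset.induction_on with
  | empty => simp [show p ≠ 0 by omega]
  | insert i s hi ih =>
    simp only [Finset.mem_insert, forall_eq_or_imp] at hX0 hXi hb hXb
    obtain ⟨ih1, ih2⟩ := ih hX0.2 hXi.2 hb.2 hXb.2
    have hS : Measurable (fun ω => ∑ j ∈ s, X j ω) := Finset.measurable_sum _ fun j _ => hX j
    have hSX := hind s i hi
    have hB : 0 ≤ 5 * p * ∑ j ∈ s, b j ^ 2 := by positivity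
    simp only [Finset.sum_insert hi]
    constructor
    · simp_rw [add_comm (X i _)]
      exact integrable_add_even_pow hS (hX i) ih1 hXi.1
    · simp_rw [add_comm (X i _)]
      -- The induction hypothesis is used as a norm bound whose square is 5p ∑ b²; one more variable
      -- adds exactly 5p b_i² to that square.
      refine (integral_add_pow_le hS (hX i) hSX hX0.1 hp ih1 hXi.1 (Real.sqrt_nonneg _) hb.1
        (a := Real.sqrt (5 * p * ∑ j ∈ s, b j ^ 2)) ?_ hXb.1).trans ?_
      · rwa [pow_mul, Real.sq_sqrt hB]
      · rw [Real.sq_sqrt hB]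
        apply le_of_eq; ring

/-- The unbiased variance estimator of the family `e` over `s` (`0` if `s` has at most one point). -/
def sampleVar {ι : Type*} (s : Finset ι) (e : ι → ℝ) : ℝ :=
  (∑ i ∈ s, e i ^ 2 - (∑ i ∈ s, e i) ^ 2 / s.card) / (s.card - 1)

theorem sub_pow_two_mul_le {x y : ℝ} (hx : 0 ≤ x) (hy : 0 ≤ y) (p : ℕ) :
    (x - y) ^ (2 * p) ≤ x ^ (2 * p) + y ^ (2 * p) := by
  rw [← (even_two_mul p).pow_abs]
  rcases le_total x y with h | h
  · rw [abs_of_nonpos (by linarith)]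
    have : (-(x - y)) ^ (2 * p) ≤ y ^ (2 * p) := pow_le_pow_left₀ (by linarith) (by linarith) _
    have := pow_nonneg hx (2 * p)
    linarith
  · rw [abs_of_nonneg (by linarith)]
    have : (x - y) ^ (2 * p) ≤ x ^ (2 * p) := pow_le_pow_left₀ (by linarith) (by linarith) _
    have := pow_nonneg hy (2 * p)
    linarith

theorem min_sq_le_mul {x y : ℝ} (hx : 0 ≤ x) (hy : 0 ≤ y) : min x y ^ 2 ≤ x * y := by
  rcases le_total x y with h | h
  · rw [min_eq_left h]; nlinarith
  · rw [min_eq_right h]; nlinarith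

/-- Jensen's inequality, without independence. It beats the Marcinkiewicz–Zygmund bound once the
moment order exceeds the number of points. -/
theorem sum_sq_div_card_pow_le {ι : Type*} (s : Finset ι) (hs : s.Nonempty) (e : ι → ℝ) {p : ℕ}
    (hp : 1 ≤ p) :
    ((∑ i ∈ s, e i) ^ 2 / s.card) ^ (2 * p) ≤
      (s.card : ℝ) ^ (2 * p - 1) * ∑ i ∈ s, e i ^ (2 * (2 * p)) := by
  have hk : (0 : ℝ) < s.card := by exact_mod_cast hs.card_pos
  have h1 := pow_sum_div_card_le_sum_pow (s := s) (f := fun i => |e i|)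
    (fun i _ => abs_nonneg _) (2 * (2 * p) - 1)
  have e1 : 2 * (2 * p) - 1 + 1 = 2 * (2 * p) := by omega
  rw [e1, div_le_iff₀ (by positivity)] at h1
  simp only [(even_two_mul (2 * p)).pow_abs] at h1
  have h2 : (∑ i ∈ s, e i) ^ (2 * (2 * p)) ≤ (∑ i ∈ s, |e i|) ^ (2 * (2 * p)) := by
    rw [← (even_two_mul (2 * p)).pow_abs]
    exact pow_le_pow_left₀ (abs_nonneg _) (Finset.abs_sum_le_sum_abs _ _) _
  rw [div_pow, ← pow_mul, div_le_iff₀ (by positivity)]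
  refine (h2.trans h1).trans (le_of_eq ?_)
  have e2 : (s.card : ℝ) ^ (2 * (2 * p) - 1) =
      (s.card : ℝ) ^ (2 * p - 1) * (s.card : ℝ) ^ (2 * p) := by
    rw [← pow_add]; congr 1; omega
  rw [e2]; ring

/-- Moments of the deviations of the unbiased variance estimator. -/
theorem integral_sampleVar_sub_pow_le {ι : Type*} {e : ι → Ω → ℝ} (he : ∀ i, Measurable (e i))
    (hind : iIndepFun e μ) (s : Finset ι) (hs : 2 ≤ s.card) {p : ℕ} (hp : 1 ≤ p)
    (he0 : ∀ i ∈ s, ∫ ω, e i ω ∂μ = 0) {v m : ℝ} (hm : 0 ≤ m)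
    (hev : ∀ i ∈ s, ∫ ω, e i ω ^ 2 ∂μ = v)
    (hei : ∀ i ∈ s, Integrable (fun ω => e i ω ^ (2 * (2 * p))) μ)
    (hem : ∀ i ∈ s, ∫ ω, e i ω ^ (2 * (2 * p)) ∂μ ≤ m ^ (2 * (2 * p))) :
    Integrable (fun ω => (sampleVar s (fun i => e i ω) - v) ^ (2 * p)) μ ∧
    ∫ ω, (sampleVar s (fun i => e i ω) - v) ^ (2 * p) ∂μ ≤
      (640 * p * m ^ 4 / s.card) ^ p := by
  have hp1 : (1 : ℝ) ≤ p := by exact_mod_cast hp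
  have hk2 : (2 : ℝ) ≤ s.card := by exact_mod_cast hs
  have hk0 : (0 : ℝ) < s.card := by linarith
  obtain ⟨i₀, hi₀⟩ : s.Nonempty := Finset.card_pos.1 (by omega)
  have hev4 : Even (2 * (2 * p)) := even_two_mul _
  have habs : ∀ i ∈ s, Integrable (fun ω => |e i ω| ^ (2 * (2 * p))) μ := fun i hi => by
    simpa only [hev4.pow_abs] using hei i hi
  have hv0 : 0 ≤ v := by
    rw [← hev i₀ hi₀]; exact integral_nonneg fun ω => sq_nonneg _
  have hvm : v ≤ m ^ 2 := by
    have := integral_abs_pow_le_of_le (he i₀) (habs i₀ hi₀) hm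
      (by simpa only [hev4.pow_abs] using hem i₀ hi₀) (j := 2) (by omega)
    simpa only [sq_abs, hev i₀ hi₀] using this
  have hvp : v ^ (2 * p) ≤ m ^ (2 * (2 * p)) := by
    rw [pow_mul m 2 (2 * p)]
    exact pow_le_pow_left₀ hv0 hvm _
  have hsqi : ∀ i ∈ s, Integrable (fun ω => e i ω ^ 2) μ := fun i hi =>
    integrable_pow_of_le (he i) (habs i hi) (by omega)
  -- the linear part
  have hXm : ∀ i, Measurable (fun ω => e i ω ^ 2 - v) := fun i =>
    ((he i).pow_const 2).sub_const v
  have hXbd : ∀ i, ∀ ω, (e i ω ^ 2 - v) ^ (2 * p) ≤ e i ω ^ (2 * (2 * p)) + v ^ (2 * p) :=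
    fun i ω => by
      rw [pow_mul (e i ω) 2 (2 * p)]
      exact sub_pow_two_mul_le (sq_nonneg _) hv0 p
  have hXi : ∀ i ∈ s, Integrable (fun ω => (e i ω ^ 2 - v) ^ (2 * p)) μ := fun i hi => by
    refine ((hei i hi).add (integrable_const (v ^ (2 * p)))).mono'
      ((hXm i).pow_const _).aestronglyMeasurable ?_
    filter_upwards with ω
    rw [Real.norm_of_nonneg ((even_two_mul p).pow_nonneg _)]
    exact hXbd i ω
  have htwo : (2 : ℝ) ≤ 2 ^ (2 * p) := by
    calc (2 : ℝ) = 2 ^ 1 := by norm_num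
      _ ≤ 2 ^ (2 * p) := pow_le_pow_right₀ (by norm_num) (by omega)
  obtain ⟨hA1, hA2⟩ := integral_sum_pow_le hXm
    ((hind.comp (fun _ x => x ^ 2 - v)
      (fun _ => (measurable_id.pow_const 2).sub_const v)).indepFun_fun_sum hXm) hp s
    (fun i hi => by
      rw [integral_sub (hsqi i hi) (integrable_const _), hev i hi]; simp) hXi
    (b := fun _ => 2 * m ^ 2) (fun _ _ => by positivity) (fun i hi => by
      calc ∫ ω, (e i ω ^ 2 - v) ^ (2 * p) ∂μ
          ≤ ∫ ω, (e i ω ^ (2 * (2 * p)) + v ^ (2 * p)) ∂μ :=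
            integral_mono (hXi i hi) ((hei i hi).add (integrable_const _)) (hXbd i)
        _ ≤ m ^ (2 * (2 * p)) + m ^ (2 * (2 * p)) := by
            rw [integral_add (hei i hi) (integrable_const _)]
            simpa using add_le_add (hem i hi) hvp
        _ = 2 * m ^ (2 * (2 * p)) := by ring
        _ ≤ 2 ^ (2 * p) * m ^ (2 * (2 * p)) := by gcongr
        _ = (2 * m ^ 2) ^ (2 * p) := by rw [mul_pow, ← pow_mul])
  -- the quadratic part
  set Q : Ω → ℝ := fun ω => (∑ i ∈ s, e i ω) ^ 2 / s.card with hQdef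
  have hQm : Measurable Q := ((Finset.measurable_sum _ fun i _ => he i).pow_const 2).div_const _
  have hQ0 : ∀ ω, 0 ≤ Q ω := fun ω => by positivity
  obtain ⟨hB1, hB2⟩ := integral_sum_pow_le he (hind.indepFun_fun_sum he)
    (p := 2 * p) (by omega) s he0 hei (b := fun _ => m) (fun _ _ => hm) hem
  have hQe : ∀ ω, Q ω ^ (2 * p) = (∑ i ∈ s, e i ω) ^ (2 * (2 * p)) / (s.card : ℝ) ^ (2 * p) :=
    fun ω => by rw [hQdef]; simp only; rw [div_pow, ← pow_mul]
  have hQi : Integrable (fun ω => Q ω ^ (2 * p)) μ := by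
    simp_rw [hQe]; exact hB1.div_const _
  have hQ1 : ∫ ω, Q ω ^ (2 * p) ∂μ ≤ (10 * p) ^ (2 * p) * m ^ (2 * (2 * p)) := by
    simp_rw [hQe]
    rw [integral_div, div_le_iff₀ (by positivity)]
    refine hB2.trans (le_of_eq ?_)
    rw [Finset.sum_const, nsmul_eq_mul, pow_mul m 2 (2 * p), ← mul_pow, ← mul_pow]
    push_cast
    congr 1; ring
  have hQ2 : ∫ ω, Q ω ^ (2 * p) ∂μ ≤ (s.card : ℝ) ^ (2 * p) * m ^ (2 * (2 * p)) := by
    calc ∫ ω, Q ω ^ (2 * p) ∂μ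
        ≤ ∫ ω, (s.card : ℝ) ^ (2 * p - 1) * ∑ i ∈ s, e i ω ^ (2 * (2 * p)) ∂μ :=
          integral_mono hQi ((integrable_finsetSum _ hei).const_mul _)
            fun ω => sum_sq_div_card_pow_le s ⟨i₀, hi₀⟩ _ hp
      _ = (s.card : ℝ) ^ (2 * p - 1) * ∑ i ∈ s, ∫ ω, e i ω ^ (2 * (2 * p)) ∂μ := by
          rw [integral_const_mul, integral_finsetSum _ hei]
      _ ≤ (s.card : ℝ) ^ (2 * p - 1) * ∑ _i ∈ s, m ^ (2 * (2 * p)) := by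
          gcongr with i hi; exact hem i hi
      _ = _ := by
          rw [Finset.sum_const, nsmul_eq_mul, ← mul_assoc, ← pow_succ]
          congr 2; omega
  -- The minimum of 10p and card, squared, is at most their product. This replaces p² by p · card,
  -- so the quadratic part has the order of the linear part for every p, even p larger than the
  -- cell. Without it the dependence on p would be worse.
  have hQ3 : ∫ ω, Q ω ^ (2 * p) ∂μ ≤ (10 * p * s.card * m ^ 4) ^ p := by
    have h : ∫ ω, Q ω ^ (2 * p) ∂μ ≤ (min (10 * (p : ℝ)) s.card) ^ (2 * p) * m ^ (2 * (2 * p)) := by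
      rcases min_choice (10 * (p : ℝ)) (s.card : ℝ) with h | h <;> rw [h] <;> assumption
    refine h.trans ?_
    have e4 : m ^ (2 * (2 * p)) = (m ^ 4) ^ p := by rw [← pow_mul]; congr 1; ring
    rw [pow_mul, e4, ← mul_pow]
    have := min_sq_le_mul (x := 10 * (p : ℝ)) (y := s.card) (by positivity) hk0.le
    gcongr
  have hBbd : ∀ ω, (Q ω - v) ^ (2 * p) ≤ Q ω ^ (2 * p) + v ^ (2 * p) := fun ω =>
    sub_pow_two_mul_le (hQ0 ω) hv0 p
  have hBi : Integrable (fun ω => (Q ω - v) ^ (2 * p)) μ := by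
    refine (hQi.add (integrable_const (v ^ (2 * p)))).mono'
      ((hQm.sub_const v).pow_const _).aestronglyMeasurable ?_
    filter_upwards with ω
    rw [Real.norm_of_nonneg ((even_two_mul p).pow_nonneg _)]
    exact hBbd ω
  have hB3 : ∫ ω, (Q ω - v) ^ (2 * p) ∂μ ≤ 2 * (10 * p * s.card * m ^ 4) ^ p := by
    have e4 : m ^ (2 * (2 * p)) = (m ^ 4) ^ p := by rw [← pow_mul]; congr 1; ring
    calc ∫ ω, (Q ω - v) ^ (2 * p) ∂μ ≤ ∫ ω, (Q ω ^ (2 * p) + v ^ (2 * p)) ∂μ :=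
          integral_mono hBi (hQi.add (integrable_const _)) hBbd
      _ ≤ (10 * p * s.card * m ^ 4) ^ p + (m ^ 4) ^ p := by
          rw [integral_add hQi (integrable_const _), ← e4]
          simpa using add_le_add hQ3 hvp
      _ ≤ _ := by
          have : (m ^ 4) ^ p ≤ (10 * p * s.card * m ^ 4) ^ p := by
            have h1 : 1 * m ^ 4 ≤ 10 * p * s.card * m ^ 4 := by
              gcongr; nlinarith
            gcongr; linarith
          linarith
  -- combine
  have hdec : ∀ ω, sampleVar s (fun i => e i ω) - v =
      (∑ i ∈ s, (e i ω ^ 2 - v) + -(Q ω - v)) / (s.card - 1) := by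
    intro ω
    have : (s.card : ℝ) - 1 ≠ 0 := by linarith
    rw [sampleVar, Finset.sum_sub_distrib, Finset.sum_const, nsmul_eq_mul, hQdef]
    field_simp
    ring
  have hpow : ∀ ω, (sampleVar s (fun i => e i ω) - v) ^ (2 * p) =
      (∑ i ∈ s, (e i ω ^ 2 - v) + -(Q ω - v)) ^ (2 * p) / ((s.card : ℝ) - 1) ^ (2 * p) := fun ω => by
    rw [hdec, div_pow]
  have hneg : ∀ ω, (-(Q ω - v)) ^ (2 * p) = (Q ω - v) ^ (2 * p) := fun ω =>
    (even_two_mul p).neg_pow _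
  have hBi' : Integrable (fun ω => (-(Q ω - v)) ^ (2 * p)) μ := by simpa only [hneg] using hBi
  have hsum := integrable_add_even_pow (Finset.measurable_sum _ fun i (_ : i ∈ s) => hXm i)
    (Y := fun ω => -(Q ω - v)) (hQm.sub_const v).neg hA1 hBi'
  refine ⟨by simpa only [hpow] using hsum.div_const _, ?_⟩
  simp only [hpow]
  rw [integral_div, div_le_iff₀ (by have : (0 : ℝ) < s.card - 1 := by linarith
                                    positivity)]
  calc ∫ ω, (∑ i ∈ s, (e i ω ^ 2 - v) + -(Q ω - v)) ^ (2 * p) ∂μ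
      ≤ ∫ ω, 2 ^ (2 * p - 1) * ((∑ i ∈ s, (e i ω ^ 2 - v)) ^ (2 * p) + (Q ω - v) ^ (2 * p)) ∂μ := by
        refine integral_mono hsum ((hA1.add hBi).const_mul _) fun ω => ?_
        have := (even_two_mul p).add_pow_le (a := ∑ i ∈ s, (e i ω ^ 2 - v)) (b := -(Q ω - v))
        rwa [hneg] at this
    _ = 2 ^ (2 * p - 1) * (∫ ω, (∑ i ∈ s, (e i ω ^ 2 - v)) ^ (2 * p) ∂μ +
          ∫ ω, (Q ω - v) ^ (2 * p) ∂μ) := by rw [integral_const_mul, integral_add hA1 hBi]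
    _ ≤ 2 ^ (2 * p - 1) * ((40 * p * s.card * m ^ 4) ^ p + (40 * p * s.card * m ^ 4) ^ p) := by
        have h1 : (5 * p * ∑ _i ∈ s, (2 * m ^ 2) ^ 2) ^ p ≤ (40 * p * s.card * m ^ 4) ^ p := by
          rw [Finset.sum_const, nsmul_eq_mul]
          have : 0 ≤ p * (s.card : ℝ) * m ^ 4 := by positivity
          refine pow_le_pow_left₀ (by positivity) ?_ _
          nlinarith
        have h2 : 2 * (10 * p * s.card * m ^ 4) ^ p ≤ (40 * p * s.card * m ^ 4) ^ p := by
          have : (2 : ℝ) ≤ 4 ^ p := by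
            calc (2 : ℝ) ≤ 4 ^ 1 := by norm_num
              _ ≤ 4 ^ p := pow_le_pow_right₀ (by norm_num) hp
          calc 2 * (10 * p * s.card * m ^ 4) ^ p ≤ 4 ^ p * (10 * p * s.card * m ^ 4) ^ p := by gcongr
            _ = _ := by rw [← mul_pow]; congr 1; ring
        gcongr
        · exact hA2.trans h1
        · exact hB3.trans h2
    _ = 2 ^ (2 * p) * (40 * p * s.card * m ^ 4) ^ p := by
        have : (2 : ℝ) ^ (2 * p) = 2 ^ (2 * p - 1) * 2 := by rw [← pow_succ]; congr 1; omega
        rw [this]; ring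
    _ ≤ (640 * p * m ^ 4 / s.card) ^ p * ((s.card : ℝ) - 1) ^ (2 * p) := by
        rw [pow_mul 2 2 p, pow_mul _ 2 p, ← mul_pow, ← mul_pow]
        refine pow_le_pow_left₀ (by positivity) ?_ _
        -- Uses card ≥ 2. The constant is 640 = 4 · 4 · 40, with one 4 from splitting the power of
        -- the sum and one from here.
        have h1 : (s.card : ℝ) ^ 2 ≤ 4 * ((s.card : ℝ) - 1) ^ 2 := by nlinarith
        rw [div_mul_eq_mul_div, le_div_iff₀ hk0]
        have : 0 ≤ p * m ^ 4 := by positivity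
        nlinarith

end Moments

/-! ### Sample variances over disjoint blocks -/

theorem integrable_sum_sq {Ω : Type*} [MeasurableSpace Ω] {μ : Measure Ω} {ι : Type*} {e : ι → Ω → ℝ}
    (s : Finset ι) (he2 : ∀ i ∈ s, MemLp (e i) 2 μ) :
    Integrable (fun ω => (∑ i ∈ s, e i ω) ^ 2) μ :=
  (memLp_finsetSum s he2).integrable_sq

theorem integrable_sampleVar {Ω : Type*} [MeasurableSpace Ω] {μ : Measure Ω} {ι : Type*} {e : ι → Ω → ℝ} (s : Finset ι)
    (he2 : ∀ i ∈ s, MemLp (e i) 2 μ) : Integrable (fun ω => sampleVar s (fun i => e i ω)) μ :=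
  ((integrable_finsetSum _ fun i hi => (he2 i hi).integrable_sq).sub
    ((integrable_sum_sq s he2).div_const _)).div_const _

section Blocks

variable {Ω : Type*} [MeasurableSpace Ω] {μ : Measure Ω} [IsProbabilityMeasure μ]

theorem integral_sum_sq {ι : Type*} {e : ι → Ω → ℝ} (hind : iIndepFun e μ) (s : Finset ι)
    (he0 : ∀ i ∈ s, ∫ ω, e i ω ∂μ = 0) (he2 : ∀ i ∈ s, MemLp (e i) 2 μ) {v : ℝ}
    (hev : ∀ i ∈ s, ∫ ω, e i ω ^ 2 ∂μ = v) :
    ∫ ω, (∑ i ∈ s, e i ω) ^ 2 ∂μ = s.card * v := by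
  have h := IndepFun.variance_sum he2 (fun i _ j _ hij => hind.indepFun hij)
  have e1 : (∑ i ∈ s, e i) = fun ω => ∑ i ∈ s, e i ω := by ext ω; simp
  rw [e1, variance_of_integral_eq_zero (memLp_finsetSum s he2).aemeasurable] at h
  · rw [h, Finset.sum_congr rfl (g := fun _ => v), Finset.sum_const, nsmul_eq_mul]
    intro i hi
    rw [variance_of_integral_eq_zero (he2 i hi).aemeasurable (he0 i hi), hev i hi]
  · rw [integral_finsetSum _ fun i hi => (he2 i hi).integrable (by norm_num)]
    exact Finset.sum_eq_zero he0

theorem integral_sampleVar {ι : Type*} {e : ι → Ω → ℝ} (hind : iIndepFun e μ) (s : Finset ι)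
    (hs : 2 ≤ s.card)
    (he0 : ∀ i ∈ s, ∫ ω, e i ω ∂μ = 0) (he2 : ∀ i ∈ s, MemLp (e i) 2 μ) {v : ℝ}
    (hev : ∀ i ∈ s, ∫ ω, e i ω ^ 2 ∂μ = v) :
    ∫ ω, sampleVar s (fun i => e i ω) ∂μ = v := by
  have hk2 : (2 : ℝ) ≤ s.card := by exact_mod_cast hs
  have hk : (s.card : ℝ) - 1 ≠ 0 := by linarith
  have hk0 : (s.card : ℝ) ≠ 0 := by linarith
  unfold sampleVar
  rw [integral_div, integral_sub (integrable_finsetSum _ fun i hi => (he2 i hi).integrable_sq)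
    ((integrable_sum_sq s he2).div_const _), integral_div, integral_sum_sq hind s he0 he2 hev,
    integral_finsetSum _ fun i hi => (he2 i hi).integrable_sq, Finset.sum_congr rfl hev,
    Finset.sum_const, nsmul_eq_mul]
  field_simp

theorem measurable_sampleVar {ι : Type*} (s : Finset ι) :
    Measurable (fun e : ι → ℝ => sampleVar s e) := by
  unfold sampleVar
  fun_prop

/-- Independence of disjoint blocks concerns functions of the restricted tuples, so the variance has
to be factored through the coordinates it uses. -/
theorem measurable_sampleVar_restrict {ι : Type*} (s t : Finset ι) (h : s ⊆ t) :
    ∃ g : (t → ℝ) → ℝ, Measurable g ∧ ∀ e : ι → ℝ, g (fun i => e i) = sampleVar s e := by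
  classical
  have hm : Measurable (fun (y : t → ℝ) (i : ι) => if hi : i ∈ t then y ⟨i, hi⟩ else 0) := by
    refine measurable_pi_lambda _ fun i => ?_
    by_cases hi : i ∈ t
    · simp only [hi, dite_true]; exact measurable_pi_apply _
    · simp only [hi, dite_false]; exact measurable_const
  refine ⟨fun y => sampleVar s (fun i => if hi : i ∈ t then y ⟨i, hi⟩ else 0),
    (measurable_sampleVar s).comp hm, fun e => ?_⟩
  have h1 : ∀ i ∈ s, (if i ∈ t then e i else 0) = e i := fun i hi => if_pos (h hi)
  have h2 : ∑ i ∈ s, (if i ∈ t then e i else 0) = ∑ i ∈ s, e i := Finset.sum_congr rfl h1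
  have h3 : ∑ i ∈ s, (if i ∈ t then e i else 0) ^ 2 = ∑ i ∈ s, e i ^ 2 :=
    Finset.sum_congr rfl fun i hi => by rw [h1 i hi]
  simp only [sampleVar, dite_eq_ite, h2, h3]

/-- Moments of a weighted sum of variance estimators over disjoint blocks of independent
variables. -/
theorem integral_sum_sampleVar_pow_le {ι Λ : Type*} [Fintype ι] [Fintype Λ] [DecidableEq Λ]
    {e : ι → Ω → ℝ}
    (he : ∀ i, Measurable (e i)) (hind : iIndepFun e μ) (c : ι → Λ) {A : ℝ} (hA : 2 ≤ A)
    (hcard : ∀ l, A ≤ ((Finset.univ.filter fun i => c i = l).card : ℝ)) {p : ℕ} (hp : 1 ≤ p)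
    (he0 : ∀ i, ∫ ω, e i ω ∂μ = 0) {v m : Λ → ℝ} (hm : ∀ l, 0 ≤ m l)
    (hev : ∀ i, ∫ ω, e i ω ^ 2 ∂μ = v (c i))
    (hei : ∀ i, Integrable (fun ω => e i ω ^ (2 * (2 * p))) μ)
    (hem : ∀ i, ∫ ω, e i ω ^ (2 * (2 * p)) ∂μ ≤ m (c i) ^ (2 * (2 * p)))
    {r : Λ → ℝ} {R : ℝ} (hr : ∀ l, 0 ≤ r l) (hrR : ∀ l, r l ≤ R) :
    Integrable (fun ω => (∑ l, r l * (sampleVar (Finset.univ.filter fun i => c i = l)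
        (fun i => e i ω) - v l)) ^ (2 * p)) μ ∧
    ∫ ω, (∑ l, r l * (sampleVar (Finset.univ.filter fun i => c i = l)
        (fun i => e i ω) - v l)) ^ (2 * p) ∂μ ≤
      (3200 * p ^ 2 * R ^ 2 / A * ∑ l, m l ^ 4) ^ p := by
  set s : Λ → Finset ι := fun l => Finset.univ.filter fun i => c i = l with hs
  have hmem : ∀ {l i}, i ∈ s l → c i = l := fun h => (Finset.mem_filter.1 h).2
  have hcard2 : ∀ l, 2 ≤ (s l).card := fun l => by exact_mod_cast hA.trans (hcard l)
  have hk0 : ∀ l, (0 : ℝ) < (s l).card := fun l => by linarith [hcard l]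
  have hev4 : Even (2 * (2 * p)) := even_two_mul _
  have he2 : ∀ i, MemLp (e i) 2 μ := fun i => by
    rw [memLp_two_iff_integrable_sq (he i).aestronglyMeasurable]
    exact integrable_pow_of_le (he i) (N := 2 * (2 * p))
      (by simpa only [hev4.pow_abs] using hei i) (by omega)
  have hX : ∀ l, Measurable (fun ω => r l * (sampleVar (s l) (fun i => e i ω) - v l)) := fun l =>
    (((measurable_sampleVar (s l)).comp (measurable_pi_lambda _ he)).sub_const _).const_mul _
  have hblk := fun l => integral_sampleVar_sub_pow_le he hind (s l) (hcard2 l) hp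
    (fun i _ => he0 i) (hm l) (v := v l) (fun i hi => by rw [hev i, hmem hi]) (fun i _ => hei i)
    (fun i hi => by simpa only [hmem hi] using hem i)
  -- The partial sum over `t` depends only on the variables allocated to `t`, which are disjoint
  -- from block `l`.
  have hindep : ∀ (t : Finset Λ) (l : Λ), l ∉ t →
      IndepFun (fun ω => ∑ j ∈ t, r j * (sampleVar (s j) (fun i => e i ω) - v j))
        (fun ω => r l * (sampleVar (s l) (fun i => e i ω) - v l)) μ := by
    intro t l hl
    set T : Finset ι := Finset.univ.filter fun i => c i ∈ t
    have hdis : Disjoint T (s l) := by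
      rw [Finset.disjoint_left]
      intro i hi hi'
      rw [Finset.mem_filter] at hi
      exact hl (hmem hi' ▸ hi.2)
    have h0 := hind.indepFun_finset T (s l) hdis he
    have hsub : ∀ j ∈ t, s j ⊆ T := fun j hj i hi => by
      rw [Finset.mem_filter]; exact ⟨Finset.mem_univ _, by rw [hmem hi]; exact hj⟩
    have hg : ∀ j, ∃ g : (T → ℝ) → ℝ, Measurable g ∧
        (j ∈ t → ∀ y : ι → ℝ, g (fun i => y i) = sampleVar (s j) y) := fun j => by
      by_cases hj : j ∈ t
      · obtain ⟨g, h1, h2⟩ := measurable_sampleVar_restrict (s j) T (hsub j hj)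
        exact ⟨g, h1, fun _ => h2⟩
      · exact ⟨fun _ => 0, measurable_const, fun h => absurd h hj⟩
    choose g hgm hg using hg
    obtain ⟨g', hgm', hg'⟩ := measurable_sampleVar_restrict (s l) (s l) subset_rfl
    have h1 := h0.comp (φ := fun y => ∑ j ∈ t, r j * (g j y - v j))
      (ψ := fun y => r l * (g' y - v l))
      (Finset.measurable_sum _ fun j _ => ((hgm j).sub_const _).const_mul _)
      ((hgm'.sub_const _).const_mul _)
    convert h1 using 1
    · ext ω
      simp only [Function.comp]
      exact Finset.sum_congr rfl fun j hj => by rw [← hg j hj]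
    · ext ω
      simp only [Function.comp]
      rw [← hg']
  have hpw : ∀ l ω, (r l * (sampleVar (s l) (fun i => e i ω) - v l)) ^ (2 * p) =
      r l ^ (2 * p) * (sampleVar (s l) (fun i => e i ω) - v l) ^ (2 * p) := fun l ω => mul_pow _ _ _
  -- Squared norm bound for one weighted block, the block size being replaced by its lower bound A.
  -- Summing over blocks multiplies it by 5p, whence 3200 p².
  have hbsq : ∀ l, 0 ≤ 640 * p * m l ^ 4 * R ^ 2 / A := fun l => by positivity
  obtain ⟨h1, h2⟩ := integral_sum_pow_le hX hindep hp Finset.univ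
    (fun l _ => by
      rw [integral_const_mul, integral_sub (integrable_sampleVar _ fun i _ => he2 i)
        (integrable_const _), integral_sampleVar hind (s l) (hcard2 l) (fun i _ => he0 i)
        (fun i _ => he2 i) (v := v l) (fun i hi => by rw [hev i, hmem hi])]
      simp)
    (fun l _ => by
      simp only [hpw]
      exact (hblk l).1.const_mul _)
    (b := fun l => Real.sqrt (640 * p * m l ^ 4 * R ^ 2 / A)) (fun l _ => Real.sqrt_nonneg _)
    (fun l _ => by
      simp only [hpw]
      rw [integral_const_mul, pow_mul (Real.sqrt _), Real.sq_sqrt (hbsq l), pow_mul (r l)]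
      calc (r l ^ 2) ^ p * ∫ ω, (sampleVar (s l) (fun i => e i ω) - v l) ^ (2 * p) ∂μ
          ≤ (R ^ 2) ^ p * (640 * p * m l ^ 4 / A) ^ p := by
            have hA1 := (hblk l).2
            have hA2 : (640 * p * m l ^ 4 / (s l).card : ℝ) ≤ 640 * p * m l ^ 4 / A :=
              div_le_div_of_nonneg_left (by positivity) (by linarith) (hcard l)
            have hA3 := hrR l
            have hA4 := hr l
            refine mul_le_mul (by gcongr) (hA1.trans ?_)
              (integral_nonneg fun ω => (even_two_mul p).pow_nonneg _) (by positivity)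
            exact pow_le_pow_left₀ (by positivity) hA2 _
        _ = _ := by rw [← mul_pow]; congr 1; ring)
  refine ⟨h1, h2.trans (le_of_eq ?_)⟩
  congr 1
  simp only [Real.sq_sqrt (hbsq _)]
  rw [Finset.mul_sum, Finset.mul_sum]
  refine Finset.sum_congr rfl fun l _ => ?_
  ring

/-- Markov's inequality for even moments. -/
theorem measureReal_lt_abs_le {T : Ω → ℝ} {p : ℕ} (hp : 1 ≤ p)
    (hTi : Integrable (fun ω => T ω ^ (2 * p)) μ) {B : ℝ} (hB : 0 ≤ B)
    (hT : ∫ ω, T ω ^ (2 * p) ∂μ ≤ B ^ (2 * p)) :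
    μ.real {ω | Real.exp 1 * B < |T ω|} ≤ Real.exp (-(2 * p)) := by
  have hnn : ∀ ω, 0 ≤ T ω ^ (2 * p) := fun ω => (even_two_mul p).pow_nonneg _
  rcases hB.eq_or_lt with rfl | hB
  · have h0 : ∫ ω, T ω ^ (2 * p) ∂μ = 0 :=
      le_antisymm (by simpa [show p ≠ 0 by omega] using hT) (integral_nonneg hnn)
    rw [integral_eq_zero_iff_of_nonneg hnn hTi] at h0
    have : μ.real {ω | Real.exp 1 * 0 < |T ω|} = 0 := by
      rw [measureReal_eq_zero_iff]
      refine measure_mono_null (fun ω hω => ?_) (ae_iff.1 h0)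
      simp only [mul_zero, Set.mem_ofPred_eq, abs_pos] at hω
      simpa [show p ≠ 0 by omega] using hω
    rw [this]; positivity
  · have h1 := mul_meas_ge_le_integral_of_nonneg (μ := μ) (Filter.Eventually.of_forall hnn) hTi
      ((Real.exp 1 * B) ^ (2 * p))
    have h2 : μ.real {ω | Real.exp 1 * B < |T ω|} ≤
        μ.real {ω | (Real.exp 1 * B) ^ (2 * p) ≤ T ω ^ (2 * p)} := by
      refine measureReal_mono fun ω hω => ?_
      simp only [Set.mem_ofPred_eq] at hω ⊢
      rw [← (even_two_mul p).pow_abs (T ω)]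
      exact pow_le_pow_left₀ (by positivity) hω.le _
    have h3 := h1.trans hT
    rw [mul_pow, mul_right_comm] at h3
    have h4 : Real.exp 1 ^ (2 * p) *
        μ.real {ω | Real.exp 1 ^ (2 * p) * B ^ (2 * p) ≤ T ω ^ (2 * p)} ≤ 1 :=
      le_of_mul_le_mul_right (by rwa [one_mul]) (pow_pos hB (2 * p))
    have e1 : Real.exp 1 ^ (2 * p) = Real.exp (2 * p) := by
      rw [← Real.exp_nat_mul]; push_cast; ring_nf
    rw [mul_pow] at h2
    rw [e1] at h2 h4
    rw [Real.exp_neg, ← one_div, le_div_iff₀' (Real.exp_pos _)]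
    exact (mul_le_mul_of_nonneg_left h2 (Real.exp_pos _).le).trans h4

end Blocks

/-! ### Quadratic forms in exchangeable weights -/

section Exchangeable

variable {n : ℕ}

/-- Relabelling the coordinates of `Fin n → ℝ`. -/
def permEquiv (σ : Equiv.Perm (Fin n)) : (Fin n → ℝ) ≃ᵐ (Fin n → ℝ) where
  toFun w i := w (σ i)
  invFun w i := w (σ.symm i)
  left_inv w := by ext i; simp
  right_inv w := by ext i; simp
  measurable_toFun := measurable_pi_lambda _ fun i => measurable_pi_apply _
  measurable_invFun := measurable_pi_lambda _ fun i => measurable_pi_apply _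

/-- The average of `w` over the index set `K`. -/
def avgOn (K : Finset (Fin n)) (w : Fin n → ℝ) : ℝ := (∑ i ∈ K, w i) / K.card

theorem measurable_avgOn (K : Finset (Fin n)) : Measurable (avgOn K) := by
  unfold avgOn; fun_prop

/-- The first `k` indices. -/
def firstIdx (n k : ℕ) : Finset (Fin n) := Finset.univ.filter fun i => i.val < k

theorem card_firstIdx {k : ℕ} (hk : k ≤ n) : (firstIdx n k).card = k := by
  rw [firstIdx, Fin.card_filter_val_lt]; omega

theorem avg_eq_avgOn {k : ℕ} (hk : k ≤ n) (w : Fin n → ℝ) : avg k w = avgOn (firstIdx n k) w := by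
  rw [avgOn, card_firstIdx hk]; rfl

theorem measurable_avg (k : ℕ) : Measurable (avg k : (Fin n → ℝ) → ℝ) := by
  unfold avg; fun_prop

variable {ν : Measure (Fin n → ℝ)} (hν : IsWeightLaw ν)

include hν

/-- Relabelling is a measurable equivalence, so no measurability of `F` is needed. -/
theorem IsWeightLaw.integral_perm (σ : Equiv.Perm (Fin n)) (F : (Fin n → ℝ) → ℝ) :
    ∫ w, F (fun i => w (σ i)) ∂ν = ∫ w, F w ∂ν := by
  conv_rhs => rw [← hν.exchangeable σ]
  exact (integral_map_equiv (permEquiv σ) F).symm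

theorem IsWeightLaw.ae_nonneg : ∀ᵐ w ∂ν, ∀ i, 0 ≤ w i := ae_all_iff.2 hν.nonneg

theorem IsWeightLaw.integrable_coord (i : Fin n) : Integrable (fun w => w i) ν := by
  have := hν.isProbabilityMeasure
  exact (hν.memLp_two i).integrable (by norm_num)

theorem IsWeightLaw.integrable_avgOn (K : Finset (Fin n)) : Integrable (avgOn K) ν :=
  (integrable_finsetSum _ fun i _ => hν.integrable_coord i).div_const _

omit hν in
theorem abs_sub_avgOn_le {K : Finset (Fin n)} {i : Fin n} (hi : i ∈ K) {w : Fin n → ℝ}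
    (hw : ∀ i, 0 ≤ w i) : |w i - avgOn K w| ≤ K.card * avgOn K w := by
  have hk : (1 : ℝ) ≤ K.card := by exact_mod_cast Finset.card_pos.2 ⟨i, hi⟩
  have h1 : K.card * avgOn K w = ∑ j ∈ K, w j := by
    rw [avgOn, mul_div_cancel₀]; linarith
  have h2 : w i ≤ ∑ j ∈ K, w j := Finset.single_le_sum (fun j _ => hw j) hi
  have h3 : 0 ≤ avgOn K w := div_nonneg (Finset.sum_nonneg fun j _ => hw j) (by linarith)
  have h4 := hw i
  rw [abs_le]
  constructor <;> nlinarith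

omit hν in
theorem sum_sub_avgOn (K : Finset (Fin n)) (w : Fin n → ℝ) : ∑ i ∈ K, (w i - avgOn K w) = 0 := by
  rcases K.eq_empty_or_nonempty with rfl | hK
  · simp
  have hk : (K.card : ℝ) ≠ 0 := by exact_mod_cast hK.card_pos.ne'
  rw [Finset.sum_sub_distrib, Finset.sum_const, nsmul_eq_mul, avgOn, mul_div_cancel₀ _ hk, sub_self]

/-- The growth condition on `f` admits 1/a and 1/a². Nonnegative weights satisfy |w_i - avg| ≤ k ·
avg, which cancels the singularity at 0 and leaves the integrable bound k² (1 + avg). -/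
theorem IsWeightLaw.integrable_dev {f : ℝ → ℝ} (hf : Measurable f)
    (hfb : ∀ a, 0 ≤ a → a ^ 2 * |f a| ≤ 1 + a) {K : Finset (Fin n)} {i j : Fin n} (hi : i ∈ K)
    (hj : j ∈ K) :
    Integrable (fun w => (w i - avgOn K w) * (w j - avgOn K w) * f (avgOn K w)) ν := by
  have := hν.isProbabilityMeasure
  have hm := measurable_avgOn K
  refine (((integrable_const (1 : ℝ)).add (hν.integrable_avgOn K)).const_mul
    ((K.card : ℝ) ^ 2)).mono' ?_ ?_
  · have h1 : Measurable fun w : Fin n → ℝ => w i := measurable_pi_apply i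
    have h2 : Measurable fun w : Fin n → ℝ => w j := measurable_pi_apply j
    exact (((h1.sub hm).mul (h2.sub hm)).mul (hf.comp hm)).aestronglyMeasurable
  · filter_upwards [hν.ae_nonneg] with w hw
    have ha : 0 ≤ avgOn K w := div_nonneg (Finset.sum_nonneg fun j _ => hw j) (by positivity)
    rw [Real.norm_eq_abs, abs_mul, abs_mul]
    calc |w i - avgOn K w| * |w j - avgOn K w| * |f (avgOn K w)|
        ≤ (K.card * avgOn K w) * (K.card * avgOn K w) * |f (avgOn K w)| := by
          gcongr
          · exact abs_sub_avgOn_le hi hw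
          · exact abs_sub_avgOn_le hj hw
      _ = (K.card : ℝ) ^ 2 * (avgOn K w ^ 2 * |f (avgOn K w)|) := by ring
      _ ≤ (K.card : ℝ) ^ 2 * (1 + avgOn K w) := by gcongr; exact hfb _ ha

omit hν in
theorem avgOn_comp_perm (K : Finset (Fin n)) (σ : Equiv.Perm (Fin n)) (w : Fin n → ℝ) :
    avgOn K (fun i => w (σ i)) = avgOn (K.map σ.toEmbedding) w := by
  rw [avgOn, avgOn, Finset.card_map, Finset.sum_map]; rfl

omit hν in
theorem map_swap_eq {K : Finset (Fin n)} {i j : Fin n} (hi : i ∈ K) (hj : j ∈ K) :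
    K.map (Equiv.swap i j).toEmbedding = K := by
  apply Finset.eq_of_subset_of_card_le
  · intro x hx
    rw [Finset.mem_map] at hx
    obtain ⟨y, hy, rfl⟩ := hx
    simp only [Equiv.coe_toEmbedding]
    rcases eq_or_ne y i with rfl | h1
    · rwa [Equiv.swap_apply_left]
    rcases eq_or_ne y j with rfl | h2
    · rwa [Equiv.swap_apply_right]
    rwa [Equiv.swap_apply_of_ne_of_ne h1 h2]
  · rw [Finset.card_map]

theorem IsWeightLaw.integral_dev_sq_eq (f : ℝ → ℝ) {K : Finset (Fin n)} {i j : Fin n} (hi : i ∈ K)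
    (hj : j ∈ K) : ∫ w, (w i - avgOn K w) ^ 2 * f (avgOn K w) ∂ν =
      ∫ w, (w j - avgOn K w) ^ 2 * f (avgOn K w) ∂ν := by
  have := hν.integral_perm (Equiv.swap i j) (fun w => (w i - avgOn K w) ^ 2 * f (avgOn K w))
  simp only [avgOn_comp_perm, map_swap_eq hi hj, Equiv.swap_apply_left] at this
  exact this.symm

/-- Weighted covariances of the centered weights. -/
theorem IsWeightLaw.integral_dev_mul {f : ℝ → ℝ} (hf : Measurable f)
    (hfb : ∀ a, 0 ≤ a → a ^ 2 * |f a| ≤ 1 + a) {K : Finset (Fin n)} {i j : Fin n} (hi : i ∈ K)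
    (hj : j ∈ K) (hij : i ≠ j) :
    ((K.card : ℝ) - 1) * ∫ w, (w i - avgOn K w) * (w j - avgOn K w) * f (avgOn K w) ∂ν =
      -∫ w, (w i - avgOn K w) ^ 2 * f (avgOn K w) ∂ν := by
  have hsame : ∀ l ∈ K.erase i, ∫ w, (w i - avgOn K w) * (w l - avgOn K w) * f (avgOn K w) ∂ν =
      ∫ w, (w i - avgOn K w) * (w j - avgOn K w) * f (avgOn K w) ∂ν := by
    intro l hl
    obtain ⟨hli, hlK⟩ := Finset.mem_erase.1 hl
    have := hν.integral_perm (Equiv.swap l j)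
      (fun w => (w i - avgOn K w) * (w l - avgOn K w) * f (avgOn K w))
    simp only [avgOn_comp_perm, map_swap_eq hlK hj, Equiv.swap_apply_left,
      Equiv.swap_apply_of_ne_of_ne hli.symm hij] at this
    exact this.symm
  have h0 : ∑ l ∈ K, ∫ w, (w i - avgOn K w) * (w l - avgOn K w) * f (avgOn K w) ∂ν = 0 := by
    rw [← integral_finsetSum _ fun l hl => hν.integrable_dev hf hfb hi hl]
    have : ∀ w : Fin n → ℝ, ∑ l ∈ K, (w i - avgOn K w) * (w l - avgOn K w) * f (avgOn K w) = 0 :=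
      fun w => by rw [← Finset.sum_mul, ← Finset.mul_sum, sum_sub_avgOn]; ring
    simp [this]
  rw [← Finset.add_sum_erase _ _ hi, Finset.sum_congr rfl hsame, Finset.sum_const, nsmul_eq_mul,
    Finset.card_erase_of_mem hi, Nat.cast_pred (Finset.card_pos.2 ⟨i, hi⟩)] at h0
  have e1 : ∀ w : Fin n → ℝ, (w i - avgOn K w) * (w i - avgOn K w) = (w i - avgOn K w) ^ 2 :=
    fun w => by ring
  simp only [e1] at h0
  linarith

/-- Resampling quadratic forms are multiples of the unbiased variance estimator. -/
theorem IsWeightLaw.integral_quadratic {f : ℝ → ℝ} (hf : Measurable f)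
    (hfb : ∀ a, 0 ≤ a → a ^ 2 * |f a| ≤ 1 + a) {K : Finset (Fin n)} {i₀ : Fin n} (hi₀ : i₀ ∈ K)
    (e : Fin n → ℝ) :
    ∫ w, (∑ i ∈ K, (w i - avgOn K w) * e i) ^ 2 * f (avgOn K w) ∂ν =
      K.card * sampleVar K e * ∫ w, (w i₀ - avgOn K w) ^ 2 * f (avgOn K w) ∂ν := by
  have hk1 : 1 ≤ K.card := Finset.card_pos.2 ⟨i₀, hi₀⟩
  rcases hk1.eq_or_lt with hk | hk
  · obtain ⟨x, rfl⟩ := Finset.card_eq_one.1 hk.symm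
    simp [avgOn, sampleVar]
  have hk2 : (2 : ℝ) ≤ K.card := by exact_mod_cast hk
  have hkne : (K.card : ℝ) - 1 ≠ 0 := by linarith
  have hkne' : (K.card : ℝ) ≠ 0 := by linarith
  set J := ∫ w, (w i₀ - avgOn K w) ^ 2 * f (avgOn K w) ∂ν with hJ
  have hexp : ∀ w : Fin n → ℝ, (∑ i ∈ K, (w i - avgOn K w) * e i) ^ 2 * f (avgOn K w) =
      ∑ i ∈ K, ∑ j ∈ K, e i * e j * ((w i - avgOn K w) * (w j - avgOn K w) * f (avgOn K w)) := by
    intro w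
    rw [sq, Finset.sum_mul_sum, Finset.sum_mul]
    refine Finset.sum_congr rfl fun i _ => ?_
    rw [Finset.sum_mul]
    refine Finset.sum_congr rfl fun j _ => ?_
    ring
  simp only [hexp]
  rw [integral_finsetSum _ fun i hi => integrable_finsetSum _ fun j hj =>
    (hν.integrable_dev hf hfb hi hj).const_mul _]
  -- All entries of the covariance matrix in one formula: J on the diagonal and -J/(k - 1) off it.
  -- This is the centring projection times J k/(k - 1), which produces the sample variance.
  have hval : ∀ i ∈ K, ∀ j ∈ K,
      ∫ w, (w i - avgOn K w) * (w j - avgOn K w) * f (avgOn K w) ∂ν =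
        (if i = j then J * (K.card / (K.card - 1)) else 0) - J / (K.card - 1) := by
    intro i hi j hj
    split_ifs with h
    · subst h
      have : ∫ w, (w i - avgOn K w) * (w i - avgOn K w) * f (avgOn K w) ∂ν = J := by
        rw [hJ, ← hν.integral_dev_sq_eq f hi hi₀]
        congr 1; ext w; ring
      rw [this]
      field_simp
    · have h1 := hν.integral_dev_mul hf hfb hi hj h
      rw [hν.integral_dev_sq_eq f hi hi₀, ← hJ] at h1
      rw [zero_sub, eq_neg_iff_add_eq_zero]
      field_simp
      linarith
  have h2 : ∀ i ∈ K, ∫ w, ∑ j ∈ K,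
      e i * e j * ((w i - avgOn K w) * (w j - avgOn K w) * f (avgOn K w)) ∂ν =
      e i ^ 2 * (J * (K.card / (K.card - 1))) - e i * (∑ j ∈ K, e j) * (J / (K.card - 1)) := by
    intro i hi
    rw [integral_finsetSum _ fun j hj => (hν.integrable_dev hf hfb hi hj).const_mul _]
    have : ∀ j ∈ K, ∫ w, e i * e j * ((w i - avgOn K w) * (w j - avgOn K w) * f (avgOn K w)) ∂ν =
        (if i = j then e i * e j * (J * (K.card / (K.card - 1))) else 0) -
          e i * e j * (J / (K.card - 1)) := by
      intro j hj
      rw [integral_const_mul, hval i hi j hj]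
      split_ifs <;> ring
    rw [Finset.sum_congr rfl this, Finset.sum_sub_distrib, Finset.sum_ite_eq, if_pos hi,
      ← Finset.sum_mul, ← Finset.mul_sum]
    ring
  rw [Finset.sum_congr rfl h2, Finset.sum_sub_distrib, ← Finset.sum_mul, ← Finset.sum_mul,
    ← Finset.sum_mul, sampleVar]
  field_simp

omit hν in
theorem exists_perm_map_firstIdx (K : Finset (Fin n)) :
    ∃ σ : Equiv.Perm (Fin n), (firstIdx n K.card).map σ.toEmbedding = K := by
  classical
  have hk : K.card ≤ n := by simpa using Finset.card_le_univ K
  let e : {x // x ∈ firstIdx n K.card} ≃ {x // x ∈ K} :=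
    Finset.equivOfCardEq (card_firstIdx hk)
  refine ⟨e.extendSubtype, ?_⟩
  apply Finset.eq_of_subset_of_card_le
  · intro x hx
    rw [Finset.mem_map] at hx
    obtain ⟨y, hy, rfl⟩ := hx
    exact e.extendSubtype_mem y hy
  · rw [Finset.card_map, card_firstIdx hk]

/-- Carries an arbitrary index set onto the first indices, so that only its cardinality matters;
this is the form in which `R1` and `R2` are defined. -/
theorem IsWeightLaw.integral_dev_sq_eq_first [NeZero n] (f : ℝ → ℝ) {K : Finset (Fin n)} {i : Fin n}
    (hi : i ∈ K) : ∫ w, (w i - avgOn K w) ^ 2 * f (avgOn K w) ∂ν =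
      ∫ w, (w 0 - avg K.card w) ^ 2 * f (avg K.card w) ∂ν := by
  have hk : K.card ≤ n := by simpa using Finset.card_le_univ K
  obtain ⟨σ, hσ⟩ := exists_perm_map_firstIdx K
  have h0 : (0 : Fin n) ∈ firstIdx n K.card := by
    simp only [firstIdx, Finset.mem_filter, Finset.mem_univ, true_and]
    exact Finset.card_pos.2 ⟨i, hi⟩
  have h1 : σ 0 ∈ K := by
    rw [← hσ]; exact Finset.mem_map_of_mem _ h0
  rw [hν.integral_dev_sq_eq f hi h1]
  have := hν.integral_perm σ (fun w => (w 0 - avg K.card w) ^ 2 * f (avg K.card w))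
  simp only [avg_eq_avgOn hk, avgOn_comp_perm, hσ] at this ⊢
  exact this

theorem IsWeightLaw.measureReal_avgOn_pos (K : Finset (Fin n)) :
    ν.real {w | 0 < avgOn K w} = ν.real {w | 0 < avg K.card w} := by
  have hk : K.card ≤ n := by simpa using Finset.card_le_univ K
  obtain ⟨σ, hσ⟩ := exists_perm_map_firstIdx K
  have h := hν.integral_perm σ (fun w => {w | 0 < avg K.card w}.indicator (fun _ => (1 : ℝ)) w)
  have h2 : ∀ w : Fin n → ℝ, {w | 0 < avg K.card w}.indicator (fun _ => (1 : ℝ))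
      (fun i => w (σ i)) = {w | 0 < avgOn K w}.indicator (fun _ => (1 : ℝ)) w := by
    intro w
    simp only [Set.indicator, Set.mem_ofPred_eq, avg_eq_avgOn hk, avgOn_comp_perm, hσ]
  simp only [h2] at h
  rw [integral_indicator_const _ (measurableSet_lt measurable_const (measurable_avgOn K)),
    integral_indicator_const _ (measurableSet_lt measurable_const (measurable_avg _))] at h
  simpa using h

omit hν in
theorem integral_cond_eq {Ω : Type*} [MeasurableSpace Ω] (μ : Measure Ω) (s : Set Ω) (F : Ω → ℝ) :
    ∫ ω, F ω ∂(μ[|s]) = (μ.real s)⁻¹ * ∫ ω in s, F ω ∂μ := by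
  rw [ProbabilityTheory.cond, integral_smul_measure, ENNReal.toReal_inv, smul_eq_mul]; rfl

/-- `R₁` without conditioning: the integrand vanishes when the average does. -/
theorem IsWeightLaw.R1_eq [NeZero n] {k : ℕ} : R1 ν k =
    (ν.real {w | 0 < avg k w})⁻¹ * ∫ w, (w 0 - avg k w) ^ 2 * (1 / avg k w ^ 2) ∂ν := by
  rw [R1, integral_cond_eq]
  simp only [mul_one_div]
  congr 1
  rw [← integral_indicator (measurableSet_lt measurable_const (measurable_avg _))]
  refine integral_congr_ae ?_
  filter_upwards [hν.ae_nonneg] with w hw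
  have ha : 0 ≤ avg k w := div_nonneg (Finset.sum_nonneg fun j _ => hw j) (by positivity)
  rcases ha.eq_or_lt with h | h
  · simp [← h]
  · simp [Set.indicator, h]

omit hν in
theorem R2_eq [NeZero n] {k : ℕ} : R2 ν k =
    ∫ w, (w 0 - avg k w) ^ 2 * (1 / avg k w) ∂ν := by
  simp only [R2, mul_one_div]

theorem IsWeightLaw.R1_nonneg [NeZero n] (k : ℕ) : 0 ≤ R1 ν k := by
  rw [hν.R1_eq]
  exact mul_nonneg (by positivity) (integral_nonneg fun w => by positivity)

theorem IsWeightLaw.R2_nonneg [NeZero n] (k : ℕ) : 0 ≤ R2 ν k := by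
  refine integral_nonneg_of_ae ?_
  filter_upwards [hν.ae_nonneg] with w hw
  have ha : 0 ≤ avg k w := div_nonneg (Finset.sum_nonneg fun j _ => hw j) (by positivity)
  show (0 : ℝ) ≤ (w 0 - avg k w) ^ 2 / avg k w
  positivity

omit hν in
theorem sq_mul_abs_inv_sq_le (a : ℝ) (ha : 0 ≤ a) : a ^ 2 * |1 / a ^ 2| ≤ 1 + a := by
  rcases ha.eq_or_lt with rfl | h
  · simp
  · rw [abs_of_pos (by positivity), mul_one_div_cancel (by positivity)]; linarith

omit hν in
theorem sq_mul_abs_inv_le (a : ℝ) (ha : 0 ≤ a) : a ^ 2 * |1 / a| ≤ 1 + a := by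
  rcases ha.eq_or_lt with rfl | h
  · simp
  · rw [abs_of_pos (by positivity), sq, mul_assoc, mul_one_div_cancel h.ne']; linarith

end Exchangeable

/-! ### The penalty as a combination of sample variances -/

section Penalty

variable {n : ℕ} {𝒳 Λ : Type*}

open Classical in
/-- Indices of the sample points whose covariate lies in `I`. -/
def idxIn (z : Fin n → 𝒳 × ℝ) (I : Set 𝒳) : Finset (Fin n) :=
  Finset.univ.filter fun i => (z i).1 ∈ I

theorem sum_indicator_eq (z : Fin n → 𝒳 × ℝ) (I : Set 𝒳) (g : Fin n → ℝ) :
    ∑ i, I.indicator (fun _ => g i) (z i).1 = ∑ i ∈ idxIn z I, g i := by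
  classical
  rw [idxIn, Finset.sum_filter]
  exact Finset.sum_congr rfl fun i _ => by simp [Set.indicator]

theorem count_eq_card (z : Fin n → 𝒳 × ℝ) (I : Set 𝒳) : count z I = (idxIn z I).card := by
  rw [count, sum_indicator_eq z I (fun _ => 1)]; simp

theorem mul_pHat [NeZero n] (z : Fin n → 𝒳 × ℝ) (I : Set 𝒳) :
    (n : ℝ) * pHat z I = (idxIn z I).card := by
  rw [pHat, count_eq_card, mul_div_cancel₀]
  exact_mod_cast NeZero.ne n

theorem wHat_eq [NeZero n] (z : Fin n → 𝒳 × ℝ) (I : Set 𝒳) (w : Fin n → ℝ) :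
    wHat z I w = avgOn (idxIn z I) w := by
  rw [wHat, mul_pHat, sum_indicator_eq]; rfl

theorem betaHat_eq [NeZero n] (z : Fin n → 𝒳 × ℝ) (I : Set 𝒳) :
    betaHat z I = (∑ i ∈ idxIn z I, (z i).2) / (idxIn z I).card := by
  rw [betaHat, mul_pHat, sum_indicator_eq z I (fun i => (z i).2)]

/-- The coefficients w_i - avg sum to zero, so subtracting any constant b from the responses changes
nothing. Later b is the cell mean `beta`, which makes the responses centred. -/
theorem betaHatW_sub_betaHat [NeZero n] (z : Fin n → 𝒳 × ℝ) (I : Set 𝒳) (w : Fin n → ℝ)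
    (hw : 0 < avgOn (idxIn z I) w) (hk : (idxIn z I).Nonempty) (b : ℝ) :
    betaHatW z I w - betaHat z I =
      (∑ i ∈ idxIn z I, (w i - avgOn (idxIn z I) w) * ((z i).2 - b)) /
        ((idxIn z I).card * avgOn (idxIn z I) w) := by
  have hk0 : ((idxIn z I).card : ℝ) ≠ 0 := by exact_mod_cast hk.card_pos.ne'
  have h1 : ∑ i ∈ idxIn z I, (w i - avgOn (idxIn z I) w) * ((z i).2 - b) =
      ∑ i ∈ idxIn z I, w i * (z i).2 - avgOn (idxIn z I) w * ∑ i ∈ idxIn z I, (z i).2 := by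
    calc _ = ∑ i ∈ idxIn z I, w i * (z i).2 - avgOn (idxIn z I) w * ∑ i ∈ idxIn z I, (z i).2 -
          (∑ i ∈ idxIn z I, (w i - avgOn (idxIn z I) w)) * b := by
          rw [Finset.mul_sum, Finset.sum_mul, ← Finset.sum_sub_distrib, ← Finset.sum_sub_distrib]
          exact Finset.sum_congr rfl fun i _ => by ring
      _ = _ := by rw [sum_sub_avgOn]; ring
  rw [h1, betaHatW, betaHat_eq, pHatW, ← mul_assoc, mul_pHat, wHat_eq,
    sum_indicator_eq z I (fun i => w i * (z i).2)]
  field_simp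

/-- The contribution of one cell to the resampling penalty. -/
theorem pen_cell_eq [NeZero n] {ν : Measure (Fin n → ℝ)} (hν : IsWeightLaw ν)
    (z : Fin n → 𝒳 × ℝ) (I : Set 𝒳) (b : ℝ) :
    (∫ w, pHat z I * (betaHatW z I w - betaHat z I) ^ 2 ∂(ν[|{w | 0 < wHat z I w}])) +
      ∫ w, pHatW z I w * (betaHatW z I w - betaHat z I) ^ 2 ∂ν =
    (R1 ν (idxIn z I).card + R2 ν (idxIn z I).card) / n *
      sampleVar (idxIn z I) (fun i => (z i).2 - b) := by
  set K := idxIn z I with hK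
  have hn : (n : ℝ) ≠ 0 := by exact_mod_cast NeZero.ne n
  have hp : pHat z I = K.card / n := by rw [eq_div_iff hn, mul_comm, mul_pHat]
  rcases K.eq_empty_or_nonempty with h0 | hne
  · have hp0 : pHat z I = 0 := by rw [hp, h0]; simp
    simp [hp0, pHatW, h0, sampleVar]
  obtain ⟨i₀, hi₀⟩ := hne
  have hne : K.Nonempty := ⟨i₀, hi₀⟩
  have hk0 : (K.card : ℝ) ≠ 0 := by exact_mod_cast hne.card_pos.ne'
  have e1 : ∫ w, pHat z I * (betaHatW z I w - betaHat z I) ^ 2 ∂(ν[|{w | 0 < wHat z I w}]) =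
      R1 ν K.card / n * sampleVar K (fun i => (z i).2 - b) := by
    simp only [wHat_eq]
    rw [integral_cond_eq, ← hK, hν.measureReal_avgOn_pos, hν.R1_eq]
    have hms : MeasurableSet {w : Fin n → ℝ | 0 < avgOn K w} :=
      measurableSet_lt measurable_const (measurable_avgOn K)
    have h1 : ∫ w in {w | 0 < avgOn K w}, pHat z I * (betaHatW z I w - betaHat z I) ^ 2 ∂ν =
        1 / (n * K.card) * ∫ w, (∑ i ∈ K, (w i - avgOn K w) * ((z i).2 - b)) ^ 2 *
          (1 / avgOn K w ^ 2) ∂ν := by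
      rw [← integral_const_mul, ← integral_indicator hms]
      refine integral_congr_ae ?_
      filter_upwards [hν.ae_nonneg] with w hw
      have ha : 0 ≤ avgOn K w := div_nonneg (Finset.sum_nonneg fun j _ => hw j) (by positivity)
      rcases ha.eq_or_lt with h | h
      · simp [← h]
      · simp only [Set.indicator, Set.mem_ofPred_eq, h, if_true]
        rw [betaHatW_sub_betaHat z I w h hne b, ← hK, hp]
        field_simp
    rw [h1, hν.integral_quadratic (f := fun a => 1 / a ^ 2) (by fun_prop) sq_mul_abs_inv_sq_le hi₀,
      hν.integral_dev_sq_eq_first (fun a => 1 / a ^ 2) hi₀]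
    field_simp
  have e2 : ∫ w, pHatW z I w * (betaHatW z I w - betaHat z I) ^ 2 ∂ν =
      R2 ν K.card / n * sampleVar K (fun i => (z i).2 - b) := by
    rw [R2_eq]
    have h1 : ∫ w, pHatW z I w * (betaHatW z I w - betaHat z I) ^ 2 ∂ν =
        1 / (n * K.card) * ∫ w, (∑ i ∈ K, (w i - avgOn K w) * ((z i).2 - b)) ^ 2 *
          (1 / avgOn K w) ∂ν := by
      rw [← integral_const_mul]
      refine integral_congr_ae ?_
      filter_upwards [hν.ae_nonneg] with w hw
      have ha : 0 ≤ avgOn K w := div_nonneg (Finset.sum_nonneg fun j _ => hw j) (by positivity)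
      rcases ha.eq_or_lt with h | h
      · simp [pHatW, wHat_eq, ← hK, ← h]
      · rw [betaHatW_sub_betaHat z I w h hne b, pHatW, wHat_eq, ← hK, hp]
        field_simp
    rw [h1, hν.integral_quadratic (f := fun a => 1 / a) (by fun_prop) sq_mul_abs_inv_le hi₀,
      hν.integral_dev_sq_eq_first (fun a => 1 / a) hi₀]
    field_simp
  rw [e1, e2]
  ring

end Penalty

/-! ### General bounds on R₁ and R₂ -/

section SchemeBounds

variable {n : ℕ}

/-- The total weight of the first `k` indices. -/
def sumFirst (k : ℕ) (w : Fin n → ℝ) : ℝ := ∑ i ∈ firstIdx n k, w i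

theorem avg_eq_sumFirst (k : ℕ) (w : Fin n → ℝ) : avg k w = sumFirst k w / k := rfl

theorem measurable_sumFirst (k : ℕ) : Measurable (sumFirst k : (Fin n → ℝ) → ℝ) := by
  unfold sumFirst; fun_prop

theorem mem_firstIdx {k : ℕ} {i : Fin n} : i ∈ firstIdx n k ↔ i.val < k := by
  simp [firstIdx]

theorem zero_mem_firstIdx [NeZero n] {k : ℕ} (hk : 1 ≤ k) : (0 : Fin n) ∈ firstIdx n k := by
  rw [mem_firstIdx, Fin.val_zero]; omega

theorem sumFirst_nonneg {k : ℕ} {w : Fin n → ℝ} (hw : ∀ i, 0 ≤ w i) : 0 ≤ sumFirst k w :=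
  Finset.sum_nonneg fun i _ => hw i

theorem le_sumFirst {k : ℕ} {w : Fin n → ℝ} (hw : ∀ i, 0 ≤ w i) {i : Fin n}
    (hi : i ∈ firstIdx n k) : w i ≤ sumFirst k w :=
  Finset.single_le_sum (fun j _ => hw j) hi

theorem sumFirst_comp_swap {k : ℕ} {i j : Fin n} (hi : i ∈ firstIdx n k)
    (hj : j ∈ firstIdx n k) (w : Fin n → ℝ) :
    sumFirst k (fun l => w (Equiv.swap i j l)) = sumFirst k w := by
  unfold sumFirst
  conv_rhs => rw [← map_swap_eq hi hj, Finset.sum_map]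
  rfl

theorem ae_avg_le {ν : Measure (Fin n → ℝ)} {k : ℕ} (hk : 1 ≤ k) (hkn : k ≤ n) {c : ℝ} (hc : 0 < c)
    (h2 : ∀ᵐ w ∂ν, ∀ i, w i = 0 ∨ w i = c) : ∀ᵐ w ∂ν, avg k w ≤ c := by
  have hk0 : (0 : ℝ) < k := by positivity
  filter_upwards [h2] with w hw
  rw [avg_eq_sumFirst, div_le_iff₀ hk0, sumFirst]
  calc ∑ i ∈ firstIdx n k, w i ≤ ∑ _i ∈ firstIdx n k, c :=
        Finset.sum_le_sum fun i _ => by rcases hw i with h | h <;> rw [h]; exact hc.le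
    _ = c * k := by rw [Finset.sum_const, card_firstIdx hkn, nsmul_eq_mul, mul_comm]

/-- The gap between 0 and c keeps 1/avg bounded, with the convention 1/0 = 0, and allows S to be
compared with S + c. -/
theorem ae_sumFirst_eq_zero_or_le {ν : Measure (Fin n → ℝ)} {k : ℕ} {c : ℝ} (hc : 0 < c)
    (h : ∀ᵐ w ∂ν, ∀ i, w i = 0 ∨ c ≤ w i) : ∀ᵐ w ∂ν, sumFirst k w = 0 ∨ c ≤ sumFirst k w := by
  filter_upwards [h] with w hw
  have hw0 : ∀ i, 0 ≤ w i := fun i => by rcases hw i with h | h <;> linarith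
  by_cases h : ∀ i ∈ firstIdx n k, w i = 0
  · exact Or.inl (Finset.sum_eq_zero h)
  · push Not at h
    obtain ⟨i, hi, hne⟩ := h
    exact Or.inr (((hw i).resolve_left hne).trans (le_sumFirst hw0 hi))

variable {ν : Measure (Fin n → ℝ)} (hν : IsWeightLaw ν)

include hν

theorem IsWeightLaw.integral_mul_sumFirst_eq (k : ℕ) (φ : ℝ → ℝ) {i j : Fin n}
    (hi : i ∈ firstIdx n k) (hj : j ∈ firstIdx n k) (g : ℝ → ℝ) :
    ∫ w, g (w i) * φ (sumFirst k w) ∂ν = ∫ w, g (w j) * φ (sumFirst k w) ∂ν := by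
  have := hν.integral_perm (Equiv.swap i j) (fun w => g (w i) * φ (sumFirst k w))
  simp only [sumFirst_comp_swap hi hj, Equiv.swap_apply_left] at this
  exact this.symm

theorem IsWeightLaw.integral_coord_mul_eq [NeZero n] {k : ℕ} (hk : 1 ≤ k) (hkn : k ≤ n) (φ : ℝ → ℝ)
    (hint : ∀ i ∈ firstIdx n k, Integrable (fun w => w i * φ (sumFirst k w)) ν) :
    k * ∫ w, w 0 * φ (sumFirst k w) ∂ν = ∫ w, sumFirst k w * φ (sumFirst k w) ∂ν := by
  have h1 : ∫ w, sumFirst k w * φ (sumFirst k w) ∂ν =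
      ∑ i ∈ firstIdx n k, ∫ w, w i * φ (sumFirst k w) ∂ν := by
    rw [← integral_finsetSum _ hint]
    congr 1; ext w; rw [← Finset.sum_mul]; rfl
  rw [h1, Finset.sum_congr rfl fun i hi => hν.integral_mul_sumFirst_eq k φ hi
    (zero_mem_firstIdx hk) (fun x => x), Finset.sum_const, card_firstIdx hkn, nsmul_eq_mul]

theorem IsWeightLaw.integral_avg {k : ℕ} (hk : 1 ≤ k) (hkn : k ≤ n) : ∫ w, avg k w ∂ν = 1 := by
  have hk0 : (k : ℝ) ≠ 0 := by positivity
  simp only [avg_eq_sumFirst, sumFirst]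
  rw [integral_div, integral_finsetSum _ fun i _ => hν.integrable_coord i,
    Finset.sum_congr rfl fun i _ => hν.integral_eq_one i, Finset.sum_const, card_firstIdx hkn]
  simp [hk0]

/-- `k E[W₁ / ∑_{i ≤ k} W_i] = P(∑_{i ≤ k} W_i > 0)`. -/
theorem IsWeightLaw.integral_coord_div_sumFirst [NeZero n] {k : ℕ} (hk : 1 ≤ k) (hkn : k ≤ n) :
    k * ∫ w, w 0 / sumFirst k w ∂ν = ν.real {w | 0 < avg k w} := by
  have := hν.isProbabilityMeasure
  have hk0 : (0 : ℝ) < k := by positivity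
  have h := hν.integral_coord_mul_eq hk hkn (fun t => t⁻¹) (fun i hi => by
    refine (integrable_const (1 : ℝ)).mono' ((measurable_pi_apply i).mul
      (measurable_sumFirst k).inv).aestronglyMeasurable ?_
    filter_upwards [hν.ae_nonneg] with w hw
    rw [← div_eq_mul_inv, Real.norm_of_nonneg (div_nonneg (hw i) (sumFirst_nonneg hw))]
    exact div_le_one_of_le₀ (le_sumFirst hw hi) (sumFirst_nonneg hw))
  simp only [div_eq_mul_inv]
  rw [h, ← integral_indicator_one (measurableSet_lt measurable_const (measurable_avg k))]
  refine integral_congr_ae ?_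
  filter_upwards [hν.ae_nonneg] with w hw
  rcases (sumFirst_nonneg hw (k := k)).eq_or_lt with h0 | h0
  · simp [← h0, Set.indicator, avg_eq_sumFirst]
  · have : 0 < avg k w := by rw [avg_eq_sumFirst]; positivity
    simp [Set.indicator, this, h0.ne']

/-- Moving the probability of a positive average to the right-hand side removes any need for a lower
bound on it; if it is zero, `R1` is zero. -/
theorem IsWeightLaw.R1_le [NeZero n] {k : ℕ} {B : ℝ} (hB : 0 ≤ B)
    (h : ∫ w, (w 0 - avg k w) ^ 2 * (1 / avg k w ^ 2) ∂ν ≤ B * ν.real {w | 0 < avg k w}) :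
    R1 ν k ≤ B := by
  rw [hν.R1_eq]
  rcases (measureReal_nonneg (μ := ν) (s := {w | 0 < avg k w})).eq_or_lt with h0 | h0
  · simpa [← h0] using hB
  · rw [inv_mul_le_iff₀ h0, mul_comm]; exact h

theorem IsWeightLaw.integrable_one_div_avg {k : ℕ} (hk : 1 ≤ k) {c : ℝ} (hc : 0 < c)
    (hlat : ∀ᵐ w ∂ν, sumFirst k w = 0 ∨ c ≤ sumFirst k w) :
    Integrable (fun w => 1 / avg k w) ν := by
  have := hν.isProbabilityMeasure
  have hk0 : (0 : ℝ) < k := by positivity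
  refine (integrable_const (k / c : ℝ)).mono'
    ((measurable_const.div (measurable_avg k)).aestronglyMeasurable) ?_
  filter_upwards [hlat] with w hw
  rcases hw with hw | hw
  · simp only [avg_eq_sumFirst, hw, zero_div, div_zero, norm_zero]; positivity
  · have : 0 < sumFirst k w := by linarith
    rw [avg_eq_sumFirst, one_div_div, Real.norm_of_nonneg (by positivity)]
    gcongr

/-- Since 1/0 = 0, only positive averages count. There S ≥ c, hence 1/S ≤ 2/(S + c), and the
hypothesis `hinv` brings back E[W₁/S], whose value is explicit. -/
theorem IsWeightLaw.integral_one_div_avg_le [NeZero n] {k : ℕ} (hk : 1 ≤ k) (hkn : k ≤ n) {c : ℝ}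
    (hc : 0 < c) (hlat : ∀ᵐ w ∂ν, sumFirst k w = 0 ∨ c ≤ sumFirst k w)
    (hinv : ∫ w, 1 / (sumFirst k w + c) ∂ν ≤ ∫ w, w 0 / sumFirst k w ∂ν) :
    ∫ w, 1 / avg k w ∂ν ≤ 2 * ν.real {w | 0 < avg k w} := by
  have := hν.isProbabilityMeasure
  have hk0 : (0 : ℝ) < k := by positivity
  have hI : Integrable (fun w => 1 / (sumFirst k w + c)) ν := by
    refine (integrable_const (1 / c : ℝ)).mono' (measurable_const.div
      ((measurable_sumFirst k).add_const c)).aestronglyMeasurable ?_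
    filter_upwards [hν.ae_nonneg] with w hw
    have := sumFirst_nonneg hw (k := k)
    rw [Real.norm_of_nonneg (by positivity)]
    gcongr; linarith
  calc ∫ w, 1 / avg k w ∂ν ≤ ∫ w, 2 * k * (1 / (sumFirst k w + c)) ∂ν := by
        refine integral_mono_ae (hν.integrable_one_div_avg hk hc hlat) (hI.const_mul _) ?_
        filter_upwards [hlat] with w hw
        rcases hw with hw | hw
        · simp only [avg_eq_sumFirst, hw, zero_div, div_zero]; positivity
        · have : 0 < sumFirst k w := by linarith
          simp only [avg_eq_sumFirst]
          rw [one_div_div, mul_one_div, div_le_div_iff₀ this (by linarith)]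
          nlinarith
    _ ≤ 2 * k * ∫ w, w 0 / sumFirst k w ∂ν := by rw [integral_const_mul]; gcongr
    _ = _ := by rw [mul_assoc, hν.integral_coord_div_sumFirst hk hkn]

theorem IsWeightLaw.integrable_avg (k : ℕ) : Integrable (avg k) ν :=
  (integrable_finsetSum _ fun i _ => hν.integrable_coord i).div_const _

section TwoValued

variable [NeZero n] {k : ℕ} (hk : 1 ≤ k) (hkn : k ≤ n) {c : ℝ} (hc : 0 < c)
  (h2 : ∀ᵐ w ∂ν, ∀ i, w i = 0 ∨ w i = c)

include hk hkn h2

/-- Averaging over the k exchangeable coordinates replaces the square by an empirical variance. As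
w² = c w for these weights, that variance is a function of the average alone. -/
theorem IsWeightLaw.integral_dev_sq_of_two_valued {f : ℝ → ℝ} (hf : Measurable f)
    (hfb : ∀ a, 0 ≤ a → a ^ 2 * |f a| ≤ 1 + a) :
    ∫ w, (w 0 - avg k w) ^ 2 * f (avg k w) ∂ν =
      ∫ w, (c * avg k w - avg k w ^ 2) * f (avg k w) ∂ν := by
  have hk0 : (k : ℝ) ≠ 0 := by positivity
  have h0 := zero_mem_firstIdx (n := n) hk
  have hsum : ∀ w : Fin n → ℝ, avgOn (firstIdx n k) w = avg k w := fun w =>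
    (avg_eq_avgOn hkn w).symm
  have e1 : ∀ i ∈ firstIdx n k, ∫ w, (w i - avg k w) ^ 2 * f (avg k w) ∂ν =
      ∫ w, (w 0 - avg k w) ^ 2 * f (avg k w) ∂ν := fun i hi => by
    simpa only [hsum] using hν.integral_dev_sq_eq f hi h0
  have hint : ∀ i ∈ firstIdx n k, Integrable (fun w => (w i - avg k w) ^ 2 * f (avg k w)) ν :=
    fun i hi => by simpa only [hsum, sq] using hν.integrable_dev hf hfb hi hi
  have e2 : (k : ℝ) * ∫ w, (w 0 - avg k w) ^ 2 * f (avg k w) ∂ν =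
      ∫ w, ∑ i ∈ firstIdx n k, (w i - avg k w) ^ 2 * f (avg k w) ∂ν := by
    rw [integral_finsetSum _ hint, Finset.sum_congr rfl e1, Finset.sum_const, card_firstIdx hkn,
      nsmul_eq_mul]
  have e3 : ∫ w, ∑ i ∈ firstIdx n k, (w i - avg k w) ^ 2 * f (avg k w) ∂ν =
      k * ∫ w, (c * avg k w - avg k w ^ 2) * f (avg k w) ∂ν := by
    rw [← integral_const_mul]
    refine integral_congr_ae ?_
    filter_upwards [h2] with w hw
    have hsq : ∀ i, (w i - avg k w) ^ 2 = c * w i - 2 * avg k w * w i + avg k w ^ 2 := fun i => by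
      rcases hw i with h | h <;> rw [h] <;> ring
    rw [← Finset.sum_mul]
    simp only [hsq]
    rw [Finset.sum_add_distrib, Finset.sum_sub_distrib, ← Finset.mul_sum, ← Finset.mul_sum,
      Finset.sum_const, card_firstIdx hkn, nsmul_eq_mul]
    have : ∑ i ∈ firstIdx n k, w i = k * avg k w := by
      rw [avg_eq_sumFirst, mul_div_cancel₀ _ hk0]; rfl
    rw [this]; ring
  exact mul_left_cancel₀ hk0 (e2.trans e3)

include hc

theorem IsWeightLaw.R2_le_of_two_valued : R2 ν k ≤ c - 1 := by
  have := hν.isProbabilityMeasure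
  rw [R2_eq, hν.integral_dev_sq_of_two_valued hk hkn h2 (f := fun a => 1 / a) (by fun_prop)
    sq_mul_abs_inv_le]
  have hia := hν.integrable_avg k
  calc ∫ w, (c * avg k w - avg k w ^ 2) * (1 / avg k w) ∂ν ≤ ∫ w, (c - avg k w) ∂ν := by
        have hle : ∀ᵐ w ∂ν, (c * avg k w - avg k w ^ 2) * (1 / avg k w) ≤ c - avg k w ∧
            0 ≤ (c * avg k w - avg k w ^ 2) * (1 / avg k w) := by
          filter_upwards [ae_avg_le hk hkn hc h2, hν.ae_nonneg] with w hw hw0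
          have ha : 0 ≤ avg k w := div_nonneg (sumFirst_nonneg hw0) (by positivity)
          rcases ha.eq_or_lt with h | h
          · simp [← h, hc.le]
          · have : (c * avg k w - avg k w ^ 2) * (1 / avg k w) = c - avg k w := by field_simp
            rw [this]
            exact ⟨le_rfl, by linarith⟩
        have hi : Integrable (fun w => c - avg k w) ν := (integrable_const c).sub hia
        exact integral_mono_of_nonneg (hle.mono fun w h => h.2) hi (hle.mono fun w h => h.1)
    _ = c - 1 := by
        rw [integral_sub (integrable_const c) hia, hν.integral_avg hk hkn]; simp

/-- On positive averages the integrand reduces to c/avg - 1, and the inverse moment bound costs the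
factor 2. -/
theorem IsWeightLaw.R1_le_of_two_valued
    (hinv : ∫ w, 1 / (sumFirst k w + c) ∂ν ≤ ∫ w, w 0 / sumFirst k w ∂ν) : R1 ν k ≤ 2 * c := by
  refine hν.R1_le (by positivity) ?_
  have hlat := ae_sumFirst_eq_zero_or_le (k := k) hc
    (h2.mono fun w hw i => (hw i).imp_right fun h => h.ge)
  rw [hν.integral_dev_sq_of_two_valued hk hkn h2 (f := fun a => 1 / a ^ 2) (by fun_prop)
    sq_mul_abs_inv_sq_le]
  calc ∫ w, (c * avg k w - avg k w ^ 2) * (1 / avg k w ^ 2) ∂ν ≤ ∫ w, c * (1 / avg k w) ∂ν := by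
        have hle : ∀ᵐ w ∂ν, (c * avg k w - avg k w ^ 2) * (1 / avg k w ^ 2) ≤ c * (1 / avg k w) ∧
            0 ≤ (c * avg k w - avg k w ^ 2) * (1 / avg k w ^ 2) := by
          filter_upwards [ae_avg_le hk hkn hc h2, hν.ae_nonneg] with w hw hw0
          have ha : 0 ≤ avg k w := div_nonneg (sumFirst_nonneg hw0) (by positivity)
          rcases ha.eq_or_lt with h | h
          · simp [← h]
          · have : (c * avg k w - avg k w ^ 2) * (1 / avg k w ^ 2) = c * (1 / avg k w) - 1 := by
              field_simp
            refine ⟨by rw [this]; linarith, mul_nonneg ?_ (by positivity)⟩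
            nlinarith
        exact integral_mono_of_nonneg (hle.mono fun w h => h.2)
          ((hν.integrable_one_div_avg hk hc hlat).const_mul c) (hle.mono fun w h => h.1)
    _ ≤ c * (2 * ν.real {w | 0 < avg k w}) := by
        rw [integral_const_mul]
        gcongr
        exact hν.integral_one_div_avg_le hk hkn hc hlat hinv
    _ = _ := by ring

end TwoValued

section PoissonType

variable [NeZero n] {k : ℕ} (hk : 2 ≤ k) (hkn : k ≤ n)

include hk hkn

/-- Apply the quadratic identity to the vector with entries 1 at index 0, -1 at i₁ and 0 elsewhere.
Its sample variance is 2/(k - 1), and 2k/(k - 1) ≥ 2. -/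
theorem IsWeightLaw.integral_dev_sq_le_pair {f : ℝ → ℝ} (hf : Measurable f)
    (hf0 : ∀ a, 0 ≤ a → 0 ≤ f a)
    (hfb : ∀ a, 0 ≤ a → a ^ 2 * |f a| ≤ 1 + a) {i₁ : Fin n} (hi₁ : i₁ ∈ firstIdx n k)
    (hne : i₁ ≠ 0) :
    2 * ∫ w, (w 0 - avg k w) ^ 2 * f (avg k w) ∂ν ≤ ∫ w, (w 0 - w i₁) ^ 2 * f (avg k w) ∂ν := by
  have hk2 : (2 : ℝ) ≤ k := by exact_mod_cast hk
  have hkne : (k : ℝ) - 1 ≠ 0 := by linarith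
  have h0 := zero_mem_firstIdx (n := n) (by omega : 1 ≤ k)
  have hsum : ∀ w : Fin n → ℝ, avgOn (firstIdx n k) w = avg k w := fun w =>
    (avg_eq_avgOn hkn w).symm
  let e : Fin n → ℝ := fun i => (if i = 0 then 1 else 0) - if i = i₁ then 1 else 0
  have hq := hν.integral_quadratic hf hfb h0 e
  simp only [hsum] at hq
  have e1 : ∀ w : Fin n → ℝ, ∑ i ∈ firstIdx n k, (w i - avg k w) * e i = w 0 - w i₁ := fun w => by
    simp only [e, mul_sub, mul_ite, mul_one, mul_zero, Finset.sum_sub_distrib, Finset.sum_ite_eq',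
      h0, hi₁, if_true]
    ring
  have e2 : sampleVar (firstIdx n k) e = 2 / (k - 1) := by
    have h1 : ∀ i, e i ^ 2 = (if i = 0 then 1 else 0) + if i = i₁ then 1 else 0 := fun i => by
      simp only [e]
      rcases eq_or_ne i 0 with h | h <;> rcases eq_or_ne i i₁ with h' | h'
      · exact absurd (h'.symm.trans h) hne
      all_goals simp [h, h', hne.symm, hne]
    have h2 : ∑ i ∈ firstIdx n k, e i = 0 := by
      simp only [e, Finset.sum_sub_distrib, Finset.sum_ite_eq', h0, hi₁, if_true, sub_self]
    rw [sampleVar, h2, card_firstIdx hkn]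
    simp only [h1, Finset.sum_add_distrib, Finset.sum_ite_eq', h0, hi₁, if_true]
    norm_num
  simp only [e1, e2, card_firstIdx hkn] at hq
  rw [hq]
  have hJ : 0 ≤ ∫ w, (w 0 - avg k w) ^ 2 * f (avg k w) ∂ν := by
    refine integral_nonneg_of_ae ?_
    filter_upwards [hν.ae_nonneg] with w hw
    exact mul_nonneg (sq_nonneg _) (hf0 _ (div_nonneg (sumFirst_nonneg hw) (by positivity)))
  refine mul_le_mul_of_nonneg_right ?_ hJ
  rw [← mul_div_assoc, le_div_iff₀ (by linarith)]
  linarith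

/-- Bound on `R₁ + R₂` for weights with `E[(W₁ - W₂)² f(Ŵ)] = c E[(W₁ + W₂) f(Ŵ)]`. -/
theorem IsWeightLaw.R1_add_R2_le_of_pair {c : ℝ} (hc : 0 < c) {i₁ : Fin n}
    (hi₁ : i₁ ∈ firstIdx n k) (hne : i₁ ≠ 0)
    (hlat : ∀ᵐ w ∂ν, sumFirst k w = 0 ∨ c ≤ sumFirst k w)
    (hinv : ∫ w, 1 / (sumFirst k w + c) ∂ν ≤ ∫ w, w 0 / sumFirst k w ∂ν)
    (hpair : ∀ p : ℕ, 1 ≤ p → p ≤ 2 → ∫ w, (w 0 - w i₁) ^ 2 * (1 / sumFirst k w ^ p) ∂ν ≤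
      2 * c * ∫ w, w 0 * (1 / sumFirst k w ^ p) ∂ν) :
    R1 ν k + R2 ν k ≤ 3 * c := by
  have := hν.isProbabilityMeasure
  have hk1 : 1 ≤ k := by omega
  have hk0 : (0 : ℝ) < k := by positivity
  have hint : ∀ p : ℕ, 1 ≤ p → p ≤ 2 → ∀ i ∈ firstIdx n k,
      Integrable (fun w => w i * (1 / sumFirst k w ^ p)) ν := by
    intro p hp1 hp2 i hi
    refine (integrable_const (1 / c ^ (p - 1) : ℝ)).mono' ((measurable_pi_apply i).mul
      (measurable_const.div ((measurable_sumFirst k).pow_const p))).aestronglyMeasurable ?_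
    filter_upwards [hlat, hν.ae_nonneg] with w hw hw0
    rcases hw with hw | hw
    · have : p ≠ 0 := by omega
      simp only [hw, ne_eq, this, not_false_eq_true, zero_pow, div_zero, mul_zero, norm_zero]
      positivity
    · have h1 : 0 < sumFirst k w := by linarith
      have h2 := hw0 i
      rw [Real.norm_of_nonneg (by positivity), mul_one_div]
      have h3 : sumFirst k w ^ p = sumFirst k w ^ (p - 1) * sumFirst k w := by
        rw [← pow_succ]; congr 1; omega
      rw [h3, div_le_div_iff₀ (by positivity) (by positivity), one_mul, mul_comm]
      have := le_sumFirst hw0 hi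
      gcongr
  have hex : ∀ p : ℕ, 1 ≤ p → p ≤ 2 → k * ∫ w, w 0 * (1 / sumFirst k w ^ p) ∂ν =
      ∫ w, sumFirst k w * (1 / sumFirst k w ^ p) ∂ν := fun p hp1 hp2 =>
    hν.integral_coord_mul_eq hk1 hkn (fun t => 1 / t ^ p) (hint p hp1 hp2)
  -- The pair identity and k E[W₁/S²] = E[1/S] reduce the numerator of R₁ to c E[1/avg], which is at
  -- most 2c P(avg > 0).
  have hR1 : R1 ν k ≤ 2 * c := by
    refine hν.R1_le (by positivity) ?_
    have h1 := hν.integral_dev_sq_le_pair hk hkn (f := fun a => 1 / a ^ 2) (by fun_prop)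
      (fun a _ => by positivity) sq_mul_abs_inv_sq_le hi₁ hne
    have e1 : ∫ w, (w 0 - w i₁) ^ 2 * (1 / avg k w ^ 2) ∂ν =
        (k : ℝ) ^ 2 * ∫ w, (w 0 - w i₁) ^ 2 * (1 / sumFirst k w ^ 2) ∂ν := by
      rw [← integral_const_mul]
      congr 1; ext w
      rw [avg_eq_sumFirst, div_pow, one_div_div]
      ring
    have e2 : ∫ w, sumFirst k w * (1 / sumFirst k w ^ 2) ∂ν = (∫ w, 1 / avg k w ∂ν) / k := by
      rw [← integral_div]
      congr 1; ext w
      rw [avg_eq_sumFirst, one_div_div]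
      rcases eq_or_ne (sumFirst k w) 0 with h | h
      · simp [h]
      · field_simp
    have h2 := hpair 2 (by norm_num) le_rfl
    have h3 := hex 2 (by norm_num) le_rfl
    have h4 := hν.integral_one_div_avg_le hk1 hkn hc hlat hinv
    rw [e2, eq_div_iff hk0.ne'] at h3
    rw [e1] at h1
    nlinarith [mul_le_mul_of_nonneg_left h2 (sq_nonneg (k : ℝ)), mul_le_mul_of_nonneg_left h4 hc.le]
  have hR2 : R2 ν k ≤ c := by
    rw [R2_eq]
    have h1 := hν.integral_dev_sq_le_pair hk hkn (f := fun a => 1 / a) (by fun_prop)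
      (fun a ha => by positivity) sq_mul_abs_inv_le hi₁ hne
    have e1 : ∫ w, (w 0 - w i₁) ^ 2 * (1 / avg k w) ∂ν =
        (k : ℝ) * ∫ w, (w 0 - w i₁) ^ 2 * (1 / sumFirst k w ^ 1) ∂ν := by
      rw [← integral_const_mul]
      congr 1; ext w
      rw [avg_eq_sumFirst, one_div_div]
      ring
    have h2 := hpair 1 le_rfl (by norm_num)
    have h3 := hν.integral_coord_div_sumFirst hk1 hkn
    have h4 : ν.real {w | 0 < avg k w} ≤ 1 := measureReal_le_one
    have e2 : ∫ w, w 0 * (1 / sumFirst k w ^ 1) ∂ν = ∫ w, w 0 / sumFirst k w ∂ν := by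
      simp only [pow_one, mul_one_div]
    rw [e2] at h2
    rw [e1] at h1
    nlinarith [mul_le_mul_of_nonneg_left h2 hk0.le]
  linarith

end PoissonType

end SchemeBounds

/-! ### Random hold-out and leave-one-out weights -/

section RandomHoldOut

variable {n : ℕ}

theorem sumFirst_swap_of_notMem [NeZero n] {k : ℕ} (hk : 1 ≤ k) {i : Fin n}
    (hi : i ∉ firstIdx n k) (w : Fin n → ℝ) :
    sumFirst k (fun l => w (Equiv.swap i 0 l)) = sumFirst k w - w 0 + w i := by
  have h0 := zero_mem_firstIdx (n := n) hk
  unfold sumFirst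
  rw [← Finset.add_sum_erase _ _ h0, ← Finset.add_sum_erase _ w h0, Equiv.swap_apply_right]
  have : ∑ x ∈ (firstIdx n k).erase 0, w (Equiv.swap i 0 x) = ∑ x ∈ (firstIdx n k).erase 0, w x := by
    refine Finset.sum_congr rfl fun x hx => ?_
    obtain ⟨h1, h2⟩ := Finset.mem_erase.1 hx
    rw [Equiv.swap_apply_of_ne_of_ne (fun h : x = i => hi (by rwa [← h])) h1]
  rw [this]; ring

/-- Inverse moment bound for two-valued exchangeable weights with a deterministic sum. -/
theorem IsWeightLaw.integral_inv_le_of_sum_eq [NeZero n] {ν : Measure (Fin n → ℝ)}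
    (hν : IsWeightLaw ν) {k : ℕ} (hk : 1 ≤ k) {c : ℝ} (hc : 0 < c)
    (h2 : ∀ᵐ w ∂ν, ∀ i, w i = 0 ∨ w i = c) (hsum : ∀ᵐ w ∂ν, ∑ i, w i = (n : ℝ)) :
    ∫ w, 1 / (sumFirst k w + c) ∂ν ≤ ∫ w, w 0 / sumFirst k w ∂ν := by
  have := hν.isProbabilityMeasure
  have h0 := zero_mem_firstIdx (n := n) hk
  have hn : (0 : ℝ) < n := by exact_mod_cast NeZero.pos n
  have hms := measurable_sumFirst (n := n) k
  have hint0 : ∀ i ∈ firstIdx n k, Integrable (fun w => w i / sumFirst k w) ν := fun i hi => by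
    refine (integrable_const (1 : ℝ)).mono' ((measurable_pi_apply i).div hms).aestronglyMeasurable ?_
    filter_upwards [hν.ae_nonneg] with w hw
    rw [Real.norm_of_nonneg (div_nonneg (hw i) (sumFirst_nonneg hw))]
    exact div_le_one_of_le₀ (le_sumFirst hw hi) (sumFirst_nonneg hw)
  have hint1 : ∀ i : Fin n, Integrable (fun w => w i / (sumFirst k w + c)) ν := fun i => by
    refine (integrable_const (1 : ℝ)).mono' ((measurable_pi_apply i).div
      (hms.add_const c)).aestronglyMeasurable ?_
    filter_upwards [hν.ae_nonneg, h2] with w hw hw2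
    have h3 := sumFirst_nonneg hw (k := k)
    rw [Real.norm_of_nonneg (div_nonneg (hw i) (by linarith))]
    refine div_le_one_of_le₀ ?_ (by linarith)
    rcases hw2 i with h | h <;> rw [h] <;> linarith
  -- As ∑ W_i = n, the left-hand side of the claim is the average of these n integrals. For an index
  -- outside the first k, exchanging it with 0 turns S + c into S - w₀ + w_i + c, which is at least
  -- S when w₀ = c; when w₀ = 0 the numerator vanishes.
  have hterm : ∀ i : Fin n, ∫ w, w i / (sumFirst k w + c) ∂ν ≤ ∫ w, w 0 / sumFirst k w ∂ν := by
    intro i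
    by_cases hi : i ∈ firstIdx n k
    · have h1 := hν.integral_mul_sumFirst_eq k (fun t => t⁻¹) hi h0 (fun x => x)
      simp only [← div_eq_mul_inv] at h1
      rw [← h1]
      refine integral_mono_ae (hint1 i) (hint0 i hi) ?_
      filter_upwards [hν.ae_nonneg] with w hw
      rcases (hw i).eq_or_lt with h | h
      · simp [← h]
      · have := h.trans_le (le_sumFirst hw hi)
        exact div_le_div_of_nonneg_left h.le this (by linarith)
    · have h1 := hν.integral_perm (Equiv.swap i 0) (fun w => w i / (sumFirst k w + c))
      simp only [sumFirst_swap_of_notMem hk hi, Equiv.swap_apply_left] at h1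
      rw [← h1]
      refine integral_mono_of_nonneg ?_ (hint0 0 h0) ?_
      · filter_upwards [hν.ae_nonneg] with w hw
        have := le_sumFirst hw h0
        have := hw i
        exact div_nonneg (hw 0) (by linarith)
      · filter_upwards [hν.ae_nonneg, h2] with w hw hw2
        rcases hw2 0 with h | h
        · simp [h]
        · have h3 := le_sumFirst hw h0
          have h4 := hw i
          show w 0 / (sumFirst k w - w 0 + w i + c) ≤ w 0 / sumFirst k w
          rw [h] at h3 ⊢
          exact div_le_div_of_nonneg_left hc.le (by linarith) (by linarith)
  have e1 : n * ∫ w, 1 / (sumFirst k w + c) ∂ν = ∑ i, ∫ w, w i / (sumFirst k w + c) ∂ν := by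
    rw [← integral_finsetSum _ fun i _ => hint1 i, ← integral_const_mul]
    refine integral_congr_ae ?_
    filter_upwards [hsum] with w hw
    rw [← Finset.sum_div, hw, mul_one_div]
  have e2 : ∑ i, ∫ w, w i / (sumFirst k w + c) ∂ν ≤ n * ∫ w, w 0 / sumFirst k w ∂ν := by
    calc _ ≤ ∑ _i : Fin n, ∫ w, w 0 / sumFirst k w ∂ν := Finset.sum_le_sum fun i _ => hterm i
      _ = _ := by simp
  exact le_of_mul_le_mul_left (e1.le.trans e2) hn

theorem ae_rhoLaw {q : ℕ} {p : (Fin n → ℝ) → Prop}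
    (h : ∀ I : Finset (Fin n), I.card = q → p (fun i => if i ∈ I then (n : ℝ) / q else 0)) :
    ∀ᵐ w ∂(rhoLaw n q), p w := by
  rw [rhoLaw, ae_finsetSum_measure_iff]
  intro I hI
  refine Measure.ae_smul_measure ?_ _
  rw [ae_dirac_eq]
  exact h I (Finset.mem_powersetCard.1 hI).2

theorem rhoLaw_two_valued (q : ℕ) :
    ∀ᵐ w ∂(rhoLaw n q), ∀ i, w i = 0 ∨ w i = (n : ℝ) / q :=
  ae_rhoLaw fun I _ i => by by_cases h : i ∈ I <;> simp [h]

theorem rhoLaw_sum_eq {q : ℕ} (hq : 1 ≤ q) : ∀ᵐ w ∂(rhoLaw n q), ∑ i, w i = (n : ℝ) :=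
  ae_rhoLaw fun I hI => by
    have : (q : ℝ) ≠ 0 := by positivity
    rw [← Finset.sum_filter]
    simp only [Finset.filter_mem_eq_inter, Finset.univ_inter, Finset.sum_const, hI, nsmul_eq_mul]
    field_simp

theorem R1_add_R2_rhoLaw_le [NeZero n] {q : ℕ} (hq : 1 ≤ q) (hν : IsWeightLaw (rhoLaw n q)) {k : ℕ}
    (hk : 1 ≤ k) (hkn : k ≤ n) :
    R1 (rhoLaw n q) k + R2 (rhoLaw n q) k ≤ 3 * ((n : ℝ) / q) - 1 := by
  have hn : (0 : ℝ) < n := by exact_mod_cast NeZero.pos n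
  have hc : (0 : ℝ) < (n : ℝ) / q := by positivity
  have h1 := hν.R1_le_of_two_valued hk hkn hc (rhoLaw_two_valued q)
    (hν.integral_inv_le_of_sum_eq hk hc (rhoLaw_two_valued q) (rhoLaw_sum_eq hq))
  have h2 := hν.R2_le_of_two_valued hk hkn hc (rhoLaw_two_valued q)
  linarith

/-- The bound 2c on R₁ is too weak here, since c = n/(n - 1) stays near 1 while the target is of
order c - 1. Because the total weight is c (n - 1) and each weight is at most c, the first k sum to
at least c (k - 1). With k ≥ 2 this gives avg ≥ c/2 almost surely, which trivialises the
conditioning and bounds (c - avg)/avg by (2/c)(c - avg), whose mean is (2/c)(c - 1). -/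
theorem R1_add_R2_loo_le [NeZero n] (hn2 : 2 ≤ n) (hν : IsWeightLaw (rhoLaw n (n - 1))) {k : ℕ}
    (hk : 2 ≤ k) (hkn : k ≤ n) :
    R1 (rhoLaw n (n - 1)) k + R2 (rhoLaw n (n - 1)) k ≤ 3 / ((n : ℝ) - 1) := by
  have := hν.isProbabilityMeasure
  have hn : (2 : ℝ) ≤ n := by exact_mod_cast hn2
  have hk2 : (2 : ℝ) ≤ k := by exact_mod_cast hk
  have hq : ((n - 1 : ℕ) : ℝ) = (n : ℝ) - 1 := by rw [Nat.cast_sub (by omega)]; simp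
  have hn1 : (0 : ℝ) < (n : ℝ) - 1 := by linarith
  have htwo := rhoLaw_two_valued (n := n) (n - 1)
  have hsum := rhoLaw_sum_eq (n := n) (q := n - 1) (by omega)
  rw [hq] at htwo
  set c : ℝ := (n : ℝ) / ((n : ℝ) - 1) with hcdef
  have hcn : c * ((n : ℝ) - 1) = n := div_mul_cancel₀ _ hn1.ne'
  have hc1 : c - 1 = 1 / ((n : ℝ) - 1) := by rw [hcdef]; field_simp; ring
  have hc : 0 < c := by positivity
  have h2 := hν.R2_le_of_two_valued (by omega) hkn hc htwo
  have hlow : ∀ᵐ w ∂(rhoLaw n (n - 1)), c / 2 ≤ avg k w := by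
    filter_upwards [htwo, hsum] with w hw hs
    have hle : ∀ i, w i ≤ c := fun i => by rcases hw i with h | h <;> rw [h]; exact hc.le
    have h3 : ∑ i, w i = sumFirst k w + ∑ i ∈ (firstIdx n k)ᶜ, w i :=
      (Finset.sum_add_sum_compl _ _).symm
    have h4 : ∑ i ∈ (firstIdx n k)ᶜ, w i ≤ ((n : ℝ) - k) * c := by
      calc ∑ i ∈ (firstIdx n k)ᶜ, w i ≤ ∑ _i ∈ (firstIdx n k)ᶜ, c :=
            Finset.sum_le_sum fun i _ => hle i
        _ = _ := by
            rw [Finset.sum_const, Finset.card_compl, card_firstIdx hkn, Fintype.card_fin,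
              nsmul_eq_mul, Nat.cast_sub hkn]
    rw [avg_eq_sumFirst, le_div_iff₀ (by linarith)]
    nlinarith
  have hP : (rhoLaw n (n - 1)).real {w | 0 < avg k w} = 1 := by
    rw [measureReal_def, (mem_ae_iff_prob_eq_one
      (measurableSet_lt measurable_const (measurable_avg k))).1]
    · simp
    · filter_upwards [hlow] with w hw
      show 0 < avg k w
      linarith
  have h1 : R1 (rhoLaw n (n - 1)) k ≤ 2 * (c - 1) := by
    refine hν.R1_le (by rw [hc1]; positivity) ?_
    rw [hP, hν.integral_dev_sq_of_two_valued (by omega) hkn htwo (f := fun a => 1 / a ^ 2)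
      (by fun_prop) sq_mul_abs_inv_sq_le]
    have hia := hν.integrable_avg k
    calc ∫ w, (c * avg k w - avg k w ^ 2) * (1 / avg k w ^ 2) ∂(rhoLaw n (n - 1))
        ≤ ∫ w, 2 / c * (c - avg k w) ∂(rhoLaw n (n - 1)) := by
          refine integral_mono_of_nonneg ?_ (((integrable_const c).sub hia).const_mul _) ?_
          · filter_upwards [hlow, ae_avg_le (by omega) hkn hc htwo] with w h3 h4
            have : 0 < avg k w := by linarith
            exact mul_nonneg (by show 0 ≤ c * avg k w - avg k w ^ 2; nlinarith) (by positivity)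
          · filter_upwards [hlow, ae_avg_le (by omega) hkn hc htwo] with w h3 h4
            have h5 : 0 < avg k w := by linarith
            have e : (c * avg k w - avg k w ^ 2) * (1 / avg k w ^ 2) =
                1 / avg k w * (c - avg k w) := by field_simp
            rw [e]
            refine mul_le_mul_of_nonneg_right ?_ (by linarith)
            rw [div_le_div_iff₀ h5 hc]; linarith
      _ = 2 / c * (c - 1) := by
          rw [integral_const_mul, integral_sub (integrable_const c) hia,
            hν.integral_avg (by omega) hkn]
          simp
      _ ≤ 2 * (c - 1) * 1 := by
          rw [mul_one]
          have : 0 < c - 1 := by rw [hc1]; positivity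
          refine mul_le_mul_of_nonneg_right ?_ this.le
          rw [div_le_iff₀ hc]; linarith
  have e3 : 3 / ((n : ℝ) - 1) = 3 * (c - 1) := by rw [hc1]; ring
  rw [e3]; linarith

end RandomHoldOut

/-! ### Rademacher weights -/

section Rademacher

variable {n : ℕ}

theorem isProbabilityMeasure_bernoulli {p : ℝ} (hp0 : 0 < p) (hp1 : p < 1) (x y : ℝ) :
    IsProbabilityMeasure (ENNReal.ofReal p • Measure.dirac x +
      ENNReal.ofReal (1 - p) • Measure.dirac y) := by
  constructor
  simp only [Measure.coe_add, Measure.coe_smul, Pi.add_apply, Pi.smul_apply, measure_univ,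
    smul_eq_mul, mul_one]
  rw [← ENNReal.ofReal_add hp0.le (by linarith)]
  simp

theorem radLaw_two_valued {p : ℝ} (hp0 : 0 < p) (hp1 : p < 1) :
    ∀ᵐ w ∂(radLaw n p), ∀ i, w i = 0 ∨ w i = 1 / p := by
  have := isProbabilityMeasure_bernoulli hp0 hp1 (1 / p) 0
  rw [ae_all_iff]
  intro i
  refine (Measure.quasiMeasurePreserving_eval (fun _ : Fin n => ENNReal.ofReal p •
    Measure.dirac (1 / p) + ENNReal.ofReal (1 - p) • Measure.dirac (0 : ℝ)) i).ae
    (p := fun x : ℝ => x = 0 ∨ x = 1 / p) ?_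
  rw [ae_add_measure_iff]
  constructor <;> refine Measure.ae_smul_measure ?_ _ <;> rw [ae_dirac_eq] <;> simp

/-- As W₁ is 0 or c, the ratio W₁/S equals W₁/(c + τ'), with τ' the sum of the other weights.
Independence and E[W₁] = 1 leave E[1/(c + τ')], and τ' ≤ S. -/
theorem radLaw_integral_inv_le [NeZero n] {p : ℝ} (hp0 : 0 < p) (hp1 : p < 1)
    (hν : IsWeightLaw (radLaw n p)) {k : ℕ} (hk : 1 ≤ k) :
    ∫ w, 1 / (sumFirst k w + 1 / p) ∂(radLaw n p) ≤ ∫ w, w 0 / sumFirst k w ∂(radLaw n p) := by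
  have hprob := hν.isProbabilityMeasure
  have := isProbabilityMeasure_bernoulli hp0 hp1 (1 / p) 0
  have hc : 0 < 1 / p := by positivity
  set c := 1 / p
  have h0 := zero_mem_firstIdx (n := n) hk
  set τ' : (Fin n → ℝ) → ℝ := fun w => ∑ i ∈ (firstIdx n k).erase 0, w i
  have hτ' : ∀ w, sumFirst k w = w 0 + τ' w := fun w => (Finset.add_sum_erase _ _ h0).symm
  have hτm : Measurable τ' := by fun_prop
  have hind : iIndepFun (fun (i : Fin n) (w : Fin n → ℝ) => w i) (radLaw n p) :=
    iIndepFun_pi (X := fun _ x => x) fun _ => aemeasurable_id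
  have hi2 : IndepFun (fun w : Fin n → ℝ => w 0) (fun w => 1 / (c + τ' w)) (radLaw n p) :=
    ((hind.indepFun_fun_sum (fun i => measurable_pi_apply i) _ 0
      (Finset.notMem_erase 0 (firstIdx n k))).symm).comp (ψ := fun x => 1 / (c + x))
      measurable_id (by fun_prop)
  have e1 : ∫ w, w 0 / sumFirst k w ∂(radLaw n p) = ∫ w, w 0 * (1 / (c + τ' w)) ∂(radLaw n p) := by
    refine integral_congr_ae ?_
    filter_upwards [radLaw_two_valued hp0 hp1] with w hw
    rw [hτ', mul_one_div]
    rcases hw 0 with h | h <;> rw [h]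
    simp
  have hnn : ∀ᵐ w ∂(radLaw n p), 0 ≤ τ' w := by
    filter_upwards [hν.ae_nonneg] with w hw
    exact Finset.sum_nonneg fun i _ => hw i
  rw [e1, hi2.integral_fun_mul_eq_mul_integral (measurable_pi_apply 0).aestronglyMeasurable
    (measurable_const.div (hτm.const_add c)).aestronglyMeasurable, hν.integral_eq_one 0, one_mul]
  refine integral_mono_of_nonneg ?_ ?_ ?_
  · filter_upwards [hν.ae_nonneg] with w hw
    have := sumFirst_nonneg hw (k := k)
    show 0 ≤ 1 / (sumFirst k w + c)
    positivity
  · refine (integrable_const (1 / c : ℝ)).mono'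
      (measurable_const.div (hτm.const_add c)).aestronglyMeasurable ?_
    filter_upwards [hnn] with w hw
    rw [Real.norm_of_nonneg (by positivity)]
    gcongr; linarith
  · filter_upwards [hnn, hν.ae_nonneg] with w hw hw0
    have := hw0 0
    rw [hτ']
    exact one_div_le_one_div_of_le (by linarith) (by linarith)

theorem R1_add_R2_radLaw_le [NeZero n] {p : ℝ} (hp0 : 0 < p) (hp1 : p < 1)
    (hν : IsWeightLaw (radLaw n p)) {k : ℕ} (hk : 1 ≤ k) (hkn : k ≤ n) :
    R1 (radLaw n p) k + R2 (radLaw n p) k ≤ 3 * (1 / p) := by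
  have hc : 0 < 1 / p := by positivity
  have h1 := hν.R1_le_of_two_valued hk hkn hc (radLaw_two_valued hp0 hp1)
    (radLaw_integral_inv_le hp0 hp1 hν hk)
  have h2 := hν.R2_le_of_two_valued hk hkn hc (radLaw_two_valued hp0 hp1)
  linarith

end Rademacher

/-! ### Efron weights: balls thrown into boxes -/

section Efron

variable {n m : ℕ}

/-- Number of balls `j` with `u j = i`. -/
def occ (u : Fin m → Fin n) (i : Fin n) : ℝ := ∑ j, if u j = i then 1 else 0

/-- Number of balls in the first `k` boxes. -/
def occFirst (k : ℕ) (u : Fin m → Fin n) : ℝ := ∑ j, if u j ∈ firstIdx n k then 1 else 0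

/-- Apply the permutation `π` to the value at `j`. -/
def permAt (j : Fin m) (π : Equiv.Perm (Fin n)) : Equiv.Perm (Fin m → Fin n) :=
  Equiv.piCongrRight fun j' => if j' = j then π else Equiv.refl _

theorem permAt_same (j : Fin m) (π : Equiv.Perm (Fin n)) (u : Fin m → Fin n) :
    permAt j π u j = π (u j) := by simp [permAt]

theorem permAt_ne {j j' : Fin m} (h : j' ≠ j) (π : Equiv.Perm (Fin n)) (u : Fin m → Fin n) :
    permAt j π u j' = u j' := by simp [permAt, h]

theorem occ_eq_card (u : Fin m → Fin n) (i : Fin n) :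
    ((Finset.univ.filter fun j => u j = i).card : ℝ) = occ u i := by
  simp [occ]

theorem occFirst_eq_sum (k : ℕ) (u : Fin m → Fin n) :
    occFirst k u = ∑ i ∈ firstIdx n k, occ u i := by
  simp only [occFirst, occ]
  rw [Finset.sum_comm]
  exact Finset.sum_congr rfl fun j _ => by rw [Finset.sum_ite_eq]

theorem integral_efrLaw (F : (Fin n → ℝ) → ℝ) : ∫ w, F w ∂(efrLaw n m) =
    (((n : ℝ≥0∞) ^ m)⁻¹).toReal * ∑ u : Fin m → Fin n, F (fun i => (n : ℝ) / m * occ u i) := by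
  by_cases hn : (n : ℝ≥0∞) ^ m = 0
  · have : IsEmpty (Fin m → Fin n) := by
      have h1 : n ^ m = 0 := by exact_mod_cast hn
      have h2 : n = 0 ∧ m ≠ 0 := by simpa using h1
      obtain ⟨rfl, h⟩ := h2
      have : NeZero m := ⟨h⟩
      exact ⟨fun u => (u 0).elim0⟩
    simp [efrLaw]
  rw [efrLaw, integral_finsetSum_measure, Finset.mul_sum]
  · refine Finset.sum_congr rfl fun u _ => ?_
    rw [integral_smul_measure, integral_dirac, smul_eq_mul]
    simp only [occ_eq_card]
  · intro u _
    exact (integrable_dirac (by simp)).smul_measure (ENNReal.inv_ne_top.2 hn)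

theorem ae_efrLaw {p : (Fin n → ℝ) → Prop}
    (h : ∀ u : Fin m → Fin n, p (fun i => (n : ℝ) / m * occ u i)) :
    ∀ᵐ w ∂(efrLaw n m), p w := by
  rw [efrLaw, ae_finsetSum_measure_iff]
  intro u _
  refine Measure.ae_smul_measure ?_ _
  rw [ae_dirac_eq]
  simp only [occ_eq_card]
  exact h u

theorem sumFirst_occ (k : ℕ) (u : Fin m → Fin n) (c : ℝ) :
    sumFirst k (fun i => c * occ u i) = c * occFirst k u := by
  rw [sumFirst, ← Finset.mul_sum, occFirst_eq_sum]

theorem occFirst_nonneg (k : ℕ) (u : Fin m → Fin n) : 0 ≤ occFirst k u :=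
  Finset.sum_nonneg fun j _ => by split_ifs <;> norm_num

theorem occFirst_eq_add (k : ℕ) (u : Fin m → Fin n) (j : Fin m) :
    occFirst k u = (if u j ∈ firstIdx n k then 1 else 0) +
      ∑ j' ∈ Finset.univ.erase j, if u j' ∈ firstIdx n k then 1 else 0 :=
  (Finset.add_sum_erase _ _ (Finset.mem_univ j)).symm

theorem sum_erase_permAt (k : ℕ) (j : Fin m) (π : Equiv.Perm (Fin n)) (u : Fin m → Fin n) :
    ∑ j' ∈ Finset.univ.erase j, (if permAt j π u j' ∈ firstIdx n k then (1 : ℝ) else 0) =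
      ∑ j' ∈ Finset.univ.erase j, if u j' ∈ firstIdx n k then 1 else 0 :=
  Finset.sum_congr rfl fun j' hj' => by rw [permAt_ne (Finset.ne_of_mem_erase hj')]

/-- Split according to the box b that holds ball `j`, then exchange boxes 0 and b for this ball
alone. Ball `j` now lies in box 0, among the first k, so the new count is at most the old one plus
1. Each of the n values of b is bounded by the same sum. -/
theorem sum_inv_occFirst_le [NeZero n] {k : ℕ} (hk : 1 ≤ k) (j : Fin m) :
    ∑ u : Fin m → Fin n, 1 / (occFirst k u + 1) ≤
      n * ∑ u : Fin m → Fin n, (if u j = 0 then 1 else 0) / occFirst k u := by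
  have h0 := zero_mem_firstIdx (n := n) hk
  calc ∑ u : Fin m → Fin n, 1 / (occFirst k u + 1)
      = ∑ b : Fin n, ∑ u : Fin m → Fin n, (if u j = b then 1 else 0) / (occFirst k u + 1) := by
        rw [Finset.sum_comm]
        refine Finset.sum_congr rfl fun u _ => ?_
        rw [← Finset.sum_div, Finset.sum_ite_eq, if_pos (Finset.mem_univ _)]
    _ ≤ ∑ b : Fin n, ∑ u : Fin m → Fin n, (if u j = 0 then 1 else 0) / occFirst k u := by
        refine Finset.sum_le_sum fun b _ => ?_
        rw [← Equiv.sum_comp (permAt j (Equiv.swap 0 b))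
          (fun u => (if u j = 0 then (1 : ℝ) else 0) / occFirst k u)]
        refine Finset.sum_le_sum fun u _ => ?_
        rw [permAt_same]
        by_cases hb : u j = b
        · have h1 : Equiv.swap 0 b (u j) = 0 := by rw [hb, Equiv.swap_apply_right]
          have h2 := occFirst_eq_add k (permAt j (Equiv.swap 0 b) u) j
          rw [permAt_same, h1, if_pos h0, sum_erase_permAt] at h2
          have h3 := occFirst_eq_add k u j
          have h4 : (0 : ℝ) ≤ if u j ∈ firstIdx n k then 1 else 0 := by split_ifs <;> norm_num
          have h5 : (0 : ℝ) ≤ ∑ j' ∈ Finset.univ.erase j, if u j' ∈ firstIdx n k then 1 else 0 :=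
            Finset.sum_nonneg fun j _ => by split_ifs <;> norm_num
          rw [if_pos hb, if_pos h1]
          exact one_div_le_one_div_of_le (by linarith) (by linarith)
        · rw [if_neg hb, zero_div]
          exact div_nonneg (by split_ifs <;> norm_num) (occFirst_nonneg _ _)
    _ = _ := by simp

theorem efrLaw_integral_inv_le [NeZero n] (hm : 1 ≤ m) {k : ℕ} (hk : 1 ≤ k) :
    ∫ w, 1 / (sumFirst k w + (n : ℝ) / m) ∂(efrLaw n m) ≤
      ∫ w, w 0 / sumFirst k w ∂(efrLaw n m) := by
  have hn : (0 : ℝ) < n := by exact_mod_cast NeZero.pos n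
  have hm0 : (0 : ℝ) < m := by exact_mod_cast hm
  rw [integral_efrLaw, integral_efrLaw]
  refine mul_le_mul_of_nonneg_left ?_ ENNReal.toReal_nonneg
  simp only [sumFirst_occ]
  have e1 : ∀ u : Fin m → Fin n, 1 / ((n : ℝ) / m * occFirst k u + (n : ℝ) / m) =
      m / n * (1 / (occFirst k u + 1)) := fun u => by
    have := occFirst_nonneg k u
    field_simp
  have e2 : ∀ u : Fin m → Fin n, (n : ℝ) / m * occ u 0 / ((n : ℝ) / m * occFirst k u) =
      ∑ j, (if u j = 0 then 1 else 0) / occFirst k u := fun u => by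
    rw [mul_div_mul_left _ _ (by positivity), occ, Finset.sum_div]
  simp only [e1, e2]
  rw [← Finset.mul_sum, Finset.sum_comm]
  calc (m : ℝ) / n * ∑ u : Fin m → Fin n, 1 / (occFirst k u + 1)
      = ∑ _j : Fin m, (∑ u : Fin m → Fin n, 1 / (occFirst k u + 1)) / n := by
        rw [Finset.sum_const, Finset.card_univ, Fintype.card_fin, nsmul_eq_mul]; ring
    _ ≤ _ := Finset.sum_le_sum fun j _ => by
        rw [div_le_iff₀' hn]; exact sum_inv_occFirst_le hk j

/-- Write the difference of occupancies as a sum of signs, one per ball. Exchanging the boxes i₀ and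
i₁ for a single ball flips its sign and keeps the number of balls in the first k boxes, so cross
terms cancel. The squared signs add up to the sum of the two occupancies. -/
theorem sum_occ_sub_sq_mul {i₀ i₁ : Fin n} {k : ℕ} (h₀ : i₀ ∈ firstIdx n k)
    (h₁ : i₁ ∈ firstIdx n k) (hne : i₀ ≠ i₁) (φ : ℝ → ℝ) :
    ∑ u : Fin m → Fin n, (occ u i₀ - occ u i₁) ^ 2 * φ (occFirst k u) =
      ∑ u : Fin m → Fin n, (occ u i₀ + occ u i₁) * φ (occFirst k u) := by
  let ε : (Fin m → Fin n) → Fin m → ℝ := fun u j =>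
    (if u j = i₀ then 1 else 0) - if u j = i₁ then 1 else 0
  have hsub : ∀ u, occ u i₀ - occ u i₁ = ∑ j, ε u j := fun u => by
    simp only [ε, occ, Finset.sum_sub_distrib]
  have hsq : ∀ u j, ε u j * ε u j = (if u j = i₀ then 1 else 0) + if u j = i₁ then 1 else 0 := by
    intro u j
    simp only [ε]
    rcases eq_or_ne (u j) i₀ with h | h
    · simp [h, hne]
    · rcases eq_or_ne (u j) i₁ with h' | h' <;> simp [h, h', hne.symm]
  have hcross : ∀ j j' : Fin m, j ≠ j' →
      ∑ u : Fin m → Fin n, ε u j * ε u j' * φ (occFirst k u) = 0 := by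
    intro j j' hjj
    have hinv := Equiv.sum_comp (permAt j (Equiv.swap i₀ i₁))
      (fun u : Fin m → Fin n => ε u j * ε u j' * φ (occFirst k u))
    have hterm : ∀ u : Fin m → Fin n, ε (permAt j (Equiv.swap i₀ i₁) u) j *
        ε (permAt j (Equiv.swap i₀ i₁) u) j' * φ (occFirst k (permAt j (Equiv.swap i₀ i₁) u)) =
        -(ε u j * ε u j' * φ (occFirst k u)) := by
      intro u
      have e1 : ε (permAt j (Equiv.swap i₀ i₁) u) j = -ε u j := by
        simp only [ε, permAt_same]
        have a1 : Equiv.swap i₀ i₁ (u j) = i₀ ↔ u j = i₁ := by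
          rw [Equiv.swap_apply_eq_iff, Equiv.swap_apply_left]
        have a2 : Equiv.swap i₀ i₁ (u j) = i₁ ↔ u j = i₀ := by
          rw [Equiv.swap_apply_eq_iff, Equiv.swap_apply_right]
        simp only [a1, a2]; ring
      have e2 : ε (permAt j (Equiv.swap i₀ i₁) u) j' = ε u j' := by
        simp only [ε, permAt_ne hjj.symm]
      have e3 : occFirst k (permAt j (Equiv.swap i₀ i₁) u) = occFirst k u := by
        rw [occFirst_eq_add k _ j, occFirst_eq_add k u j, sum_erase_permAt, permAt_same]
        congr 1
        rcases eq_or_ne (u j) i₀ with h | h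
        · simp [h, h₀, h₁]
        · rcases eq_or_ne (u j) i₁ with h' | h'
          · simp [h', h₀, h₁]
          · rw [Equiv.swap_apply_of_ne_of_ne h h']
      rw [e1, e2, e3]; ring
    simp only [hterm, Finset.sum_neg_distrib] at hinv
    linarith
  have hexp : ∀ u : Fin m → Fin n, (occ u i₀ - occ u i₁) ^ 2 * φ (occFirst k u) =
      ∑ j, ∑ j', ε u j * ε u j' * φ (occFirst k u) := fun u => by
    rw [hsub, sq, Finset.sum_mul_sum, Finset.sum_mul]
    exact Finset.sum_congr rfl fun j _ => by rw [Finset.sum_mul]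
  simp only [hexp]
  rw [Finset.sum_comm]
  have hdiag : ∀ j : Fin m, ∑ u : Fin m → Fin n, ∑ j', ε u j * ε u j' * φ (occFirst k u) =
      ∑ u : Fin m → Fin n, ((if u j = i₀ then 1 else 0) + if u j = i₁ then 1 else 0) *
        φ (occFirst k u) := by
    intro j
    rw [Finset.sum_comm, ← Finset.add_sum_erase _ _ (Finset.mem_univ j),
      Finset.sum_eq_zero (s := Finset.univ.erase j)
        fun j' hj' => hcross j j' (Finset.ne_of_mem_erase hj').symm, add_zero]
    simp only [hsq]
  simp only [hdiag]
  rw [Finset.sum_comm]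
  refine Finset.sum_congr rfl fun u _ => ?_
  rw [← Finset.sum_mul, Finset.sum_add_distrib]; rfl

theorem R1_add_R2_efrLaw_le [NeZero n] (hm : 1 ≤ m) (hν : IsWeightLaw (efrLaw n m)) {k : ℕ}
    (hk : 2 ≤ k) (hkn : k ≤ n) :
    R1 (efrLaw n m) k + R2 (efrLaw n m) k ≤ 3 * ((n : ℝ) / m) := by
  have hn : (0 : ℝ) < n := by exact_mod_cast NeZero.pos n
  have hm0 : (0 : ℝ) < m := by exact_mod_cast hm
  have hc : (0 : ℝ) < (n : ℝ) / m := by positivity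
  have h0 := zero_mem_firstIdx (n := n) (by omega : 1 ≤ k)
  let i₁ : Fin n := ⟨1, by omega⟩
  have h1 : i₁ ∈ firstIdx n k := by rw [mem_firstIdx]; exact hk
  have hne : i₁ ≠ 0 := fun h => by simpa [i₁] using congrArg Fin.val h
  refine hν.R1_add_R2_le_of_pair hk hkn hc h1 hne
    (ae_sumFirst_eq_zero_or_le hc (ae_efrLaw fun u i => ?_))
    (efrLaw_integral_inv_le hm (by omega)) ?_
  · simp only [← occ_eq_card]
    rcases Nat.eq_zero_or_pos (Finset.univ.filter fun j => u j = i).card with h | h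
    · left; simp only [h]; simp
    · right
      have : (1 : ℝ) ≤ ((Finset.univ.filter fun j => u j = i).card : ℝ) := by exact_mod_cast h
      nlinarith
  · intro p _ _
    have hex := hν.integral_mul_sumFirst_eq k (fun t => 1 / t ^ p) h0 h1 (fun x => x)
    rw [integral_efrLaw, integral_efrLaw] at hex
    rw [integral_efrLaw, integral_efrLaw]
    simp only [sumFirst_occ] at hex ⊢
    have key := sum_occ_sub_sq_mul (m := m) h0 h1 hne.symm
      (fun t => 1 / ((n : ℝ) / m * t) ^ p)
    have e1 : ∑ u : Fin m → Fin n, ((n : ℝ) / m * occ u 0 - (n : ℝ) / m * occ u i₁) ^ 2 *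
        (1 / ((n : ℝ) / m * occFirst k u) ^ p) = ((n : ℝ) / m) ^ 2 *
        ∑ u : Fin m → Fin n, (occ u 0 - occ u i₁) ^ 2 *
          (1 / ((n : ℝ) / m * occFirst k u) ^ p) := by
      rw [Finset.mul_sum]
      exact Finset.sum_congr rfl fun u _ => by ring
    have e2 : ∀ i : Fin n, ∑ u : Fin m → Fin n, (n : ℝ) / m * occ u i *
        (1 / ((n : ℝ) / m * occFirst k u) ^ p) = (n : ℝ) / m *
        ∑ u : Fin m → Fin n, occ u i * (1 / ((n : ℝ) / m * occFirst k u) ^ p) := by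
      intro i
      rw [Finset.mul_sum]
      exact Finset.sum_congr rfl fun u _ => by ring
    rw [e1, key]
    simp only [add_mul, Finset.sum_add_distrib]
    rw [e2, e2] at hex
    rw [e2]
    apply le_of_eq
    linear_combination (-(n : ℝ) / m) * hex

end Efron

/-! ### Poisson weights and the Chen–Stein identity -/

section Poisson

variable {μ : ℝ}

/-- Law of `N / μ` with `N` Poisson of parameter `μ`. -/
def scaledPoisson (μ : ℝ) : Measure ℝ := (poissonMeasure μ.toNNReal).map (fun k : ℕ => (k : ℝ) / μ)

instance : IsProbabilityMeasure (scaledPoisson μ) :=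
  Measure.isProbabilityMeasure_map measurable_from_nat.aemeasurable

theorem poiLaw_eq (n : ℕ) : poiLaw n μ = Measure.pi fun _ => scaledPoisson μ := rfl

theorem integral_scaledPoisson {h : ℝ → ℝ} (hh : Measurable h) (hμ : 0 < μ) :
    ∫ x, h x ∂(scaledPoisson μ) =
      ∑' k : ℕ, (Real.exp (-μ) * μ ^ k / k.factorial) * h (k / μ) := by
  rw [scaledPoisson, integral_map measurable_from_nat.aemeasurable hh.aestronglyMeasurable,
    integral_poissonMeasure]
  simp [Real.coe_toNNReal _ hμ.le]

/-- Chen–Stein identity. -/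
theorem integral_mul_scaledPoisson {h : ℝ → ℝ} (hh : Measurable h) (hμ : 0 < μ) :
    ∫ x, x * h x ∂(scaledPoisson μ) = ∫ x, h (x + 1 / μ) ∂(scaledPoisson μ) := by
  rw [integral_scaledPoisson (h := fun x => x * h x) (measurable_id.mul hh) hμ,
    integral_scaledPoisson (h := fun x => h (x + 1 / μ)) (hh.comp (measurable_id.add_const _)) hμ]
  set F : ℕ → ℝ := fun k => (Real.exp (-μ) * μ ^ k / k.factorial) * ((k / μ : ℝ) * h (k / μ))
  have hF0 : F 0 = 0 := by simp [F]
  have hsucc : ∀ k, F (k + 1) = (Real.exp (-μ) * μ ^ k / k.factorial) * h (k / μ + 1 / μ) := by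
    intro k
    simp only [F]
    have e : (((k + 1 : ℕ) : ℝ) / μ) = k / μ + 1 / μ := by push_cast; ring
    rw [e, Nat.factorial_succ, pow_succ]
    have : (k.factorial : ℝ) ≠ 0 := by exact_mod_cast k.factorial_ne_zero
    have h2 : ((k : ℝ) + 1) ≠ 0 := by positivity
    push_cast
    field_simp
  -- Without summability both series take the default value 0, so the identity needs no
  -- integrability of `h`.
  have hshift : ∑' k, F k = ∑' k, F (k + 1) := by
    by_cases hs : Summable F
    · rw [hs.tsum_eq_zero_add, hF0, zero_add]
    · rw [tsum_eq_zero_of_not_summable hs, tsum_eq_zero_of_not_summable]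
      rwa [summable_nat_add_iff 1]
  simp only [hsucc] at hshift
  exact hshift

theorem ae_poiLaw {n : ℕ} (hμ : 0 < μ) : ∀ᵐ w ∂(poiLaw n μ), ∀ i, w i = 0 ∨ 1 / μ ≤ w i := by
  rw [poiLaw_eq, ae_all_iff]
  intro i
  refine (Measure.quasiMeasurePreserving_eval (fun _ : Fin n => scaledPoisson μ) i).ae
    (p := fun x : ℝ => x = 0 ∨ 1 / μ ≤ x) ?_
  rw [scaledPoisson, ae_map_iff measurable_from_nat.aemeasurable]
  · refine Filter.Eventually.of_forall fun k => ?_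
    rcases Nat.eq_zero_or_pos k with rfl | hk
    · simp
    · right
      have : (1 : ℝ) ≤ k := by exact_mod_cast hk
      gcongr
  · exact (measurableSet_singleton 0).union measurableSet_Ici

/-- Chen–Stein identity in the first coordinate. -/
theorem integral_coord_mul_poiLaw {n : ℕ} [NeZero n] (hμ : 0 < μ) {G : (Fin n → ℝ) → ℝ}
    (hG : Measurable G) (h1 : Integrable (fun w => w 0 * G w) (poiLaw n μ))
    (h2 : Integrable (fun w => G (Function.update w 0 (w 0 + 1 / μ))) (poiLaw n μ)) :
    ∫ w, w 0 * G w ∂(poiLaw n μ) = ∫ w, G (Function.update w 0 (w 0 + 1 / μ)) ∂(poiLaw n μ) := by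
  obtain ⟨m, rfl⟩ := Nat.exists_eq_succ_of_ne_zero (NeZero.ne n)
  have hmp := measurePreserving_piFinSuccAbove (fun _ : Fin (m + 1) => scaledPoisson μ) 0
  have hmp' := hmp.symm
  rw [poiLaw_eq] at h1 h2 ⊢
  rw [← hmp'.integral_comp' (fun w => w 0 * G w),
    ← hmp'.integral_comp' (fun w => G (Function.update w 0 (w 0 + 1 / μ)))]
  rw [← hmp'.integrable_comp_emb (MeasurableEquiv.measurableEmbedding _)] at h1 h2
  refine (integral_prod_symm _ h1).trans (Eq.trans ?_ (integral_prod_symm _ h2).symm)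
  congr 1
  ext y
  have e1 : ∀ x : ℝ, (MeasurableEquiv.piFinSuccAbove (fun _ : Fin (m + 1) => ℝ) 0).symm (x, y) =
      Fin.cons x y := fun x => Fin.insertNth_zero' x y
  simp only [Function.comp, e1, Fin.cons_zero, Fin.update_cons_zero]
  have hGm : Measurable fun x : ℝ => G (Fin.cons x y) := by
    refine hG.comp (measurable_pi_lambda _ fun i => ?_)
    refine Fin.cases ?_ (fun i => ?_) i
    · simpa using measurable_id'
    · simp
  exact integral_mul_scaledPoisson hGm hμ

theorem sumFirst_update {n : ℕ} [NeZero n] {k : ℕ} (hk : 1 ≤ k) (w : Fin n → ℝ) (c : ℝ) :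
    sumFirst k (Function.update w 0 (w 0 + c)) = sumFirst k w + c := by
  have h0 := zero_mem_firstIdx (n := n) hk
  unfold sumFirst
  rw [Finset.sum_update_of_mem h0, ← Finset.add_sum_erase _ w h0, Finset.sdiff_singleton_eq_erase]
  ring

/-- Chen–Stein in the first coordinate gives E[W₁ (W₁ - c) φ(S)] = E[W₁ φ(S + c)] and E[W₁ W₂ φ(S)]
= E[W₂ φ(S + c)]. The right-hand sides agree by exchangeability, so E[(W₁ - W₂)² φ(S)] = 2c E[W₁
φ(S)]. The same identity turns the inverse moment hypothesis into an equality. -/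
theorem R1_add_R2_poiLaw_le {n : ℕ} [NeZero n] (hμ : 0 < μ) (hν : IsWeightLaw (poiLaw n μ)) {k : ℕ}
    (hk : 2 ≤ k) (hkn : k ≤ n) :
    R1 (poiLaw n μ) k + R2 (poiLaw n μ) k ≤ 3 * (1 / μ) := by
  have hprob := hν.isProbabilityMeasure
  have hc : 0 < 1 / μ := by positivity
  set c := 1 / μ with hcdef
  have h0 := zero_mem_firstIdx (n := n) (by omega : 1 ≤ k)
  let i₁ : Fin n := ⟨1, by omega⟩
  have h1 : i₁ ∈ firstIdx n k := by rw [mem_firstIdx]; exact hk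
  have hne : i₁ ≠ 0 := fun h => by simpa [i₁] using congrArg Fin.val h
  have hms := measurable_sumFirst (n := n) k
  have hlat := ae_sumFirst_eq_zero_or_le (k := k) hc (ae_poiLaw (n := n) hμ)
  refine hν.R1_add_R2_le_of_pair hk hkn hc h1 hne hlat ?_ ?_
  · have h := integral_coord_mul_poiLaw (n := n) hμ (G := fun w => 1 / sumFirst k w)
      (measurable_const.div hms) ?_ ?_
    · simp only [mul_one_div, sumFirst_update (by omega : 1 ≤ k)] at h
      exact h.ge
    · refine (integrable_const (1 : ℝ)).mono' ((measurable_pi_apply 0).mul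
        (measurable_const.div hms)).aestronglyMeasurable ?_
      filter_upwards [hν.ae_nonneg] with w hw
      rw [mul_one_div, Real.norm_of_nonneg (div_nonneg (hw 0) (sumFirst_nonneg hw))]
      exact div_le_one_of_le₀ (le_sumFirst hw h0) (sumFirst_nonneg hw)
    · simp only [sumFirst_update (by omega : 1 ≤ k)]
      refine (integrable_const (1 / c : ℝ)).mono'
        (measurable_const.div (hms.add_const _)).aestronglyMeasurable ?_
      filter_upwards [hν.ae_nonneg] with w hw
      have := sumFirst_nonneg hw (k := k)
      rw [Real.norm_of_nonneg (by positivity)]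
      exact one_div_le_one_div_of_le hc (by linarith)
  · intro p hp1 hp2
    set φ : ℝ → ℝ := fun t => 1 / t ^ p with hφ
    have hφm : Measurable φ := by fun_prop
    have hφ0 : ∀ t, 0 ≤ t → 0 ≤ φ t := fun t ht => by positivity
    have hφb : ∀ t, c ≤ t → t * φ t ≤ 1 / c ^ (p - 1) := by
      intro t ht
      have ht0 : 0 < t := by linarith
      have h3 : t ^ p = t ^ (p - 1) * t := by rw [← pow_succ]; congr 1; omega
      rw [hφ]
      simp only
      rw [h3, mul_one_div, div_le_div_iff₀ (by positivity) (by positivity), one_mul, mul_comm]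
      gcongr
    set B := 1 / c ^ (p - 1)
    have hB : 0 ≤ B := by positivity
    have hφm' : Measurable fun w : Fin n → ℝ => φ (sumFirst k w) := hφm.comp hms
    -- bound on one coordinate times `φ`
    have hbd : ∀ᵐ w ∂(poiLaw n μ), ∀ i ∈ firstIdx n k, |w i * φ (sumFirst k w)| ≤ B := by
      filter_upwards [hlat, hν.ae_nonneg] with w hw hw0 i hi
      have h3 := hφ0 _ (sumFirst_nonneg hw0 (k := k))
      have h4 := le_sumFirst hw0 hi
      rw [abs_of_nonneg (mul_nonneg (hw0 i) h3)]
      rcases hw with hw | hw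
      · have : w i = 0 := le_antisymm (hw ▸ h4) (hw0 i)
        rw [this, zero_mul]; exact hB
      · exact (mul_le_mul_of_nonneg_right h4 h3).trans (hφb _ hw)
    have hint1 : ∀ i ∈ firstIdx n k, Integrable (fun w => w i * φ (sumFirst k w)) (poiLaw n μ) := by
      intro i hi
      refine (integrable_const B).mono'
        ((measurable_pi_apply i).mul hφm').aestronglyMeasurable ?_
      filter_upwards [hbd] with w hw
      exact hw i hi
    have hint2 : ∀ i ∈ firstIdx n k, ∀ j ∈ firstIdx n k,
        Integrable (fun w => w i * (w j * φ (sumFirst k w))) (poiLaw n μ) := by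
      intro i hi j hj
      refine ((hν.integrable_coord i).mul_const B).mono'
        ((measurable_pi_apply i).mul ((measurable_pi_apply j).mul hφm')).aestronglyMeasurable ?_
      filter_upwards [hbd, hν.ae_nonneg] with w hw hw0
      rw [Real.norm_eq_abs, abs_mul, abs_of_nonneg (hw0 i)]
      exact mul_le_mul_of_nonneg_left (hw j hj) (hw0 i)
    have hint3 : ∀ i ∈ firstIdx n k,
        Integrable (fun w => w i * φ (sumFirst k w + c)) (poiLaw n μ) := by
      intro i hi
      refine (integrable_const B).mono'
        ((measurable_pi_apply i).mul (hφm.comp (hms.add_const c))).aestronglyMeasurable ?_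
      filter_upwards [hν.ae_nonneg] with w hw0
      have h3 := sumFirst_nonneg hw0 (k := k)
      have h5 := hφ0 (sumFirst k w + c) (by linarith)
      have h4 := le_sumFirst hw0 hi
      rw [Real.norm_of_nonneg (mul_nonneg (hw0 i) h5)]
      exact (mul_le_mul_of_nonneg_right (by linarith) h5).trans (hφb _ (by linarith))
    have s1 : ∫ w, w 0 * ((w 0 - c) * φ (sumFirst k w)) ∂(poiLaw n μ) =
        ∫ w, w 0 * φ (sumFirst k w + c) ∂(poiLaw n μ) := by
      have h := integral_coord_mul_poiLaw (n := n) hμ (G := fun w => (w 0 - c) * φ (sumFirst k w))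
        (((measurable_pi_apply 0).sub_const c).mul hφm') ?_ ?_
      · simpa only [sumFirst_update (by omega : 1 ≤ k), Function.update_self, ← hcdef,
          add_sub_cancel_right] using h
      · refine ((hint2 0 h0 0 h0).sub ((hint1 0 h0).const_mul c)).congr ?_
        filter_upwards with w
        simp only [Pi.sub_apply]; ring
      · simpa only [sumFirst_update (by omega : 1 ≤ k), Function.update_self, ← hcdef,
          add_sub_cancel_right] using hint3 0 h0
    have s2 : ∫ w, w 0 * (w i₁ * φ (sumFirst k w)) ∂(poiLaw n μ) =
        ∫ w, w i₁ * φ (sumFirst k w + c) ∂(poiLaw n μ) := by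
      have h := integral_coord_mul_poiLaw (n := n) hμ (G := fun w => w i₁ * φ (sumFirst k w))
        ((measurable_pi_apply i₁).mul hφm') (hint2 0 h0 i₁ h1) ?_
      · simpa only [sumFirst_update (by omega : 1 ≤ k), Function.update_of_ne hne, ← hcdef] using h
      · simpa only [sumFirst_update (by omega : 1 ≤ k), Function.update_of_ne hne, ← hcdef]
          using hint3 i₁ h1
    have s3 := hν.integral_mul_sumFirst_eq k (fun t => φ (t + c)) h0 h1 (fun x => x)
    have s4 := hν.integral_mul_sumFirst_eq k φ h0 h1 (fun x => x ^ 2)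
    have s5 : ∫ w, w 0 * ((w 0 - c) * φ (sumFirst k w)) ∂(poiLaw n μ) =
        ∫ w, w 0 ^ 2 * φ (sumFirst k w) ∂(poiLaw n μ) -
          c * ∫ w, w 0 * φ (sumFirst k w) ∂(poiLaw n μ) := by
      rw [← integral_const_mul, ← integral_sub _ ((hint1 0 h0).const_mul c)]
      · congr 1; ext w; ring
      · refine (hint2 0 h0 0 h0).congr ?_
        filter_upwards with w
        ring
    have hsq : ∀ i ∈ firstIdx n k, Integrable (fun w => w i ^ 2 * φ (sumFirst k w)) (poiLaw n μ) :=
      fun i hi => (hint2 i hi i hi).congr (by filter_upwards with w; ring)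
    have s6 : ∫ w, (w 0 - w i₁) ^ 2 * φ (sumFirst k w) ∂(poiLaw n μ) =
        ∫ w, w 0 ^ 2 * φ (sumFirst k w) ∂(poiLaw n μ) +
          ∫ w, w i₁ ^ 2 * φ (sumFirst k w) ∂(poiLaw n μ) -
          2 * ∫ w, w 0 * (w i₁ * φ (sumFirst k w)) ∂(poiLaw n μ) := by
      have hadd : Integrable (fun w => w 0 ^ 2 * φ (sumFirst k w) + w i₁ ^ 2 * φ (sumFirst k w))
          (poiLaw n μ) := (hsq 0 h0).add (hsq i₁ h1)
      rw [← integral_const_mul, ← integral_add (hsq 0 h0) (hsq i₁ h1), ← integral_sub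
        hadd ((hint2 0 h0 i₁ h1).const_mul 2)]
      congr 1; ext w; ring
    apply le_of_eq
    linarith

end Poisson

/-! ### Constants of the schemes and the supremum of R₁ + R₂ -/

/-- The constant `K_W` of each resampling scheme. -/
def schemeConst : Scheme → ℝ
  | .rad p => if 0 < p ∧ p < 1 then 7 / (1 - p) else 7
  | _ => 7

/-- Positivity is required for every parameter of `rad`, hence the fallback value in `schemeConst`
outside the interval (0, 1). -/
theorem schemeConst_pos (S : Scheme) : 0 < schemeConst S := by
  cases S with
  | rad p =>
    simp only [schemeConst]
    split_ifs with h
    · have : 0 < 1 - p := sub_pos.2 h.2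
      positivity
    · norm_num
  | _ => simp only [schemeConst]; norm_num

theorem Scheme.CW_pos {n : ℕ} [NeZero n] {S : Scheme} (hS : S.Valid n) : 0 < S.CW n := by
  have hn : (0 : ℝ) < n := by exact_mod_cast NeZero.pos n
  cases S with
  | efr m =>
    have : (0 : ℝ) < m := by exact_mod_cast (show 0 < m from hS)
    simp only [Scheme.CW]; positivity
  | rad p =>
    have : 0 < 1 - p := sub_pos.2 hS.2
    have := hS.1
    simp only [Scheme.CW]; positivity
  | poi μ => exact hS
  | rhoHalf =>
    have h2 : 2 ≤ n := hS
    have h1 : (0 : ℝ) < (n / 2 : ℕ) := by exact_mod_cast (by omega : 0 < n / 2)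
    have h3 : ((n / 2 : ℕ) : ℝ) < n := by exact_mod_cast (by omega : n / 2 < n)
    have : (0 : ℝ) < (n : ℝ) - (n / 2 : ℕ) := by linarith
    simp only [Scheme.CW]; positivity
  | loo =>
    have h2 : (2 : ℝ) ≤ n := by exact_mod_cast (show 2 ≤ n from hS)
    simp only [Scheme.CW]; linarith

/-- For Efron and Poisson weights the atom c is exactly 1/C_W; for Rademacher weights it is 1/(C_W
(1 - p)), whence the loss in the constant. All schemes but the half hold-out fit with 3 in place of
7. The latter, with h = ⌊n/2⌋, needs (3n - h)/(n - h) ≤ 7, which follows from 2h ≤ n. -/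
theorem Scheme.R1_add_R2_le {n : ℕ} [NeZero n] {S : Scheme} (hS : S.Valid n)
    (hν : IsWeightLaw (S.law n)) {k : ℕ} (hk : 2 ≤ k) (hkn : k ≤ n) :
    R1 (S.law n) k + R2 (S.law n) k ≤ schemeConst S / S.CW n := by
  have hn : (0 : ℝ) < n := by exact_mod_cast NeZero.pos n
  have hCW := S.CW_pos hS
  rw [le_div_iff₀ hCW]
  cases S with
  | efr m =>
    have hm : 1 ≤ m := hS
    have hm0 : (0 : ℝ) < m := by exact_mod_cast hm
    have h := R1_add_R2_efrLaw_le hm hν hk hkn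
    calc _ ≤ 3 * ((n : ℝ) / m) * ((m : ℝ) / n) := mul_le_mul_of_nonneg_right h hCW.le
      _ = 3 := by field_simp
      _ ≤ _ := by simp only [schemeConst]; norm_num
  | rad p =>
    have hp1 : 0 < 1 - p := sub_pos.2 hS.2
    have hp0 := hS.1
    have h := R1_add_R2_radLaw_le hS.1 hS.2 hν (by omega) hkn
    have e : schemeConst (Scheme.rad p) = 7 / (1 - p) := if_pos hS
    calc _ ≤ 3 * (1 / p) * (p / (1 - p)) := mul_le_mul_of_nonneg_right h hCW.le
      _ = 3 / (1 - p) := by field_simp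
      _ ≤ _ := by rw [e]; gcongr; norm_num
  | poi μ =>
    have hμ : 0 < μ := hS
    have h := R1_add_R2_poiLaw_le hμ hν hk hkn
    calc _ ≤ 3 * (1 / μ) * μ := mul_le_mul_of_nonneg_right h hCW.le
      _ = 3 := by field_simp
      _ ≤ _ := by simp only [schemeConst]; norm_num
  | rhoHalf =>
    have h2 : 2 ≤ n := hS
    have h := R1_add_R2_rhoLaw_le (q := n / 2) (by omega) hν (by omega) hkn
    have h1 : (0 : ℝ) < (n / 2 : ℕ) := by exact_mod_cast (by omega : 0 < n / 2)
    have h3 : 2 * ((n / 2 : ℕ) : ℝ) ≤ n := by exact_mod_cast (by omega : 2 * (n / 2) ≤ n)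
    have h4 : (0 : ℝ) < (n : ℝ) - (n / 2 : ℕ) := by linarith
    calc _ ≤ (3 * ((n : ℝ) / (n / 2 : ℕ)) - 1) * (((n / 2 : ℕ) : ℝ) / ((n : ℝ) - (n / 2 : ℕ))) :=
          mul_le_mul_of_nonneg_right h hCW.le
      _ = (3 * n - (n / 2 : ℕ)) / ((n : ℝ) - (n / 2 : ℕ)) := by field_simp
      _ ≤ _ := by
          simp only [schemeConst]
          rw [div_le_iff₀ h4]; linarith
  | loo =>
    have h2 : 2 ≤ n := hS
    have h3 : (2 : ℝ) ≤ n := by exact_mod_cast h2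
    have h4 : (0 : ℝ) < (n : ℝ) - 1 := by linarith
    have h := R1_add_R2_loo_le h2 hν hk hkn
    calc _ ≤ 3 / ((n : ℝ) - 1) * ((n : ℝ) - 1) := mul_le_mul_of_nonneg_right h hCW.le
      _ = 3 := by field_simp
      _ ≤ _ := by simp only [schemeConst]; norm_num

theorem Scheme.supR_le {n : ℕ} [NeZero n] {S : Scheme} (hS : S.Valid n)
    (hν : IsWeightLaw (S.law n)) {A : ℝ} (hA : 2 ≤ A) :
    supR (S.law n) A ≤ schemeConst S / S.CW n := by
  refine Real.iSup_le (fun k => ?_) (div_nonneg (schemeConst_pos S).le (S.CW_pos hS).le)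
  exact S.R1_add_R2_le hS hν (by exact_mod_cast hA.trans k.2.1) k.2.2

theorem le_supR {n : ℕ} [NeZero n] {ν : Measure (Fin n → ℝ)} {A : ℝ} {k : ℕ} (hA : A ≤ k)
    (hk : k ≤ n) : R1 ν k + R2 ν k ≤ supR ν A := by
  have : Finite {k : ℕ // A ≤ (k : ℝ) ∧ k ≤ n} :=
    Set.Finite.subset (Set.finite_Iic n) fun k hk => hk.2
  exact le_ciSup (f := fun k : {k : ℕ // A ≤ (k : ℝ) ∧ k ≤ n} => R1 ν k.1 + R2 ν k.1)
    (Set.finite_range _).bddAbove ⟨k, hA, hk⟩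

theorem IsWeightLaw.supR_nonneg {n : ℕ} [NeZero n] {ν : Measure (Fin n → ℝ)} (hν : IsWeightLaw ν)
    (A : ℝ) : 0 ≤ supR ν A :=
  Real.iSup_nonneg fun _ => add_nonneg (hν.R1_nonneg _) (hν.R2_nonneg _)

/-! ### Conditioning on a finite partition -/

section Conditioning

/-- On an atom of a sub-σ-algebra, the conditional expectation is the mean over the atom. -/
theorem condExp_ae_eq_of_atoms {Ω ι : Type*} [Fintype ι] {m m₀ : MeasurableSpace Ω}
    {μ : Measure Ω} [IsFiniteMeasure μ] (hm : m ≤ m₀) {B : ι → Set Ω}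
    (hB : ∀ c, MeasurableSet[m] (B c)) (hcov : ∀ ω, ∃ c, ω ∈ B c)
    (hdis : ∀ c c' ω, ω ∈ B c → ω ∈ B c' → c = c')
    (hatom : ∀ s, MeasurableSet[m] s → ∀ c, B c ⊆ s ∨ Disjoint (B c) s)
    {f : Ω → ℝ} (hf : Integrable f μ) {v : ι → ℝ}
    (hv : ∀ c, ∫ ω in B c, f ω ∂μ = μ.real (B c) * v c) :
    ∀ᵐ ω ∂μ, ∀ c, ω ∈ B c → (μ[f | m]) ω = v c := by
  classical
  have hB' : ∀ c, MeasurableSet (B c) := fun c => hm _ (hB c)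
  have hsum : ∀ (F : ι → Ω → ℝ) (c : ι) (ω : Ω), ω ∈ B c →
      ∑ c', (B c').indicator (F c') ω = F c ω := by
    intro F c ω hω
    rw [Finset.sum_eq_single c]
    · exact Set.indicator_of_mem hω _
    · intro c' _ hc'
      exact Set.indicator_of_notMem (fun h => hc' (hdis _ _ _ h hω)) _
    · intro h; exact absurd (Finset.mem_univ c) h
  set g : Ω → ℝ := fun ω => ∑ c, (B c).indicator (fun _ => v c) ω with hg
  have hgm : Measurable[m] g := by
    refine Finset.measurable_sum _ fun c _ => ?_
    exact (measurable_const : Measurable[m] fun _ : Ω => v c).indicator (hB c)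
  have hgi : Integrable g μ := integrable_finsetSum _ fun c _ =>
    (integrable_const (v c)).indicator (hB' c)
  have hfsum : ∀ ω, f ω = ∑ c, (B c).indicator f ω := fun ω => by
    obtain ⟨c, hc⟩ := hcov ω
    exact (hsum (fun _ => f) c ω hc).symm
  have key := ae_eq_condExp_of_forall_setIntegral_eq (g := g) hm hf
    (fun s _ _ => hgi.integrableOn) (fun s hs _ => by
      have h1 : ∫ ω in s, f ω ∂μ = ∑ c, ∫ ω in s, (B c).indicator f ω ∂μ := by
        rw [← integral_finsetSum _ fun c _ => (hf.indicator (hB' c)).integrableOn]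
        exact integral_congr_ae (Filter.Eventually.of_forall hfsum)
      rw [h1, hg, integral_finsetSum _ fun c _ =>
        ((integrable_const (v c)).indicator (hB' c)).integrableOn]
      refine Finset.sum_congr rfl fun c _ => ?_
      rw [setIntegral_indicator (hB' c), setIntegral_indicator (hB' c)]
      rcases hatom s hs c with h | h
      · rw [Set.inter_eq_right.2 h, hv c]; simp
      · rw [Set.inter_comm, h.inter_eq]; simp)
    hgm.aestronglyMeasurable
  filter_upwards [key] with ω hω c hc
  rw [← hω, hg]
  exact hsum (fun c _ => v c) c ω hc

/-- Conditionally on each point of an i.i.d. sample lying in a given set, the points are still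
independent. -/
theorem iIndepFun_cond_iInter {Ω E : Type*} [MeasurableSpace Ω] [MeasurableSpace E]
    {Pr : Measure Ω} [IsProbabilityMeasure Pr] {P : Measure E} {n : ℕ} {D : Fin n → Ω → E}
    (hD : ∀ i, Measurable (D i)) (hind : iIndepFun D Pr) (hlaw : ∀ i, Pr.map (D i) = P)
    {t : Fin n → Set E} (ht : ∀ i, MeasurableSet (t i)) (hpos : Pr (⋂ i, D i ⁻¹' t i) ≠ 0) :
    (∀ i, P (t i) ≠ 0) ∧ iIndepFun D (Pr[|⋂ i, D i ⁻¹' t i]) ∧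
      ∀ i, (Pr[|⋂ i, D i ⁻¹' t i]).map (D i) = P[|t i] := by
  have hP : ∀ i s, MeasurableSet s → Pr (D i ⁻¹' s) = P s := fun i s hs => by
    rw [← hlaw i, Measure.map_apply (hD i) hs]
  have hprod : ∀ u : Fin n → Set E, (∀ i, MeasurableSet (u i)) →
      Pr (⋂ i, D i ⁻¹' u i) = ∏ i, P (u i) := fun u hu => by
    rw [hind.meas_iInter fun i => ⟨u i, hu i, rfl⟩]
    exact Finset.prod_congr rfl fun i _ => hP i _ (hu i)
  have hne : ∀ i, P (t i) ≠ 0 := fun i => by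
    rw [hprod t ht] at hpos
    exact Finset.prod_ne_zero_iff.1 hpos i (Finset.mem_univ i)
  have hfin : ∀ i, P (t i) ≠ ∞ := fun i => by
    rw [← hP i _ (ht i)]; exact measure_ne_top _ _
  have hbox : MeasurableSet (⋂ i, D i ⁻¹' t i) := MeasurableSet.iInter fun i => hD i (ht i)
  refine ⟨hne, ?_, fun i => ?_⟩
  · exact iIndepFun.cond hD (hind.comp (fun _ x => (x, x)) fun _ => measurable_id.prodMk measurable_id)
      (fun i => by rw [hP i _ (ht i)]; exact hne i) ht
  · classical
    ext s hs
    rw [Measure.map_apply (hD i) hs, cond_apply hbox, cond_apply (ht i)]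
    -- Adding the constraint that `D i` lies in s only shrinks the i-th side of the product event,
    -- so the product formula applies and the other factors cancel.
    have h1 : (⋂ j, D j ⁻¹' t j) ∩ D i ⁻¹' s =
        ⋂ j, D j ⁻¹' (Function.update t i (t i ∩ s) j) := by
      ext ω
      simp only [Set.mem_inter_iff, Set.mem_iInter, Set.mem_preimage]
      constructor
      · rintro ⟨h, h'⟩ j
        rcases eq_or_ne j i with rfl | hj
        · rw [Function.update_self]; exact ⟨h j, h'⟩
        · rw [Function.update_of_ne hj]; exact h j
      · intro h
        have hi := h i
        rw [Function.update_self] at hi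
        refine ⟨fun j => ?_, hi.2⟩
        rcases eq_or_ne j i with rfl | hj
        · exact hi.1
        · have := h j
          rwa [Function.update_of_ne hj] at this
    rw [h1, hprod t ht, hprod _ fun j => ?_]
    · rw [← Finset.mul_prod_erase _ _ (Finset.mem_univ i),
        ← Finset.mul_prod_erase _ (fun j => P (Function.update t i (t i ∩ s) j)) (Finset.mem_univ i),
        Function.update_self]
      have h2 : ∏ j ∈ Finset.univ.erase i, P (Function.update t i (t i ∩ s) j) =
          ∏ j ∈ Finset.univ.erase i, P (t j) := Finset.prod_congr rfl fun j hj => by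
        rw [Function.update_of_ne (Finset.ne_of_mem_erase hj)]
      rw [h2]
      have h3 : ∏ j ∈ Finset.univ.erase i, P (t j) ≠ 0 := Finset.prod_ne_zero_iff.2 fun j _ => hne j
      have h4 : ∏ j ∈ Finset.univ.erase i, P (t j) ≠ ∞ :=
        ENNReal.prod_ne_top fun j _ => hfin j
      rw [ENNReal.mul_inv (Or.inl (hne i)) (Or.inl (hfin i)), mul_mul_mul_comm,
        ENNReal.inv_mul_cancel h3 h4, mul_one]
    · rcases eq_or_ne j i with rfl | hj
      · rw [Function.update_self]; exact (ht j).inter hs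
      · rw [Function.update_of_ne hj]; exact ht j

end Conditioning

/-! ### Conditional moments on a cell -/

section Cells

variable {𝒳 Λ : Type*} [MeasurableSpace 𝒳] {cell : Λ → Set 𝒳}

theorem IsPartition.eq_of_mem (h : IsPartition cell) {x : 𝒳} {l l' : Λ} (hl : x ∈ cell l)
    (hl' : x ∈ cell l') : l = l' := by
  by_contra hne
  exact Set.disjoint_left.1 (h.disjoint hne) hl hl'

theorem IsPartition.exists_mem (h : IsPartition cell) (x : 𝒳) : ∃ l, x ∈ cell l := by
  have : x ∈ ⋃ l, cell l := by rw [h.cover]; trivial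
  simpa using this

theorem measurableSet_fst_preimage (h : IsPartition cell) (l : Λ) :
    MeasurableSet (Prod.fst ⁻¹' cell l : Set (𝒳 × ℝ)) := measurable_fst (h.measurableSet_cell l)

variable [Fintype Λ] {P : Measure (𝒳 × ℝ)}

theorem IsPartition.sum_indicator (h : IsPartition cell) (g : Λ → ℝ) {x : 𝒳} {l : Λ}
    (hl : x ∈ cell l) : ∑ l', (cell l').indicator (fun _ => g l') x = g l := by
  rw [Finset.sum_eq_single l]
  · exact Set.indicator_of_mem hl _
  · intro l' _ hl'
    exact Set.indicator_of_notMem (fun h' => hl' (h.eq_of_mem h' hl)) _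
  · intro h'; exact absurd (Finset.mem_univ l) h'

theorem ae_condCell_sM (h : IsPartition cell) (l : Λ) :
    ∀ᵐ z ∂(condCell P (cell l)), z.2 - sM P cell z.1 = z.2 - beta P (cell l) := by
  filter_upwards [ae_cond_mem (μ := P) (measurableSet_fst_preimage h l)] with z hz
  rw [sM, h.sum_indicator (fun l => beta P (cell l)) hz]

theorem sigmaSq_eq (h : IsPartition cell) (l : Λ) :
    ∫ z, (z.2 - beta P (cell l)) ^ 2 ∂(condCell P (cell l)) = sigmaSq P cell l := by
  refine integral_congr_ae ?_
  filter_upwards [ae_condCell_sM (P := P) h l] with z hz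
  rw [hz]

theorem sigmaSq_nonneg (l : Λ) : 0 ≤ sigmaSq P cell l := integral_nonneg fun _ => sq_nonneg _

theorem mq_nonneg (q : ℝ) (l : Λ) : 0 ≤ mq P cell q l :=
  Real.rpow_nonneg (integral_nonneg fun _ => Real.rpow_nonneg (abs_nonneg _) _) _

theorem mq_two_sq (l : Λ) : mq P cell 2 l ^ 2 = sigmaSq P cell l := by
  rw [mq, ← Real.rpow_natCast, ← Real.rpow_mul
    (integral_nonneg fun _ => Real.rpow_nonneg (abs_nonneg _) _)]
  norm_num [sigmaSq]

theorem mq_natCast_pow (h : IsPartition cell) (l : Λ) {N : ℕ} (hN : N ≠ 0) (hev : Even N) :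
    mq P cell N l ^ N = ∫ z, (z.2 - beta P (cell l)) ^ N ∂(condCell P (cell l)) := by
  rw [mq, one_div, Real.rpow_inv_natCast_pow
    (integral_nonneg fun _ => Real.rpow_nonneg (abs_nonneg _) _) hN]
  refine integral_congr_ae ?_
  filter_upwards [ae_condCell_sM (P := P) h l] with z hz
  rw [hz, Real.rpow_natCast, hev.pow_abs]

theorem memLp_resid (h : IsPartition cell) {a ξ : ℝ} (hmom : LocalMoment P cell a ξ) {N : ℕ}
    (hN : 2 ≤ N) (l : Λ) :
    MemLp (fun z : 𝒳 × ℝ => z.2 - beta P (cell l)) N (condCell P (cell l)) := by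
  have h1 := (hmom N (by exact_mod_cast hN)).1 l
  rw [ENNReal.ofReal_natCast] at h1
  exact (memLp_congr_ae (ae_condCell_sM h l)).1 h1

theorem integral_resid (h : IsPartition cell) {a ξ : ℝ} (hmom : LocalMoment P cell a ξ) {l : Λ}
    [IsFiniteMeasure P] (hl : P (Prod.fst ⁻¹' cell l) ≠ 0) :
    ∫ z, (z.2 - beta P (cell l)) ∂(condCell P (cell l)) = 0 := by
  have : IsProbabilityMeasure (condCell P (cell l)) := cond_isProbabilityMeasure hl
  have h1 : Integrable (fun z : 𝒳 × ℝ => z.2 - beta P (cell l)) (condCell P (cell l)) :=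
    (memLp_resid h hmom le_rfl l).integrable (by norm_num)
  have h2 : Integrable (fun z : 𝒳 × ℝ => z.2) (condCell P (cell l)) := by
    refine (h1.add (integrable_const (beta P (cell l)))).congr ?_
    filter_upwards with z
    simp
  rw [integral_sub h2 (integrable_const _)]
  simp [beta]

theorem sum_mq_pow_le (h : IsPartition cell) {a ξ : ℝ} (hmom : LocalMoment P cell a ξ)
    (ha : 0 < a) [Nonempty Λ] {N : ℕ} (hN : 2 ≤ N) (hev : Even N) :
    ∑ l, mq P cell N l ^ 4 ≤ (a * (N : ℝ) ^ ξ * ∑ l, sigmaSq P cell l) ^ 2 / Fintype.card Λ := by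
  have hD : (0 : ℝ) < Fintype.card Λ := by exact_mod_cast Fintype.card_pos
  have hS0 : 0 ≤ ∑ l, sigmaSq P cell l := Finset.sum_nonneg fun l _ => sigmaSq_nonneg l
  rcases hS0.eq_or_lt with h0 | h0
  -- If all variances vanish, the quotient in the moment condition is 0 by the convention x/0 = 0
  -- and carries no information. But then the residuals vanish almost everywhere on each cell, and
  -- so do all their moments.
  · have hz : ∀ l, mq P cell N l = 0 := by
      intro l
      have h1 : sigmaSq P cell l = 0 :=
        (Finset.sum_eq_zero_iff_of_nonneg fun l _ => sigmaSq_nonneg l).1 h0.symm l (Finset.mem_univ l)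
      rw [← sigmaSq_eq h, integral_eq_zero_iff_of_nonneg (fun _ => sq_nonneg _)
        (memLp_resid h hmom le_rfl l).integrable_sq] at h1
      have h2 : mq P cell N l ^ N = 0 := by
        rw [mq_natCast_pow h l (by omega) hev]
        refine integral_eq_zero_of_ae ?_
        filter_upwards [h1] with z hz
        have : z.2 - beta P (cell l) = 0 := by simpa using hz
        simp [this, show N ≠ 0 by omega]
      exact pow_eq_zero_iff (by omega) |>.1 h2
    simp only [hz]
    simp [← h0]
  · have h1 := (hmom N (by exact_mod_cast hN)).2
    simp only [mq_two_sq] at h1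
    rw [div_le_iff₀ h0, Real.sqrt_le_left (by positivity)] at h1
    rw [le_div_iff₀ hD, mul_comm]
    exact h1

end Cells

/-! ### Allocations of the design points -/

section Box

variable {𝒳 Λ Ω : Type*} {n : ℕ} {cell : Λ → Set 𝒳} {D : Fin n → Ω → 𝒳 × ℝ}

/-- The event that the `i`-th design point lies in the cell `c i`, for all `i`. -/
def box (cell : Λ → Set 𝒳) (D : Fin n → Ω → 𝒳 × ℝ) (c : Fin n → Λ) : Set Ω :=
  ⋂ i, D i ⁻¹' (Prod.fst ⁻¹' cell (c i))

theorem mem_box {c : Fin n → Λ} {ω : Ω} : ω ∈ box cell D c ↔ ∀ i, (D i ω).1 ∈ cell (c i) := by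
  simp [box]

/-- The indices that the allocation `c` sends to the cell `l`. -/
def fiber [DecidableEq Λ] (c : Fin n → Λ) (l : Λ) : Finset (Fin n) :=
  Finset.univ.filter fun i => c i = l

theorem mem_fiber [DecidableEq Λ] {c : Fin n → Λ} {l : Λ} {i : Fin n} :
    i ∈ fiber c l ↔ c i = l := by simp [fiber]

variable [MeasurableSpace 𝒳]

/-- Centred responses, given the allocation `c` of the design points. -/
def resid (P : Measure (𝒳 × ℝ)) (cell : Λ → Set 𝒳) (D : Fin n → Ω → 𝒳 × ℝ) (c : Fin n → Λ)
    (i : Fin n) (ω : Ω) : ℝ := (D i ω).2 - beta P (cell (c i))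

variable (h : IsPartition cell)
include h

theorem exists_mem_box (D : Fin n → Ω → 𝒳 × ℝ) (ω : Ω) : ∃ c, ω ∈ box cell D c := by
  choose c hc using fun i => h.exists_mem (D i ω).1
  exact ⟨c, mem_box.2 hc⟩

theorem box_unique {c c' : Fin n → Λ} {ω : Ω} (hc : ω ∈ box cell D c) (hc' : ω ∈ box cell D c') :
    c = c' := funext fun i => h.eq_of_mem (mem_box.1 hc i) (mem_box.1 hc' i)

theorem pairwise_disjoint_box (D : Fin n → Ω → 𝒳 × ℝ) :
    Pairwise (Function.onFun Disjoint (box cell D)) := fun _ _ hne =>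
  Set.disjoint_left.2 fun _ hω hω' => hne (box_unique h hω hω')

theorem iUnion_box (D : Fin n → Ω → 𝒳 × ℝ) : ⋃ c, box cell D c = Set.univ :=
  Set.eq_univ_of_forall fun ω => Set.mem_iUnion.2 (exists_mem_box h D ω)

theorem idxIn_of_mem_box [DecidableEq Λ] {c : Fin n → Λ} {ω : Ω} (hω : ω ∈ box cell D c) (l : Λ) :
    idxIn (fun i => D i ω) (cell l) = fiber c l := by
  ext i
  simp only [idxIn, Finset.mem_filter, Finset.mem_univ, true_and, mem_fiber]
  constructor
  · intro hi; exact h.eq_of_mem (mem_box.1 hω i) hi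
  · rintro rfl; exact mem_box.1 hω i

variable [MeasurableSpace Ω]

theorem measurableSet_box (hD : ∀ i, Measurable (D i)) (c : Fin n → Λ) :
    MeasurableSet (box cell D c) :=
  MeasurableSet.iInter fun i => hD i (measurableSet_fst_preimage h (c i))

omit h in
theorem measurable_resid (P : Measure (𝒳 × ℝ)) (hD : ∀ i, Measurable (D i)) (c : Fin n → Λ)
    (i : Fin n) : Measurable (resid P cell D c i) :=
  (measurable_snd.comp (hD i)).sub_const _

variable {Pr : Measure Ω} [IsProbabilityMeasure Pr] {P : Measure (𝒳 × ℝ)}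
  (hD : ∀ i, Measurable (D i)) (hind : iIndepFun D Pr) (hlaw : ∀ i, Pr.map (D i) = P)
  {c : Fin n → Λ}
  (hc : Pr (box cell D c) ≠ 0)
include hD hind hlaw hc

theorem measure_cell_ne_zero (i : Fin n) : P (Prod.fst ⁻¹' cell (c i)) ≠ 0 :=
  (iIndepFun_cond_iInter hD hind hlaw (fun i => measurableSet_fst_preimage h (c i)) hc).1 i

theorem iIndepFun_resid : iIndepFun (resid P cell D c) Pr[|box cell D c] :=
  (iIndepFun_cond_iInter hD hind hlaw (fun i => measurableSet_fst_preimage h (c i)) hc).2.1.comp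
    (fun i z => z.2 - beta P (cell (c i))) fun _ => measurable_snd.sub_const _

theorem map_cond_box (i : Fin n) : (Pr[|box cell D c]).map (D i) = condCell P (cell (c i)) :=
  (iIndepFun_cond_iInter hD hind hlaw (fun i => measurableSet_fst_preimage h (c i)) hc).2.2 i

theorem integral_comp_resid {g : ℝ → ℝ} (hg : Measurable g) (i : Fin n) :
    ∫ ω, g (resid P cell D c i ω) ∂Pr[|box cell D c] =
      ∫ z, g (z.2 - beta P (cell (c i))) ∂(condCell P (cell (c i))) := by
  rw [← map_cond_box h hD hind hlaw hc i, integral_map (hD i).aemeasurable]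
  · rfl
  · exact (hg.comp (measurable_snd.sub_const _)).aestronglyMeasurable

variable [Fintype Λ]

theorem integral_resid_box_sq (i : Fin n) :
    ∫ ω, resid P cell D c i ω ^ 2 ∂Pr[|box cell D c] = sigmaSq P cell (c i) :=
  (integral_comp_resid h hD hind hlaw hc (g := fun x => x ^ 2) (by fun_prop) i).trans
    (sigmaSq_eq h (c i))

theorem integral_resid_box_pow {N : ℕ} (hN : N ≠ 0) (hev : Even N) (i : Fin n) :
    ∫ ω, resid P cell D c i ω ^ N ∂Pr[|box cell D c] = mq P cell N (c i) ^ N :=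
  (integral_comp_resid h hD hind hlaw hc (g := fun x => x ^ N) (by fun_prop) i).trans
    (mq_natCast_pow h (c i) hN hev).symm

variable {a ξ : ℝ} (hmom : LocalMoment P cell a ξ)
include hmom

theorem memLp_resid_box {N : ℕ} (hN : 2 ≤ N) (i : Fin n) :
    MemLp (resid P cell D c i) N Pr[|box cell D c] := by
  have h1 := memLp_resid h hmom hN (c i)
  rw [← map_cond_box h hD hind hlaw hc i] at h1
  exact h1.comp_of_map (hD i).aemeasurable

theorem integral_resid_box [IsProbabilityMeasure P] (i : Fin n) :
    ∫ ω, resid P cell D c i ω ∂Pr[|box cell D c] = 0 :=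
  (integral_comp_resid h hD hind hlaw hc measurable_id i).trans
    (integral_resid h hmom (measure_cell_ne_zero h hD hind hlaw hc i))

end Box

/-! ### The penalty and its conditional mean -/

section Pen

variable {𝒳 Λ Ω : Type*} [MeasurableSpace 𝒳] [Fintype Λ] [DecidableEq Λ] {n : ℕ} [NeZero n]
  {cell : Λ → Set 𝒳} {D : Fin n → Ω → 𝒳 × ℝ} (h : IsPartition cell)
  {ν : Measure (Fin n → ℝ)} (hν : IsWeightLaw ν) {P : Measure (𝒳 × ℝ)} {c : Fin n → Λ}

/-- The weight of the cell `l` in the penalty. -/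
def penCoeff (ν : Measure (Fin n → ℝ)) (c : Fin n → Λ) (l : Λ) : ℝ :=
  R1 ν (fiber c l).card + R2 ν (fiber c l).card

/-- The mean of the penalty given the allocation `c` of the design points. -/
def penMean (C : ℝ) (ν : Measure (Fin n → ℝ)) (P : Measure (𝒳 × ℝ)) (cell : Λ → Set 𝒳)
    (c : Fin n → Λ) : ℝ :=
  C / n * ∑ l, penCoeff ν c l * if 2 ≤ (fiber c l).card then sigmaSq P cell l else 0

include h hν in
-- Once the allocation is fixed the index sets are deterministic, and only the responses remain
-- random.
theorem pen_of_mem_box (C : ℝ) {ω : Ω} (hω : ω ∈ box cell D c) :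
    pen C ν cell (fun i => D i ω) =
      C / n * ∑ l, penCoeff ν c l * sampleVar (fiber c l) fun i => resid P cell D c i ω := by
  rw [pen, div_mul_eq_mul_div, mul_div_assoc, Finset.sum_div]
  congr 1
  refine Finset.sum_congr rfl fun l _ => ?_
  rw [pen_cell_eq hν _ _ (beta P (cell l)), idxIn_of_mem_box h hω, penCoeff, div_mul_eq_mul_div]
  congr 2
  have : ∀ i ∈ fiber c l, (D i ω).2 - beta P (cell l) = resid P cell D c i ω := fun i hi => by
    rw [resid, mem_fiber.1 hi]
  simp only [sampleVar]
  rw [Finset.sum_congr rfl this, Finset.sum_congr rfl fun i hi => by rw [this i hi]]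

theorem sampleVar_of_card_le_one {ι : Type*} {s : Finset ι} (hs : s.card ≤ 1) (e : ι → ℝ) :
    sampleVar s e = 0 := by
  rcases Nat.le_one_iff_eq_zero_or_eq_one.1 hs with h0 | h1
  · simp [sampleVar, Finset.card_eq_zero.1 h0]
  · obtain ⟨x, rfl⟩ := Finset.card_eq_one.1 h1
    simp [sampleVar]

variable [MeasurableSpace Ω] {Pr : Measure Ω} [IsProbabilityMeasure Pr] 
  [IsProbabilityMeasure P] (hD : ∀ i, Measurable (D i)) (hind : iIndepFun D Pr)
  (hlaw : ∀ i, Pr.map (D i) = P) {a ξ : ℝ} (hmom : LocalMoment P cell a ξ) 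

/-- An integral over an event from the integral with respect to the conditional measure. -/
theorem integrableOn_and_setIntegral_eq {s : Set Ω} (hs : MeasurableSet s) {F G : Ω → ℝ} {v : ℝ}
    (hFG : ∀ ω ∈ s, F ω = G ω)
    (hG : Pr s ≠ 0 → Integrable G Pr[|s] ∧ ∫ ω, G ω ∂Pr[|s] = v) :
    IntegrableOn F s Pr ∧ ∫ ω in s, F ω ∂Pr = Pr.real s * v := by
  by_cases h0 : Pr s = 0
  · rw [IntegrableOn, Measure.restrict_eq_zero.2 h0]
    simp [Measure.real, h0]
  · obtain ⟨h1, h2⟩ := hG h0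
    rw [ProbabilityTheory.cond, integrable_smul_measure (ENNReal.inv_ne_zero.2 (measure_ne_top _ _))
      (ENNReal.inv_ne_top.2 h0)] at h1
    refine ⟨(integrableOn_congr_fun hFG hs).2 h1, ?_⟩
    rw [setIntegral_congr_fun hs hFG, ← h2, integral_cond_eq, mul_inv_cancel_left₀]
    exact (measureReal_ne_zero_iff).2 h0

include h hν hD hind hlaw hmom in
-- The sample variance is unbiased when a cell has at least two points and vanishes identically
-- otherwise, which explains the case distinction in `penMean`.
theorem setIntegral_pen (C : ℝ) (c : Fin n → Λ) :
    IntegrableOn (fun ω => pen C ν cell fun i => D i ω) (box cell D c) Pr ∧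
      ∫ ω in box cell D c, pen C ν cell (fun i => D i ω) ∂Pr =
        Pr.real (box cell D c) * penMean C ν P cell c := by
  refine integrableOn_and_setIntegral_eq (measurableSet_box h hD c)
    (fun ω hω => pen_of_mem_box (P := P) h hν C hω) fun hc => ?_
  have : IsProbabilityMeasure Pr[|box cell D c] := cond_isProbabilityMeasure hc
  have hL : ∀ i, MemLp (resid P cell D c i) 2 Pr[|box cell D c] := fun i => by
    exact_mod_cast memLp_resid_box h hD hind hlaw hc hmom (N := 2) le_rfl i
  have hint : ∀ l, Integrable (fun ω => sampleVar (fiber c l) fun i => resid P cell D c i ω)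
      Pr[|box cell D c] := fun l => integrable_sampleVar _ fun i _ => hL i
  refine ⟨(integrable_finsetSum _ fun l _ => (hint l).const_mul _).const_mul _, ?_⟩
  rw [integral_const_mul, integral_finsetSum _ fun l _ => (hint l).const_mul _, penMean]
  congr 1
  refine Finset.sum_congr rfl fun l _ => ?_
  rw [integral_const_mul]
  congr 1
  split_ifs with h2
  · refine integral_sampleVar (iIndepFun_resid h hD hind hlaw hc) _ h2
      (fun i _ => integral_resid_box h hD hind hlaw hc hmom i) (fun i _ => hL i) fun i hi => ?_
    rw [integral_resid_box_sq h hD hind hlaw hc, mem_fiber.1 hi]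
  · simp [sampleVar_of_card_le_one (show (fiber c l).card ≤ 1 by omega)]

include h hν hD hind hlaw hmom in
theorem integrable_pen (C : ℝ) : Integrable (fun ω => pen C ν cell fun i => D i ω) Pr := by
  rw [← integrableOn_univ, ← iUnion_box h D]
  exact integrableOn_finite_iUnion.2 fun c => (setIntegral_pen h hν hD hind hlaw hmom C c).1

include h hν hD hind hlaw hmom in
-- The generating map `T` is constant on each box, and each box is a preimage under `T`. Boxes are
-- therefore atoms of the σ-algebra, where the conditional expectation is the mean over the box.
theorem condExp_pen (C : ℝ) : ∀ᵐ ω ∂Pr, ∀ c, ω ∈ box cell D c →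
    (Pr[fun ω' => pen C ν cell (fun i => D i ω') | cellSigma cell D]) ω =
      penMean C ν P cell c := by
  set T : Ω → Fin n → Λ → ℝ :=
    fun ω i l => (cell l).indicator (fun _ => (1 : ℝ)) (D i ω).1 with hT
  have hbox : ∀ c, box cell D c = T ⁻¹' {y | ∀ i, y i (c i) = 1} := fun c => by
    ext ω
    rw [mem_box]
    simp [hT]
  have hconst : ∀ c, ∀ ω ∈ box cell D c, ∀ ω' ∈ box cell D c, T ω = T ω' := by
    intro c ω hω ω' hω'
    funext i l
    have h1 := mem_box.1 hω i
    have h2 := mem_box.1 hω' i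
    simp only [hT]
    have : (D i ω).1 ∈ cell l ↔ (D i ω').1 ∈ cell l :=
      ⟨fun h3 => h.eq_of_mem h1 h3 ▸ h2, fun h3 => h.eq_of_mem h2 h3 ▸ h1⟩
    by_cases h3 : (D i ω).1 ∈ cell l
    · rw [Set.indicator_of_mem h3, Set.indicator_of_mem (this.1 h3)]
    · rw [Set.indicator_of_notMem h3, Set.indicator_of_notMem (mt this.2 h3)]
  refine condExp_ae_eq_of_atoms ?_ (fun c => ?_) (exists_mem_box h D)
    (fun c c' ω hω hω' => box_unique h hω hω') ?_ (integrable_pen h hν hD hind hlaw hmom C)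
    fun c => (setIntegral_pen h hν hD hind hlaw hmom C c).2
  · refine Measurable.comap_le ?_
    refine measurable_pi_lambda _ fun i => measurable_pi_lambda _ fun l => ?_
    exact (measurable_const.indicator (h.measurableSet_cell l)).comp (measurable_fst.comp (hD i))
  · rw [hbox c]
    refine ⟨_, ?_, rfl⟩
    have : {y : Fin n → Λ → ℝ | ∀ i, y i (c i) = 1} = ⋂ i, (fun y => y i (c i)) ⁻¹' {1} := by
      ext y; simp
    rw [this]
    exact MeasurableSet.iInter fun i => 
      ((measurable_pi_apply (c i)).comp (measurable_pi_apply i)) (measurableSet_singleton 1)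
  · rintro s ⟨t, -, rfl⟩ c
    by_cases hne : ∃ ω ∈ box cell D c, T ω ∈ t
    · obtain ⟨ω, hω, hωt⟩ := hne
      left
      intro ω' hω'
      have := hconst c ω hω ω' hω'
      change T ω' ∈ t
      rwa [← this]
    · right
      exact Set.disjoint_left.2 fun ω hω hωt => hne ⟨ω, hω, hωt⟩

end Pen

/-! ### The mean of p₂ -/

section EmpiricalRisk

variable {𝒳 Λ Ω : Type*} [MeasurableSpace 𝒳] [Fintype Λ] [DecidableEq Λ] {n : ℕ} [NeZero n]
  {cell : Λ → Set 𝒳} {D : Fin n → Ω → 𝒳 × ℝ} (h : IsPartition cell)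
  {P : Measure (𝒳 × ℝ)} {c : Fin n → Λ}

theorem sum_sq_sub_sq_mean {ι : Type*} (s : Finset ι) (e : ι → ℝ) :
    ∑ i ∈ s, (e i ^ 2 - ((∑ j ∈ s, e j) / s.card - e i) ^ 2) = (∑ i ∈ s, e i) ^ 2 / s.card := by
  rcases s.eq_empty_or_nonempty with rfl | hs
  · simp
  have hk : (s.card : ℝ) ≠ 0 := by exact_mod_cast hs.card_pos.ne'
  have : ∀ i ∈ s, e i ^ 2 - ((∑ j ∈ s, e j) / s.card - e i) ^ 2 =
      2 * ((∑ j ∈ s, e j) / s.card) * e i - ((∑ j ∈ s, e j) / s.card) ^ 2 := fun i _ => by ring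
  rw [Finset.sum_congr rfl this, Finset.sum_sub_distrib, ← Finset.mul_sum]
  simp only [Finset.sum_const, nsmul_eq_mul]
  field_simp
  ring

include h in
theorem p2_of_mem_box {ω : Ω} (hω : ω ∈ box cell D c) :
    p2 P cell (fun i => D i ω) = 1 / n * ∑ l, ((∑ i ∈ fiber c l, resid P cell D c i ω) ^ 2 /
      (fiber c l).card + if (fiber c l).card = 0 then sigmaSq P cell l else 0) := by
  rw [p2, ← mul_add, Finset.sum_add_distrib]
  congr 2
  · rw [← Finset.sum_fiberwise (s := Finset.univ) (g := c)]
    refine Finset.sum_congr rfl fun l _ => ?_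
    rw [← sum_sq_sub_sq_mean]
    refine Finset.sum_congr rfl fun i hi => ?_
    have hi' : i ∈ fiber c l := hi
    have hil : c i = l := mem_fiber.1 hi'
    have hk : ((fiber c l).card : ℝ) ≠ 0 := by
      exact_mod_cast (Finset.card_pos.2 ⟨i, hi'⟩).ne'
    have hmem : (D i ω).1 ∈ cell l := hil ▸ mem_box.1 hω i
    have hs : ∑ j ∈ fiber c l, resid P cell D c j ω =
        ∑ j ∈ fiber c l, (D j ω).2 - (fiber c l).card * beta P (cell l) := by
      rw [← nsmul_eq_mul, ← Finset.sum_const, ← Finset.sum_sub_distrib]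
      exact Finset.sum_congr rfl fun j hj => by rw [resid, mem_fiber.1 hj]
    rw [contrast, contrast, sM, sHat, h.sum_indicator (fun l => beta P (cell l)) hmem,
      h.sum_indicator (fun l => betaHat (fun i => D i ω) (cell l)) hmem, betaHat_eq,
      idxIn_of_mem_box h hω, hs, resid, hil]
    field_simp
    ring
  · refine Finset.sum_congr rfl fun l _ => ?_
    rw [count_eq_card, idxIn_of_mem_box h hω]
    simp only [Nat.cast_eq_zero]

variable [MeasurableSpace Ω] {Pr : Measure Ω} [IsProbabilityMeasure Pr]
  [IsProbabilityMeasure P] (hD : ∀ i, Measurable (D i)) (hind : iIndepFun D Pr)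
  (hlaw : ∀ i, Pr.map (D i) = P) {a ξ : ℝ} (hmom : LocalMoment P cell a ξ)
include h hD hind hlaw hmom

/-- The mean over a box does not depend on the box: a nonempty cell contributes the variance of its
sum divided by its size, which is σ², and the convention for empty cells contributes the same σ². -/
theorem setIntegral_p2 (c : Fin n → Λ) :
    IntegrableOn (fun ω => p2 P cell fun i => D i ω) (box cell D c) Pr ∧
      ∫ ω in box cell D c, p2 P cell (fun i => D i ω) ∂Pr =
        Pr.real (box cell D c) * (1 / n * ∑ l, sigmaSq P cell l) := by
  refine integrableOn_and_setIntegral_eq (measurableSet_box h hD c)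
    (fun ω hω => p2_of_mem_box h hω) fun hc => ?_
  have : IsProbabilityMeasure Pr[|box cell D c] := cond_isProbabilityMeasure hc
  have hL : ∀ i, MemLp (resid P cell D c i) 2 Pr[|box cell D c] := fun i => by
    exact_mod_cast memLp_resid_box h hD hind hlaw hc hmom (N := 2) le_rfl i
  have hint : ∀ l, Integrable (fun ω => (∑ i ∈ fiber c l, resid P cell D c i ω) ^ 2 /
      ((fiber c l).card : ℝ)) Pr[|box cell D c] := fun l =>
    (integrable_sum_sq _ fun i _ => hL i).div_const _
  have hint' : ∀ l, Integrable (fun ω => (∑ i ∈ fiber c l, resid P cell D c i ω) ^ 2 /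
      ((fiber c l).card : ℝ) + if (fiber c l).card = 0 then sigmaSq P cell l else 0)
      Pr[|box cell D c] := fun l => (hint l).add (integrable_const _)
  refine ⟨(integrable_finsetSum _ fun l _ => hint' l).const_mul _, ?_⟩
  rw [integral_const_mul, integral_finsetSum _ fun l _ => hint' l]
  congr 1
  refine Finset.sum_congr rfl fun l _ => ?_
  rw [integral_add (hint l) (integrable_const _), integral_div,
    integral_sum_sq (iIndepFun_resid h hD hind hlaw hc) (fiber c l)
      (fun i _ => integral_resid_box h hD hind hlaw hc hmom i) (fun i _ => hL i)
      (v := sigmaSq P cell l) fun i hi => by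
        rw [integral_resid_box_sq h hD hind hlaw hc, mem_fiber.1 hi]]
  by_cases h0 : (fiber c l).card = 0
  · simp [h0]
  · have : ((fiber c l).card : ℝ) ≠ 0 := by exact_mod_cast h0
    simp only [h0, if_false, integral_zero, add_zero]
    field_simp

omit hmom hind hlaw [IsProbabilityMeasure P] [NeZero n] [DecidableEq Λ] in
theorem sum_measureReal_box : ∑ c, Pr.real (box cell D c) = 1 := by
  rw [← measureReal_iUnion_fintype (pairwise_disjoint_box h D) (measurableSet_box h hD),
    iUnion_box h]
  simp

theorem integral_p2 : ∫ ω, p2 P cell (fun i => D i ω) ∂Pr = 1 / n * ∑ l, sigmaSq P cell l := by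
  have h1 := integral_iUnion_fintype (μ := Pr) (measurableSet_box h hD) (pairwise_disjoint_box h D)
    fun c => (setIntegral_p2 h hD hind hlaw hmom c).1
  rw [iUnion_box h, Measure.restrict_univ] at h1
  rw [h1, Finset.sum_congr rfl fun c _ => (setIntegral_p2 h hD hind hlaw hmom c).2,
    ← Finset.sum_mul, sum_measureReal_box h hD, one_mul]

end EmpiricalRisk

/-! ### Deviation of the penalty on one box -/

section Deviation

variable {𝒳 Λ Ω : Type*} [MeasurableSpace 𝒳] [Fintype Λ] [DecidableEq Λ] {n : ℕ} [NeZero n]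
  {cell : Λ → Set 𝒳} {D : Fin n → Ω → 𝒳 × ℝ} (h : IsPartition cell)
  {P : Measure (𝒳 × ℝ)} {c : Fin n → Λ}

/-- The centred sum of weighted within-cell variances. -/
def penDev (ν : Measure (Fin n → ℝ)) (P : Measure (𝒳 × ℝ)) (cell : Λ → Set 𝒳)
    (D : Fin n → Ω → 𝒳 × ℝ) (c : Fin n → Λ) (ω : Ω) : ℝ :=
  ∑ l, penCoeff ν c l *
    (sampleVar (fiber c l) (fun i => resid P cell D c i ω) - sigmaSq P cell l)

variable {ν : Measure (Fin n → ℝ)} (hν : IsWeightLaw ν) {A : ℝ} (hA : 2 ≤ A)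
  (hcA : ∀ l, A ≤ ((fiber c l).card : ℝ))

include h hν hA hcA in
theorem pen_sub_penMean (C : ℝ) {ω : Ω} (hω : ω ∈ box cell D c) :
    pen C ν cell (fun i => D i ω) - penMean C ν P cell c = C / n * penDev ν P cell D c ω := by
  rw [pen_of_mem_box (P := P) h hν C hω, penMean, penDev, ← mul_sub, ← Finset.sum_sub_distrib]
  congr 1
  refine Finset.sum_congr rfl fun l _ => ?_
  have : 2 ≤ (fiber c l).card := by exact_mod_cast hA.trans (hcA l)
  rw [if_pos this, mul_sub]

theorem measurable_penDev [MeasurableSpace Ω] (hD : ∀ i, Measurable (D i)) :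
    Measurable (penDev ν P cell D c) :=
  Finset.measurable_sum _ fun l _ => (((measurable_sampleVar (fiber c l)).comp
    (measurable_pi_lambda _ fun i => measurable_resid P hD c i)).sub_const _).const_mul _

variable [MeasurableSpace Ω] {Pr : Measure Ω} [IsProbabilityMeasure Pr]
  [IsProbabilityMeasure P] (hD : ∀ i, Measurable (D i)) (hind : iIndepFun D Pr)
  (hlaw : ∀ i, Pr.map (D i) = P) {a ξ : ℝ} (hmom : LocalMoment P cell a ξ)

include h hν hA hcA hD hind hlaw hmom in
-- The moment of order 2p of a sample variance involves residuals to the power 4p, so the local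
-- moment condition is used at q = 4p.
theorem measureReal_lt_abs_penDev_le [Nonempty Λ] (hc : Pr (box cell D c) ≠ 0) (ha : 0 < a)
    {p : ℕ} (hp : 1 ≤ p) :
    (Pr[|box cell D c]).real {ω | Real.exp 1 * (57 * p * supR ν A * (a * (4 * p : ℝ) ^ ξ *
      ∑ l, sigmaSq P cell l) / Real.sqrt (A * Fintype.card Λ)) < |penDev ν P cell D c ω|} ≤
      Real.exp (-(2 * p)) := by
  have : IsProbabilityMeasure Pr[|box cell D c] := cond_isProbabilityMeasure hc
  have hR := hν.supR_nonneg A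
  have hS : 0 ≤ ∑ l, sigmaSq P cell l := Finset.sum_nonneg fun l _ => sigmaSq_nonneg l
  have hcard : (0 : ℝ) < Fintype.card Λ := by exact_mod_cast Fintype.card_pos
  have hA0 : 0 < A := by linarith
  have hN : 2 ≤ 2 * (2 * p) := by omega
  have hN0 : 2 * (2 * p) ≠ 0 := by omega
  have hev : Even (2 * (2 * p)) := even_two_mul _
  obtain ⟨h1, h2⟩ := integral_sum_sampleVar_pow_le (μ := Pr[|box cell D c])
    (e := resid P cell D c) (measurable_resid P hD c) (iIndepFun_resid h hD hind hlaw hc) c hA hcA hp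
    (integral_resid_box h hD hind hlaw hc hmom) (v := sigmaSq P cell)
    (m := mq P cell ((2 * (2 * p) : ℕ) : ℝ)) (fun l => mq_nonneg _ l)
    (integral_resid_box_sq h hD hind hlaw hc)
    (fun i => by
      simpa [hev.pow_abs] using (memLp_resid_box h hD hind hlaw hc hmom hN i).integrable_norm_pow hN0)
    (fun i => (integral_resid_box_pow h hD hind hlaw hc hN0 hev i).le)
    (r := penCoeff ν c) (R := supR ν A)
    (fun l => add_nonneg (hν.R1_nonneg _) (hν.R2_nonneg _))
    (fun l => le_supR (hcA l) ((Finset.card_le_univ _).trans_eq (Fintype.card_fin n)))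
  refine measureReal_lt_abs_le hp h1 (by positivity) (h2.trans ?_)
  rw [pow_mul]
  have h3 := sum_mq_pow_le h hmom ha hN hev
  have hm0 : 0 ≤ ∑ l, mq P cell ((2 * (2 * p) : ℕ) : ℝ) l ^ 4 :=
    Finset.sum_nonneg fun l _ => pow_nonneg (mq_nonneg _ l) 4
  refine pow_le_pow_left₀ (by positivity) ?_ p
  have h4 : ((2 * (2 * p) : ℕ) : ℝ) = 4 * p := by push_cast; ring
  rw [h4] at h3
  -- 57² = 3249 exceeds 3200, so that the square root is a plain number.
  calc 3200 * (p : ℝ) ^ 2 * supR ν A ^ 2 / A * ∑ l, mq P cell ((2 * (2 * p) : ℕ) : ℝ) l ^ 4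
      ≤ 57 ^ 2 * (p : ℝ) ^ 2 * supR ν A ^ 2 / A *
        ((a * (4 * p : ℝ) ^ ξ * ∑ l, sigmaSq P cell l) ^ 2 / Fintype.card Λ) := by
        rw [h4]
        gcongr
        norm_num
    _ = _ := by
        rw [div_pow, Real.sq_sqrt (by positivity)]
        field_simp

end Deviation

/-! ### Choice of the moment order -/

section Numerics

/-- The order is at most γ ln n + 2, and 2 ≤ 3 ln n because ln 2 > 0.69; this is where γ + 3 comes
from. -/
theorem natCeil_mul_log_bounds {γ : ℝ} (hγ : 0 < γ) {n : ℕ} (hn : 2 ≤ n) :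
    ((⌈γ * Real.log n⌉₊ + 1 : ℕ) : ℝ) ≤ (γ + 3) * Real.log n ∧
      Real.exp (-(2 * ((⌈γ * Real.log n⌉₊ + 1 : ℕ) : ℝ))) ≤ (n : ℝ) ^ (-γ) := by
  have hn' : (2 : ℝ) ≤ n := by exact_mod_cast hn
  have hL : 0.69 ≤ Real.log n := by
    have := Real.log_le_log (by norm_num) hn'
    linarith [Real.log_two_gt_d9]
  have h0 : 0 ≤ γ * Real.log n := by positivity
  have h1 := Nat.ceil_lt_add_one h0
  have h2 := Nat.le_ceil (γ * Real.log n)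
  push_cast
  refine ⟨by linarith, ?_⟩
  rw [Real.rpow_def_of_pos (by linarith)]
  refine Real.exp_le_exp.2 ?_
  linarith

theorem mul_four_mul_rpow_le {p q ξ : ℝ} (hp : 0 < p) (hpq : p ≤ q) (hξ : 0 < ξ) :
    p * (4 * p) ^ ξ ≤ 4 ^ ξ * q ^ (ξ + 1) := by
  rw [Real.mul_rpow (by norm_num) hp.le, mul_left_comm, mul_comm p, ← Real.rpow_add_one hp.ne']
  gcongr

end Numerics

/-! ### Concentration over all allocations -/

section Concentration

/-- The constant in front of the deviation bound. -/
def devConst (γ a ξ : ℝ) : ℝ := Real.exp 1 * 57 * a * 4 ^ ξ * (γ + 3) ^ (ξ + 1)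

theorem devConst_pos {γ a ξ : ℝ} (hγ : 0 < γ) (ha : 0 < a) : 0 < devConst γ a ξ := by
  unfold devConst
  positivity

variable {𝒳 Λ Ω : Type*} [MeasurableSpace 𝒳] [Fintype Λ] {n : ℕ} [NeZero n]
  {cell : Λ → Set 𝒳} {D : Fin n → Ω → 𝒳 × ℝ} (h : IsPartition cell)
  {P : Measure (𝒳 × ℝ)} {ν : Measure (Fin n → ℝ)} (hν : IsWeightLaw ν) {A : ℝ} (hA : 2 ≤ A)
  [MeasurableSpace Ω] {Pr : Measure Ω} [IsProbabilityMeasure Pr]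
  [IsProbabilityMeasure P] (hD : ∀ i, Measurable (D i)) (hind : iIndepFun D Pr)
  (hlaw : ∀ i, Pr.map (D i) = P) {γ a ξ : ℝ} (hγ : 0 < γ) (ha : 0 < a) (hξ : 0 < ξ)
  (hmom : LocalMoment P cell a ξ)

include h hν hA hD hind hlaw hγ ha hξ hmom in
theorem measureReal_devConst_lt_abs_penDev_le [DecidableEq Λ] [Nonempty Λ] (hn : 2 ≤ n)
    {c : Fin n → Λ} (hcA : ∀ l, A ≤ ((fiber c l).card : ℝ)) (hc : Pr (box cell D c) ≠ 0) :
    (Pr[|box cell D c]).real {ω | devConst γ a ξ * supR ν A * (Real.log n ^ (ξ + 1) /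
      Real.sqrt (A * Fintype.card Λ)) * ∑ l, sigmaSq P cell l < |penDev ν P cell D c ω|} ≤
      (n : ℝ) ^ (-γ) := by
  have : IsProbabilityMeasure Pr[|box cell D c] := cond_isProbabilityMeasure hc
  obtain ⟨h1, h2⟩ := natCeil_mul_log_bounds hγ hn
  set p := ⌈γ * Real.log n⌉₊ + 1 with hp
  refine le_trans (measureReal_mono fun ω hω => ?_) ((measureReal_lt_abs_penDev_le h hν hA hcA hD
    hind hlaw hmom hc ha (p := p) (by omega)).trans h2)
  refine lt_of_le_of_lt ?_ (Set.mem_ofPred_eq ▸ hω :)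
  have hp0 : (0 : ℝ) < p := by exact_mod_cast (by omega : 0 < p)
  have hS : 0 ≤ ∑ l, sigmaSq P cell l := Finset.sum_nonneg fun l _ => sigmaSq_nonneg l
  have hL : 0 ≤ Real.log n := Real.log_natCast_nonneg n
  have hR := hν.supR_nonneg A
  have h3 := mul_four_mul_rpow_le hp0 h1 hξ
  rw [Real.mul_rpow (by linarith) hL] at h3
  calc _ = Real.exp 1 * 57 * a * supR ν A * (p * (4 * p : ℝ) ^ ξ) *
        (∑ l, sigmaSq P cell l) / Real.sqrt (A * Fintype.card Λ) := by ring
    _ ≤ Real.exp 1 * 57 * a * supR ν A *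
        (4 ^ ξ * ((γ + 3) ^ (ξ + 1) * Real.log n ^ (ξ + 1))) *
        (∑ l, sigmaSq P cell l) / Real.sqrt (A * Fintype.card Λ) := by gcongr
    _ = _ := by rw [devConst]; ring

include h hν hA hD hind hlaw hγ ha hξ hmom in
/-- Concentration of the resampling penalty around its mean given the allocation of the design
points. -/
theorem exists_event_abs_pen_sub_condExp_le {C : ℝ} (hC : 0 ≤ C) :
    ∃ E : Set Ω, MeasurableSet E ∧ 1 - 1 * (n : ℝ) ^ (-γ) ≤ Pr.real E ∧
      ∀ ω ∈ E, |pen C ν cell (fun i => D i ω) -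
          (Pr[fun ω' => pen C ν cell (fun i => D i ω') | cellSigma cell D]) ω| *
          (occEvent cell D A).indicator (fun _ => (1 : ℝ)) ω
        ≤ C * devConst γ a ξ * supR ν A *
          (Real.log n ^ (ξ + 1) / Real.sqrt (A * (Fintype.card Λ : ℝ))) *
          ∫ ω', p2 P cell (fun i => D i ω') ∂Pr := by
  classical
  -- For n = 1 the required probability is 0 and the empty event suffices; the choice of the moment
  -- order needs n ≥ 2.
  rcases (show n = 1 ∨ 2 ≤ n by have := NeZero.ne n; omega) with rfl | hn
  · exact ⟨∅, MeasurableSet.empty, by simp, fun ω hω => absurd hω (Set.notMem_empty ω)⟩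
  have : Nonempty Λ := by
    obtain ⟨ω⟩ := nonempty_of_isProbabilityMeasure Pr
    exact ⟨(exists_mem_box h D ω).choose 0⟩
  have hS : 0 ≤ ∑ l, sigmaSq P cell l := Finset.sum_nonneg fun l _ => sigmaSq_nonneg l
  have hL : 0 ≤ Real.log n := Real.log_natCast_nonneg n
  have hR := hν.supR_nonneg A
  have hK := devConst_pos (ξ := ξ) hγ ha
  -- `N` is a measurable set of full measure on which the conditional expectation takes its explicit
  -- value, for all boxes at once.
  obtain ⟨N, hN, hNm, hNs⟩ :=
    (condExp_pen h hν hD hind hlaw hmom C).exists_measurable_mem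
  set b : ℝ := devConst γ a ξ * supR ν A * (Real.log n ^ (ξ + 1) /
      Real.sqrt (A * Fintype.card Λ)) * ∑ l, sigmaSq P cell l with hb
  set bad : (Fin n → Λ) → Set Ω := fun c => {ω | b < |penDev ν P cell D c ω|} with hbad
  have hbadm : ∀ c, MeasurableSet (bad c) := fun c =>
    measurableSet_lt measurable_const (measurable_penDev hD).abs
  -- Only allocations that fill every cell with at least A points can be bad; elsewhere the
  -- indicator kills the left-hand side.
  set U : Set Ω := ⋃ c ∈ Finset.univ.filter fun c : Fin n → Λ => ∀ l, A ≤ ((fiber c l).card : ℝ),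
    box cell D c ∩ bad c with hU
  have hUm : MeasurableSet U := Finset.measurableSet_biUnion _ fun c _ =>
    (measurableSet_box h hD c).inter (hbadm c)
  have hUle : Pr.real U ≤ (n : ℝ) ^ (-γ) := by
    have h0 : (0 : ℝ) ≤ (n : ℝ) ^ (-γ) := by positivity
    -- The conditional bound is the same for all boxes and their probabilities sum to 1, so the
    -- union over allocations costs no factor.
    calc Pr.real U ≤ ∑ c ∈ Finset.univ.filter fun c : Fin n → Λ =>
          ∀ l, A ≤ ((fiber c l).card : ℝ), Pr.real (box cell D c ∩ bad c) :=
          measureReal_biUnion_finset_le _ _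
      _ ≤ ∑ c ∈ Finset.univ.filter fun c : Fin n → Λ =>
          ∀ l, A ≤ ((fiber c l).card : ℝ), Pr.real (box cell D c) * (n : ℝ) ^ (-γ) := by
          refine Finset.sum_le_sum fun c hc => ?_
          by_cases hc0 : Pr (box cell D c) = 0
          · have : Pr (box cell D c ∩ bad c) = 0 := measure_mono_null Set.inter_subset_left hc0
            simp [Measure.real, hc0, this]
          · have h1 := measureReal_devConst_lt_abs_penDev_le h hν hA hD hind hlaw hγ ha hξ hmom hn
              (Finset.mem_filter.1 hc).2 hc0
            rw [measureReal_def, cond_apply (measurableSet_box h hD c), ENNReal.toReal_mul,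
              ENNReal.toReal_inv] at h1
            exact (inv_mul_le_iff₀ (ENNReal.toReal_pos hc0 (measure_ne_top _ _))).1 h1
      _ ≤ ∑ c, Pr.real (box cell D c) * (n : ℝ) ^ (-γ) :=
          Finset.sum_le_sum_of_subset_of_nonneg (Finset.filter_subset _ _) fun c _ _ =>
            mul_nonneg measureReal_nonneg h0
      _ = (n : ℝ) ^ (-γ) := by rw [← Finset.sum_mul, sum_measureReal_box h hD, one_mul]
  refine ⟨N ∩ Uᶜ, hNm.inter hUm.compl, ?_, fun ω hω => ?_⟩
  · have h1 : Pr.real (N ∩ Uᶜ) = Pr.real Uᶜ :=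
      measureReal_congr (Filter.inter_eventuallyEq_right.2 (Filter.mem_of_superset hN fun ω hω _ => hω))
    rw [h1, probReal_compl_eq_one_sub hUm]
    linarith
  · rw [integral_p2 h hD hind hlaw hmom]
    by_cases hocc : ω ∈ occEvent cell D A
    · rw [Set.indicator_of_mem hocc, mul_one]
      obtain ⟨c, hc⟩ := exists_mem_box h D ω
      have hcA : ∀ l, A ≤ ((fiber c l).card : ℝ) := fun l => by
        rw [← idxIn_of_mem_box h hc, ← count_eq_card]
        exact hocc l
      have hnb : |penDev ν P cell D c ω| ≤ b := by
        by_contra hlt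
        exact hω.2 (Set.mem_biUnion (Finset.mem_filter.2 ⟨Finset.mem_univ c, hcA⟩)
          ⟨hc, not_le.1 hlt⟩)
      rw [hNs ω hω.1 c hc, pen_sub_penMean h hν hA hcA C hc, abs_mul,
        abs_of_nonneg (by positivity : 0 ≤ C / (n : ℝ))]
      refine (mul_le_mul_of_nonneg_left hnb (by positivity)).trans_eq ?_
      rw [hb]
      ring
    · rw [Set.indicator_of_notMem hocc, mul_zero]
      positivity

end Concentration

end HistRP

end

/-! ### The main theorem -/

theorem proposition3 :
    ∃ K₄ : ℝ, 0 < K₄ ∧ ∃ L : ℝ, 0 < L ∧ ∃ K_W : HistRP.Scheme → ℝ,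
      (∀ S, 0 < K_W S) ∧
      (∀ p : ℝ, 0 < p → p < 1 → K_W (HistRP.Scheme.rad p) ≤ L / (1 - p)) ∧
      (∀ S, (∀ p, S ≠ HistRP.Scheme.rad p) → K_W S ≤ L) ∧
      ∀ γ a ξ : ℝ, 0 < γ → 0 < a → 0 < ξ → ∃ K₅ : ℝ, 0 < K₅ ∧
        ∀ (𝒳 : Type*) [MeasurableSpace 𝒳] (Λ : Type*) [Fintype Λ]
          (Ω : Type*) [MeasurableSpace Ω] (Pr : Measure Ω) [IsProbabilityMeasure Pr]
          (P : Measure (𝒳 × ℝ)) [IsProbabilityMeasure P] (n : ℕ) [NeZero n]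
          (C A : ℝ) (cell : Λ → Set 𝒳) (D : Fin n → Ω → 𝒳 × ℝ) (W : Ω → Fin n → ℝ),
          0 ≤ C → 2 ≤ A →
          HistRP.IsPartition cell →
          -- the data `(X_i, Y_i) = D i` are i.i.d. with common law `P`
          (∀ i, Measurable (D i)) → iIndepFun D Pr → (∀ i, Pr.map (D i) = P) →
          -- `W` is an exchangeable weight vector, independent of the data
          Measurable W → IndepFun W (fun ω i => D i ω) Pr → HistRP.IsWeightLaw (Pr.map W) →
          HistRP.LocalMoment P cell a ξ →
          ∃ E : Set Ω, MeasurableSet E ∧ 1 - K₄ * (n : ℝ) ^ (-γ) ≤ Pr.real E ∧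
            ∀ ω ∈ E,
              |HistRP.pen C (Pr.map W) cell (fun i => D i ω) -
                  (Pr[fun ω' => HistRP.pen C (Pr.map W) cell (fun i => D i ω') |
                    HistRP.cellSigma cell D]) ω| *
                  (HistRP.occEvent cell D A).indicator (fun _ => (1 : ℝ)) ω
                ≤ C * K₅ * HistRP.supR (Pr.map W) A *
                  (Real.log n ^ (ξ + 1) / Real.sqrt (A * (Fintype.card Λ : ℝ))) *
                  ∫ ω', HistRP.p2 P cell (fun i => D i ω') ∂Pr ∧
              ∀ S : HistRP.Scheme, S.Valid n → Pr.map W = S.law n →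
                |HistRP.pen C (Pr.map W) cell (fun i => D i ω) -
                    (Pr[fun ω' => HistRP.pen C (Pr.map W) cell (fun i => D i ω') |
                      HistRP.cellSigma cell D]) ω| *
                    (HistRP.occEvent cell D A).indicator (fun _ => (1 : ℝ)) ω
                  ≤ C * K₅ * K_W S * Real.log n ^ (ξ + 1) /
                      (S.CW n * Real.sqrt (A * (Fintype.card Λ : ℝ))) *
                    ∫ ω', HistRP.p2 P cell (fun i => D i ω') ∂Pr := by
  -- K₄ = 1 because the tail bound is exactly n^{-γ}; 7 is the absolute constant in `schemeConst`.
  refine ⟨1, one_pos, 7, by norm_num, HistRP.schemeConst, HistRP.schemeConst_pos, ?_, ?_, ?_⟩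
  · intro p hp hp1
    simp [HistRP.schemeConst, hp, hp1]
  · intro S hS
    cases S with
    | rad p => exact absurd rfl (hS p)
    | _ => simp [HistRP.schemeConst]
  intro γ a ξ hγ ha hξ
  refine ⟨HistRP.devConst γ a ξ, HistRP.devConst_pos hγ ha, ?_⟩
  intro 𝒳 _ Λ _ Ω _ Pr _ P _ n _ C A cell D W hC hA h hD hind hlaw _ _ hν hmom
  obtain ⟨E, hE, hPE, hle⟩ := HistRP.exists_event_abs_pen_sub_condExp_le h hν hA hD hind hlaw hγ
    ha hξ hmom hC
  refine ⟨E, hE, hPE, fun ω hω => ⟨hle ω hω, fun S hS hlawS => (hle ω hω).trans ?_⟩⟩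
  -- The scheme-specific inequality follows pointwise from the general one, so it holds on the same
  -- event. A ≥ 2 ensures that only cell counts k ≥ 2 enter the supremum.
  have hsup : HistRP.supR (Pr.map W) A ≤ HistRP.schemeConst S / S.CW n := by
    rw [hlawS] at hν ⊢
    exact HistRP.Scheme.supR_le hS hν hA
  have hp2 : 0 ≤ ∫ ω', HistRP.p2 P cell (fun i => D i ω') ∂Pr := by
    classical
    rw [HistRP.integral_p2 h hD hind hlaw hmom]
    exact mul_nonneg (by positivity) (Finset.sum_nonneg fun l _ => HistRP.sigmaSq_nonneg l)
  have hK := HistRP.devConst_pos (ξ := ξ) hγ ha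
  have hL : 0 ≤ Real.log n := Real.log_natCast_nonneg n
  refine mul_le_mul_of_nonneg_right ?_ hp2
  calc _ ≤ C * HistRP.devConst γ a ξ * (HistRP.schemeConst S / S.CW n) *
        (Real.log n ^ (ξ + 1) / Real.sqrt (A * (Fintype.card Λ : ℝ))) := by gcongr
    _ = _ := by rw [mul_assoc, div_mul_div_comm, ← mul_div_assoc]; ring
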